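/- Let $N_6$ denote the closed non-orientable surface of genus $6$, i.e. the connected sum of six projective planes; concretely, the quotient of a $12$-gon by the boundary identification $a_1a_1a_2a_2\cdots a_6a_6$. A triangulation of $N_6$ is a (finite, abstract) two-dimensional simplicial complex $\Delta$ whose underlying space $|\Delta|$ is homeomorphic to $N_6$. A map $\psi\colon V\to\mathbb R^3$ on the vertex set $V$ of $\Delta$ induces a simplexwise linear map $\phi_\psi\colon|\Delta|\to\mathbb R^3$; it is called a polyhedral immersion if $\phi_\psi$ is locally injective. It has $2$-fold rotational symmetry if there are a rotation $\rho$ of $\mathbb R^3$ of order $2$ about an axis and a simplicial automorphism $\sigma$ of $\Delta$ such that $\rho\circ\phi_\psi=\phi_\psi\circ|\sigma|$. **Theorem.** The minimal number of vertices of a triangulation of $N_6$ is $10$, and some $10$-vertex triangulation of $N_6$ has a polyhedral immersion into $\mathbb R^3$ with $2$-fold rotational symmetry. In particular, $10$ is the minimal number of vertices of a triangulation of $N_6$ that admits a polyhedral immersion into $\mathbb R^3$. -/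

import Mathlib

noncomputable section

/-- The closed unit disc in the complex plane. -/
abbrev UnitDisc : Type := Metric.closedBall (0 : ℂ) 1

/-- The unit circle is divided into the `2 * h` arcs
`A k = {exp (2 * π * i * (k + t) / (2 * h)) | 0 ≤ t ≤ 1}` for `k = 0, …, 2 * h - 1`.
The arcs `A (2 * j)` and `A (2 * j + 1)` are identified, both traversed in the positive direction.
This is the labelling `a₁ a₁ a₂ a₂ … a_h a_h` of the boundary of a `2 * h`-gon. -/
def crossCapGluing (h : ℕ) (z w : UnitDisc) : Prop :=
  ∃ j : Fin h, ∃ t ∈ Set.Icc (0 : ℝ) 1,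
    (z : ℂ) = Complex.exp (2 * Real.pi * Complex.I * ((2 * (j : ℕ) + t) / (2 * h))) ∧
    (w : ℂ) = Complex.exp (2 * Real.pi * Complex.I * ((2 * (j : ℕ) + 1 + t) / (2 * h)))

/-- The closed non-orientable surface `N_h` of genus `h ≥ 1` (the connected sum of `h` projective
planes), as the quotient space of the `2 * h`-gon with boundary word `a₁ a₁ a₂ a₂ … a_h a_h`.
`Quot` divides by the equivalence relation generated by the gluing and carries the quotient
topology. -/
abbrev NonorientableSurface (h : ℕ) : Type := Quot (crossCapGluing h)

namespace AbstractSimplicialComplex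

variable {V : Type*} [Fintype V]

/-- The underlying space `|Δ|` of a finite simplicial complex: the points of the standard simplex
on the vertex set (in barycentric coordinates) that are supported on a face of `Δ`. It carries the
subspace topology. -/
def space (Δ : AbstractSimplicialComplex V) : Set (V → ℝ) :=
  {x | x ∈ stdSimplex ℝ V ∧ ∃ s ∈ Δ.faces, ∀ v, x v ≠ 0 → v ∈ s}

/-- `Δ` is two-dimensional: its largest faces are triangles. -/
def IsTwoDimensional (Δ : AbstractSimplicialComplex V) : Prop :=
  (∀ s ∈ Δ.faces, s.card ≤ 3) ∧ ∃ s ∈ Δ.faces, s.card = 3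

/-- `Δ` is a triangulation of the surface `S`: a two-dimensional simplicial complex whose underlying
space is homeomorphic to `S`. -/
def Triangulates (Δ : AbstractSimplicialComplex V) (S : Type*) [TopologicalSpace S] : Prop :=
  Δ.IsTwoDimensional ∧ Nonempty (Δ.space ≃ₜ S)

/-- The simplexwise linear map determined by the positions `ψ v` of the vertices, in barycentric
coordinates. Its restriction to `Δ.space` is the map `|Δ| → ℝ³` induced by `ψ`. -/
def linearMapOfVertices (ψ : V → EuclideanSpace ℝ (Fin 3)) (x : V → ℝ) :
    EuclideanSpace ℝ (Fin 3) :=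
  ∑ v, x v • ψ v

/-- `ψ` induces a polyhedral immersion of `Δ` into `ℝ³`: the induced simplexwise linear map
`|Δ| → ℝ³` is locally injective. -/
def IsPolyhedralImmersion (Δ : AbstractSimplicialComplex V)
    (ψ : V → EuclideanSpace ℝ (Fin 3)) : Prop :=
  ∀ x : Δ.space, ∃ U ∈ nhds x, Set.InjOn (fun y : Δ.space => linearMapOfVertices ψ y) U

/-- The permutation `σ` of the vertices is an automorphism of `Δ`. -/
def IsAutomorphism (Δ : AbstractSimplicialComplex V) (σ : Equiv.Perm V) : Prop :=
  ∀ s : Finset V, s ∈ Δ.faces ↔ s.map σ.toEmbedding ∈ Δ.faces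

end AbstractSimplicialComplex

/-- `ρ` is a `k`-fold rotation of `ℝ³`: an orientation-preserving isometry with a fixed point
(hence a rotation about an axis through it) that has order exactly `k`. -/
def IsRotationOfOrder (k : ℕ)
    (ρ : EuclideanSpace ℝ (Fin 3) ≃ᵃⁱ[ℝ] EuclideanSpace ℝ (Fin 3)) : Prop :=
  (∃ p, ρ p = p) ∧
  LinearMap.det
    (ρ.linearIsometryEquiv : EuclideanSpace ℝ (Fin 3) →ₗ[ℝ] EuclideanSpace ℝ (Fin 3)) = 1 ∧
  orderOf ρ = k

namespace AbstractSimplicialComplex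

variable {V : Type*} [Fintype V]

/-- The simplexwise linear map `|Δ| → ℝ³` induced by `ψ` has `k`-fold rotational symmetry: some
`k`-fold rotation `ρ` of `ℝ³` is induced by an automorphism `σ` of `Δ`. The automorphism acts
on `|Δ|` by sending the point with barycentric coordinates `x` to the one with coordinates
`x ∘ σ⁻¹`. -/
def HasRotationalSymmetry (Δ : AbstractSimplicialComplex V)
    (ψ : V → EuclideanSpace ℝ (Fin 3)) (k : ℕ) : Prop :=
  ∃ ρ : EuclideanSpace ℝ (Fin 3) ≃ᵃⁱ[ℝ] EuclideanSpace ℝ (Fin 3), IsRotationOfOrder k ρ ∧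
    ∃ σ : Equiv.Perm V, Δ.IsAutomorphism σ ∧
      ∀ x ∈ Δ.space, ρ (linearMapOfVertices ψ x) = linearMapOfVertices ψ (x ∘ σ.symm)

end AbstractSimplicialComplex

end

/-!
For the existence of the triangulation, exchanges `σ * ∂τ * K ↔ ∂σ * τ * K` (bistellar moves and
subdivisions) are realized by piecewise linear homeomorphisms which push mass from `σ` to `τ`. They
turn the polygon, as a cone over a cycle of length `48`, into another triangulated disc; glueing the
boundary of this disc gives a triangulated surface, and further exchanges reduce that surface to a
complex with ten vertices. Its immersion has integral coordinates: any two faces with a common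
vertex `v` are separated by a plane through `v`, so the map is injective on the star of `v`.

For the lower bound, let `Δ` be any triangulation of `N_6`, with `n` vertices, `E` edges and `T`
triangles. By invariance of domain in the plane, its homeomorphism to the ten-vertex complex shows
that every edge of `Δ` is in two triangles, so `3 * T = 2 * E`. Classes in the first cohomology
modulo two are the holonomies of line fields, and line fields can be pulled back along the
homeomorphism; hence `Δ` has `2 ^ 6` such classes. The dense open cell of `N_6` shows that `|Δ|` is
connected, even without its vertices, so the coboundary maps modulo two have ranks at least `n - 1`
and `T - 1`. Thus `n.choose 2 ≥ E ≥ (n - 1) + (T - 1) + 6`, which fails for `n < 10`.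
-/

open Finset Function

/-! ### Exchanges of simplices -/

noncomputable section Polyhedron

variable {V : Type*}

/-- The union of the simplices spanned by the sets in `𝒯`, in barycentric coordinates. The vertex
set `V` may be infinite, so that complexes whose vertices are natural numbers need no bound. -/
def polyhedron (𝒯 : Set (Finset V)) : Set (V → ℝ) :=
  {x | 0 ≤ x ∧ ∑ᶠ i, x i = 1 ∧ ∃ t ∈ 𝒯, support x ⊆ t}

theorem polyhedron_mono {𝒯 𝒯' : Set (Finset V)} (h : ∀ t ∈ 𝒯, ∃ q ∈ 𝒯', t ⊆ q) :
    polyhedron 𝒯 ⊆ polyhedron 𝒯' := by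
  rintro x ⟨hx, hsum, t, ht, hxt⟩
  obtain ⟨q, hq, htq⟩ := h t ht
  exact ⟨hx, hsum, q, hq, hxt.trans (coe_subset.2 htq)⟩

theorem space_eq_polyhedron [Fintype V] (Δ : AbstractSimplicialComplex V) :
    Δ.space = polyhedron Δ.faces := by
  ext x
  simp only [AbstractSimplicialComplex.space, polyhedron, stdSimplex, Set.mem_ofPred_eq,
    finsum_eq_sum_of_fintype, and_assoc]
  rfl

/-- The least barycentric coordinate of `x` at the vertices in `σ`. -/
def minCoord {σ : Finset V} (hσ : σ.Nonempty) (x : V → ℝ) : ℝ :=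
  σ.inf' hσ x

variable {σ : Finset V} {x : V → ℝ}

theorem minCoord_le (hσ : σ.Nonempty) {i : V} (hi : i ∈ σ) : minCoord hσ x ≤ x i :=
  inf'_le x hi

theorem minCoord_nonneg (hσ : σ.Nonempty) (hx : 0 ≤ x) : 0 ≤ minCoord hσ x :=
  le_inf' hσ x fun i _ => hx i

theorem minCoord_eq_zero (hσ : σ.Nonempty) (hx : 0 ≤ x) (h : ¬ (σ : Set V) ⊆ support x) :
    minCoord hσ x = 0 := by
  obtain ⟨i, hi, hxi⟩ := Set.not_subset.1 h
  exact le_antisymm ((minCoord_le hσ hi).trans_eq (notMem_support.1 hxi)) (minCoord_nonneg hσ hx)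

end Polyhedron

noncomputable section Exchange

variable {V : Type*} [DecidableEq V] {σ τ : Finset V} {𝒯 𝒯' : Set (Finset V)} {x : V → ℝ}

/-- Moves the largest possible mass, in equal parts, from the vertices in `σ` to the vertices in
`τ`. -/
def pushMass (hσ : σ.Nonempty) (τ : Finset V) (x : V → ℝ) (i : V) : ℝ :=
  x i + minCoord hσ x * ((if i ∈ τ then (#σ : ℝ) / #τ else 0) - if i ∈ σ then 1 else 0)

theorem continuous_pushMass (hσ : σ.Nonempty) (τ : Finset V) : Continuous (pushMass hσ τ) := by
  have hmin : Continuous (minCoord hσ) :=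
    Continuous.finset_inf'_apply hσ fun i _ => continuous_apply i
  exact continuous_pi fun i => (continuous_apply i).add (hmin.mul continuous_const)

theorem pushMass_eq_self (hσ : σ.Nonempty) (hx : 0 ≤ x) (h : ¬ (σ : Set V) ⊆ support x) :
    pushMass hσ τ x = x := by
  ext i
  simp only [pushMass, minCoord_eq_zero hσ hx h, zero_mul, add_zero]

theorem pushMass_nonneg (hσ : σ.Nonempty) (hx : 0 ≤ x) : 0 ≤ pushMass hσ τ x := by
  intro i
  have hmin := minCoord_nonneg hσ hx
  have hgain : 0 ≤ minCoord hσ x * if i ∈ τ then (#σ : ℝ) / #τ else 0 := by positivity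
  have hloss : minCoord hσ x * (if i ∈ σ then 1 else 0) ≤ x i := by
    split_ifs with hi
    · simpa only [mul_one] using minCoord_le hσ hi
    · simpa using hx i
  simp only [pushMass, Pi.zero_apply, mul_sub]
  linarith

theorem finsum_pushMass (hσ : σ.Nonempty) (hτ : τ.Nonempty) (hx : (support x).Finite) :
    ∑ᶠ i, pushMass hσ τ x i = ∑ᶠ i, x i := by
  have hcτ : (#τ : ℝ) ≠ 0 := Nat.cast_ne_zero.2 hτ.card_pos.ne'
  set shift : V → ℝ := fun i =>
    minCoord hσ x * ((if i ∈ τ then (#σ : ℝ) / #τ else 0) - if i ∈ σ then 1 else 0)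
  have hshift : support shift ⊆ ↑(σ ∪ τ) := fun i => by
    contrapose
    simp +contextual [shift]
  have hsum : ∑ᶠ i, shift i = 0 := by
    rw [finsum_eq_sum_of_support_subset _ hshift, ← mul_sum, sum_sub_distrib, sum_ite_mem,
      sum_ite_mem, union_inter_cancel_right, union_inter_cancel_left]
    simp [mul_div_cancel₀ _ hcτ]
  calc ∑ᶠ i, pushMass hσ τ x i = ∑ᶠ i, x i + ∑ᶠ i, shift i :=
        finsum_add_distrib hx ((σ ∪ τ).finite_toSet.subset hshift)
    _ = ∑ᶠ i, x i := by rw [hsum, add_zero]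

theorem pushMass_pushMass (hσ : σ.Nonempty) (hτ : τ.Nonempty) (hστ : Disjoint σ τ)
    (hx : 0 ≤ x) (h : ¬ (τ : Set V) ⊆ support x) :
    pushMass hτ σ (pushMass hσ τ x) = x := by
  have hcσ : (#σ : ℝ) ≠ 0 := Nat.cast_ne_zero.2 hσ.card_pos.ne'
  have hcτ : (#τ : ℝ) ≠ 0 := Nat.cast_ne_zero.2 hτ.card_pos.ne'
  have hpush : ∀ i ∈ τ, pushMass hσ τ x i = x i + minCoord hσ x * (#σ / #τ) := fun i hi => by
    simp [pushMass, hi, disjoint_right.1 hστ hi]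
  have hmin : minCoord hτ (pushMass hσ τ x) = minCoord hσ x * (#σ / #τ) := by
    calc minCoord hτ (pushMass hσ τ x) = minCoord hτ x + minCoord hσ x * (#σ / #τ) := by
          rw [minCoord, inf'_congr hτ rfl hpush]
          exact (map_finset_inf' (OrderIso.addRight (minCoord hσ x * (#σ / #τ))) hτ x).symm
      _ = minCoord hσ x * (#σ / #τ) := by rw [minCoord_eq_zero hτ hx h, zero_add]
  ext i
  rw [pushMass, hmin, pushMass]
  by_cases hiσ : i ∈ σ <;> by_cases hiτ : i ∈ τ
  · exact absurd hiτ (disjoint_left.1 hστ hiσ)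
  all_goals
    simp only [hiσ, hiτ, if_true, if_false]
    field_simp
    ring

theorem exists_support_pushMass_subset (hσ : σ.Nonempty) (hστ : Disjoint σ τ) (hx : 0 ≤ x)
    {t : Finset V} (hxt : support x ⊆ t) :
    ∃ i ∈ σ, support (pushMass hσ τ x) ⊆ (t ∪ τ).erase i := by
  obtain ⟨i, hi, hmin⟩ := exists_mem_eq_inf' hσ x
  refine ⟨i, hi, fun j hj => mem_coe.2 <| mem_erase.2 ⟨?_, mem_union.2 ?_⟩⟩
  · rintro rfl
    exact hj (by simp [pushMass, minCoord, hmin, hi, disjoint_left.1 hστ hi])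
  · by_contra! hjt
    have hxj : x j = 0 := notMem_support.1 fun h => hjt.1 (hxt h)
    refine hj ?_
    by_cases hjσ : j ∈ σ
    · simp [pushMass, hxj, minCoord_eq_zero hσ hx fun h => h (mem_coe.2 hjσ) hxj]
    · simp [pushMass, hxj, hjσ, hjt.2]

/-- Combinatorial condition under which `pushMass` from `σ` to `τ` sends the polyhedron of `𝒯` to
that of `𝒯'`, and is undone by the opposite push. -/
structure Pushes (σ τ : Finset V) (𝒯 𝒯' : Set (Finset V)) : Prop where
  not_subset : ∀ t ∈ 𝒯, ¬ τ ⊆ t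
  keep : ∀ t ∈ 𝒯, ¬ σ ⊆ t → ∃ q ∈ 𝒯', t ⊆ q
  replace : ∀ t ∈ 𝒯, σ ⊆ t → ∀ i ∈ σ, ∃ q ∈ 𝒯', (t ∪ τ).erase i ⊆ q

namespace Pushes

theorem mapsTo (h : Pushes σ τ 𝒯 𝒯') (hσ : σ.Nonempty) (hτ : τ.Nonempty) (hστ : Disjoint σ τ) :
    Set.MapsTo (pushMass hσ τ) (polyhedron 𝒯) (polyhedron 𝒯') := by
  rintro x ⟨hx, hsum, t, ht, hxt⟩
  refine ⟨pushMass_nonneg hσ hx, ?_, ?_⟩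
  · rw [finsum_pushMass hσ hτ (t.finite_toSet.subset hxt), hsum]
  · by_cases hσt : σ ⊆ t
    · obtain ⟨i, hi, hsupp⟩ := exists_support_pushMass_subset hσ hστ hx hxt
      obtain ⟨q, hq, hqt⟩ := h.replace t ht hσt i hi
      exact ⟨q, hq, hsupp.trans (coe_subset.2 hqt)⟩
    · obtain ⟨q, hq, htq⟩ := h.keep t ht hσt
      rw [pushMass_eq_self hσ hx fun hσx => hσt (coe_subset.1 (hσx.trans hxt))]
      exact ⟨q, hq, hxt.trans (coe_subset.2 htq)⟩

theorem leftInvOn (h : Pushes σ τ 𝒯 𝒯') (hσ : σ.Nonempty) (hτ : τ.Nonempty)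
    (hστ : Disjoint σ τ) :
    Set.LeftInvOn (pushMass hτ σ) (pushMass hσ τ) (polyhedron 𝒯) := by
  rintro x ⟨hx, -, t, ht, hxt⟩
  exact pushMass_pushMass hσ hτ hστ hx fun hτx => h.not_subset t ht (coe_subset.1 (hτx.trans hxt))

theorem exists_homeomorph (h : Pushes σ τ 𝒯 𝒯') (h' : Pushes τ σ 𝒯' 𝒯) (hσ : σ.Nonempty)
    (hτ : τ.Nonempty) (hστ : Disjoint σ τ) :
    ∃ g : polyhedron 𝒯 ≃ₜ polyhedron 𝒯',
      ∀ x, ¬ (σ : Set V) ⊆ support x.1 → (g x : V → ℝ) = x := by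
  refine ⟨{ toFun := (h.mapsTo hσ hτ hστ).restrict
            invFun := (h'.mapsTo hτ hσ hστ.symm).restrict
            left_inv := fun x => Subtype.ext (h.leftInvOn hσ hτ hστ x.2)
            right_inv := fun x => Subtype.ext (h'.leftInvOn hτ hσ hστ.symm x.2)
            continuous_toFun := (continuous_pushMass hσ τ).restrict _
            continuous_invFun := (continuous_pushMass hτ σ).restrict _ }, fun x hx => ?_⟩
  exact pushMass_eq_self hσ x.2.1 hx

end Pushes

/-- The exchange of `σ` for `τ`: if `∂τ * K` is the link of `σ`, the star `σ * ∂τ * K` of `σ` is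
replaced by `∂σ * τ * K`. -/
def exchange (σ τ : Finset V) (𝒯 : Set (Finset V)) : Set (Finset V) :=
  {q | q ∈ 𝒯 ∧ ¬ σ ⊆ q} ∪ {q | ∃ t ∈ 𝒯, σ ⊆ t ∧ ∃ i ∈ σ, (t ∪ τ).erase i = q}

theorem pushes_exchange (hτ : ∀ t ∈ 𝒯, ¬ τ ⊆ t) : Pushes σ τ 𝒯 (exchange σ τ 𝒯) where
  not_subset := hτ
  keep t ht hσt := ⟨t, .inl ⟨ht, hσt⟩, Subset.rfl⟩
  replace t ht hσt i hi := ⟨_, .inr ⟨t, ht, hσt, i, hi, rfl⟩, Subset.rfl⟩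

theorem exchange_pushes (hστ : Disjoint σ τ) (hτ : ∀ t ∈ 𝒯, ¬ τ ⊆ t)
    (hlink : ∀ t ∈ 𝒯, σ ⊆ t → ∀ j ∈ τ, ∃ q ∈ 𝒯, (t ∪ τ).erase j ⊆ q) :
    Pushes τ σ (exchange σ τ 𝒯) 𝒯 where
  not_subset := by
    rintro q (⟨-, hσq⟩ | ⟨t, -, -, i, hi, rfl⟩) hq
    · exact hσq hq
    · exact notMem_erase i _ (hq hi)
  keep := by
    rintro q (⟨hq, -⟩ | ⟨t, -, -, i, hi, rfl⟩) hτq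
    · exact ⟨q, hq, Subset.rfl⟩
    · exact absurd (subset_erase.2 ⟨subset_union_right, disjoint_left.1 hστ hi⟩) hτq
  replace := by
    rintro q (⟨hq, -⟩ | ⟨t, ht, hσt, i, -, rfl⟩) hτq j hj
    · exact absurd hτq (hτ q hq)
    · obtain ⟨q, hq, htq⟩ := hlink t ht hσt j hj
      refine ⟨q, hq, (erase_subset_erase j ?_).trans htq⟩
      exact union_subset (erase_subset _ _) (hσt.trans subset_union_left)

end Exchange

section BitMasks

/-- The finite set of natural numbers encoded by a bit mask. Complexes are computed with in this
encoding because bitwise operations are fast in the kernel. -/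
def maskSet (m : ℕ) : Finset ℕ := m.bitIndices.toFinset

/-- The bit mask of the set of entries of `l`. -/
def mask (l : List ℕ) : ℕ := l.foldr (fun i m => 2 ^ i ||| m) 0

/-- Inclusion of the sets encoded by two bit masks. -/
def maskSubset (s t : ℕ) : Bool := s &&& t == s

theorem mem_maskSet {i m : ℕ} : i ∈ maskSet m ↔ m.testBit i := by
  rw [maskSet, List.mem_toFinset, Nat.mem_bitIndices]

theorem maskSet_mask (l : List ℕ) : maskSet (mask l) = l.toFinset := by
  ext i
  rw [mem_maskSet]
  induction l with
  | nil => simp [mask]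
  | cons a l ih =>
    rw [mask, List.foldr_cons, Nat.testBit_or, Nat.testBit_two_pow, ← mask, Bool.or_eq_true, ih]
    simp [eq_comm]

theorem maskSubset_iff {s t : ℕ} : maskSubset s t ↔ maskSet s ⊆ maskSet t := by
  simp only [maskSubset, beq_iff_eq, subset_iff, mem_maskSet]
  constructor
  · intro h i hi
    rw [← h, Nat.testBit_and, Bool.and_eq_true] at hi
    exact hi.2
  · intro h
    refine Nat.eq_of_testBit_eq fun i => ?_
    rw [Nat.testBit_and, Bool.and_eq_left_iff_imp]
    exact @h i

theorem maskSet_or (s t : ℕ) : maskSet (s ||| t) = maskSet s ∪ maskSet t := by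
  ext i
  simp only [mem_union, mem_maskSet, Nat.testBit_or, Bool.or_eq_true]

theorem maskSet_xor_two_pow {i m : ℕ} (hi : i ∈ maskSet m) :
    maskSet (m ^^^ 2 ^ i) = (maskSet m).erase i := by
  ext j
  rw [mem_maskSet] at hi
  rcases eq_or_ne i j with rfl | hij
  · simp [mem_maskSet, hi]
  · simp [mem_maskSet, Nat.testBit_two_pow_of_ne hij, hij.symm]

/-- The sets encoded by a list of bit masks. -/
def maskSets (L : List ℕ) : Set (Finset ℕ) := maskSet '' {m | m ∈ L}

/-- The exchange of `σ` for `τ` in a complex that is encoded by bit masks. -/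
def exchangeMasks (σ τ : List ℕ) (L : List ℕ) : List ℕ :=
  L.filter (fun t => !maskSubset (mask σ) t) ++
    ((L.filter (maskSubset (mask σ))).flatMap fun t =>
      σ.map fun i => (t ||| mask τ) ^^^ 2 ^ i).dedup

/-- Tests that the exchange of `σ` for `τ` is a homeomorphism that fixes the simplices in `B`. -/
def isExchangeable (B : List ℕ) (σ τ : List ℕ) (L : List ℕ) : Bool :=
  !σ.isEmpty && !τ.isEmpty && decide (∀ i ∈ σ, i ∉ τ) &&
  L.all (fun t => !maskSubset (mask τ) t) && B.all (fun t => !maskSubset (mask σ) t) &&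
  (L.filter (maskSubset (mask σ))).all fun t => τ.all fun j =>
    (L.filter (maskSubset (mask σ))).any (maskSubset ((t ||| mask τ) ^^^ 2 ^ j))

/-- Tests that the successive exchanges in a list are homeomorphisms that fix the simplices in `B`,
and that they lead to the complex spanned by `K`. -/
def deforms (B K : List ℕ) : List (List ℕ × List ℕ) → List ℕ → Bool
  | [], L => L.all (fun t => K.any (maskSubset t)) && K.all (fun t => L.any (maskSubset t))
  | (σ, τ) :: ms, L => isExchangeable B σ τ L && deforms B K ms (exchangeMasks σ τ L)

theorem maskSets_exchangeMasks {σ τ : List ℕ} {L : List ℕ} :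
    maskSets (exchangeMasks σ τ L) = exchange σ.toFinset τ.toFinset (maskSets L) := by
  ext q
  have hsub : ∀ t, maskSubset (mask σ) t ↔ σ.toFinset ⊆ maskSet t := fun t => by
    rw [maskSubset_iff, maskSet_mask]
  have herase : ∀ t, maskSubset (mask σ) t → ∀ i ∈ σ,
      maskSet ((t ||| mask τ) ^^^ 2 ^ i) = (maskSet t ∪ τ.toFinset).erase i := fun t ht i hi => by
    rw [maskSet_xor_two_pow, maskSet_or, maskSet_mask]
    rw [maskSet_or, mem_union]
    exact .inl ((hsub t).1 ht (List.mem_toFinset.2 hi))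
  simp only [maskSets, exchangeMasks, exchange, List.mem_append, List.mem_dedup, List.mem_flatMap,
    List.mem_map, List.mem_filter, Bool.not_eq_true', ← Bool.not_eq_true, Set.mem_image,
    Set.mem_union, Set.mem_ofPred_eq, List.mem_toFinset]
  constructor
  · rintro ⟨m, ⟨hm, hσm⟩ | ⟨t, ⟨ht, hσt⟩, i, hi, rfl⟩, rfl⟩
    · exact .inl ⟨⟨m, hm, rfl⟩, by rwa [← hsub]⟩
    · exact .inr ⟨_, ⟨t, ht, rfl⟩, (hsub t).1 hσt, i, hi, (herase t hσt i hi).symm⟩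
  · rintro (⟨⟨m, hm, rfl⟩, hσm⟩ | ⟨_, ⟨t, ht, rfl⟩, hσt, i, hi, rfl⟩)
    · exact ⟨m, .inl ⟨hm, by rwa [hsub]⟩, rfl⟩
    · have hσt := (hsub t).2 hσt
      exact ⟨_, .inr ⟨t, ⟨ht, hσt⟩, i, hi, rfl⟩, herase t hσt i hi⟩

theorem exists_homeomorph_exchangeMasks {B : List ℕ} {σ τ : List ℕ} {L : List ℕ}
    (h : isExchangeable B σ τ L) :
    ∃ g : polyhedron (maskSets L) ≃ₜ polyhedron (maskSets (exchangeMasks σ τ L)),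
      ∀ x, (∃ b ∈ B, support x.1 ⊆ maskSet b) → (g x : ℕ → ℝ) = x := by
  simp only [isExchangeable, Bool.and_eq_true, Bool.not_eq_true', ← Bool.not_eq_true,
    List.isEmpty_iff, decide_eq_true_eq, List.all_eq_true, List.any_eq_true, List.mem_filter,
    maskSubset_iff, maskSet_mask, and_imp] at h
  obtain ⟨⟨⟨⟨⟨hσ, hτ⟩, hστ⟩, hL⟩, hB⟩, hlink⟩ := h
  have hdisj : Disjoint σ.toFinset τ.toFinset :=
    List.disjoint_toFinset_iff_disjoint.2 fun _ => @hστ _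
  have hτL : ∀ t ∈ maskSets L, ¬ τ.toFinset ⊆ t := Set.forall_mem_image.2 hL
  have hback : Pushes τ.toFinset σ.toFinset (exchange σ.toFinset τ.toFinset (maskSets L))
      (maskSets L) := by
    refine exchange_pushes hdisj hτL (Set.forall_mem_image.2 fun t ht hσt j hj => ?_)
    have hj : j ∈ τ := List.mem_toFinset.1 hj
    obtain ⟨q, ⟨hq, -⟩, hsub⟩ := hlink t ht hσt j hj
    refine ⟨maskSet q, ⟨q, hq, rfl⟩, ?_⟩
    rwa [maskSet_xor_two_pow, maskSet_or, maskSet_mask] at hsub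
    rw [maskSet_or, maskSet_mask]
    exact mem_union_right _ (List.mem_toFinset.2 hj)
  rw [maskSets_exchangeMasks]
  obtain ⟨g, hg⟩ := (pushes_exchange hτL).exists_homeomorph hback
    (List.toFinset_nonempty_iff _ |>.2 hσ) (List.toFinset_nonempty_iff _ |>.2 hτ) hdisj
  exact ⟨g, fun x ⟨b, hb, hxb⟩ => hg x fun hσx => hB b hb (coe_subset.1 (hσx.trans hxb))⟩

theorem exists_homeomorph_of_deforms {B K : List ℕ} {ms : List (List ℕ × List ℕ)} {L : List ℕ}
    (h : deforms B K ms L) :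
    ∃ g : polyhedron (maskSets L) ≃ₜ polyhedron (maskSets K),
      ∀ x, (∃ b ∈ B, support x.1 ⊆ maskSet b) → (g x : ℕ → ℝ) = x := by
  induction ms generalizing L with
  | nil =>
    simp only [deforms, Bool.and_eq_true, List.all_eq_true, List.any_eq_true, maskSubset_iff] at h
    have hLK : polyhedron (maskSets L) = polyhedron (maskSets K) :=
      Set.Subset.antisymm (polyhedron_mono <| by simpa [maskSets] using h.1)
        (polyhedron_mono <| by simpa [maskSets] using h.2)
    exact ⟨Homeomorph.setCongr hLK, fun _ _ => rfl⟩
  | cons m ms ih =>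
    rw [deforms, Bool.and_eq_true] at h
    obtain ⟨g, hg⟩ := exists_homeomorph_exchangeMasks h.1
    obtain ⟨g', hg'⟩ := ih h.2
    refine ⟨g.trans g', fun x hx => ?_⟩
    rw [Homeomorph.trans_apply, hg' (g x) (by rwa [hg x hx]), hg x hx]

end BitMasks

/-! ### The disc as a cone -/

noncomputable section Cone

open InnerProductGeometry Real

/-- The point at the position `θ` of the unit circle, whose total length is taken to be `n`. -/
def circlePoint (n : ℕ) (θ : ℝ) : ℂ := Complex.exp (2 * π * Complex.I * (θ / n))

theorem circlePoint_eq (n : ℕ) (θ : ℝ) :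
    circlePoint n θ = Complex.exp ((2 * π / n * θ : ℝ) * Complex.I) := by
  rw [circlePoint]
  push_cast
  ring_nf

theorem norm_circlePoint (n : ℕ) (θ : ℝ) : ‖circlePoint n θ‖ = 1 := by
  rw [circlePoint_eq, Complex.norm_exp_ofReal_mul_I]

theorem circlePoint_ne_zero (n : ℕ) (θ : ℝ) : circlePoint n θ ≠ 0 :=
  Complex.exp_ne_zero _

theorem norm_smul_circlePoint (n : ℕ) {r : ℝ} (hr : 0 ≤ r) (θ : ℝ) :
    ‖r • circlePoint n θ‖ = r := by
  rw [norm_smul, norm_circlePoint, mul_one, norm_of_nonneg hr]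

theorem periodic_circlePoint {n : ℕ} (hn : n ≠ 0) : Periodic (circlePoint n) n := fun θ => by
  have hperiod : 2 * π / n * (θ + n) = 2 * π / n * θ + 2 * π := by
    field_simp
  rw [circlePoint_eq, circlePoint_eq, hperiod, Complex.ofReal_add, add_mul, Complex.exp_add]
  push_cast
  rw [Complex.exp_two_pi_mul_I, mul_one]

theorem angle_circlePoint {n : ℕ} (hn : n ≠ 0) (θ η : ℝ) :
    n / (2 * π) * angle (circlePoint n θ) (circlePoint n η) =
      ‖((θ - η : ℝ) : AddCircle (n : ℝ))‖ := by
  have hangle : ∀ x : ℝ, |toIocMod two_pi_pos (-π) x| = ‖(x : AddCircle (2 * π))‖ := fun x => by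
    have hmem := toIocMod_mem_Ioc two_pi_pos (-π) x
    have hcoe : ((toIocMod two_pi_pos (-π) x : ℝ) : AddCircle (2 * π)) = x := by
      rw [toIocMod, AddCircle.coe_sub, AddCircle.coe_zsmul, AddCircle.coe_period, smul_zero,
        sub_zero]
    rw [← hcoe, (AddCircle.norm_coe_eq_abs_iff _ two_pi_pos.ne').2]
    rw [abs_of_pos two_pi_pos, abs_le]
    constructor <;> linarith [hmem.1, hmem.2]
  have hn' : (0 : ℝ) < n := by positivity
  rw [circlePoint_eq, circlePoint_eq, Complex.angle_exp_exp, hangle, ← mul_sub]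
  have hscale := AddCircle.norm_coe_mul (n : ℝ) (θ - η) (2 * π / n)
  rw [div_mul_cancel₀ _ hn'.ne', abs_of_pos (by positivity)] at hscale
  rw [hscale]
  field_simp

theorem exists_eq_smul_circlePoint {n : ℕ} (hn : n ≠ 0) (z : ℂ) :
    ∃ k < n, ∃ s ∈ Set.Ico (0 : ℝ) 1, z = ‖z‖ • circlePoint n (k + s) := by
  have hn' : (0 : ℝ) < n := by positivity
  set θ := toIcoMod hn' 0 (n / (2 * π) * z.arg) with hθ
  have hmem : 0 ≤ θ ∧ θ < n := by
    simpa using toIcoMod_mem_Ico hn' 0 (n / (2 * π) * z.arg)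
  have hpoint : circlePoint n θ = Complex.exp (z.arg * Complex.I) := by
    rw [hθ, toIcoMod, (periodic_circlePoint hn).sub_zsmul_eq, circlePoint_eq]
    congr 3
    field_simp
  refine ⟨⌊θ⌋₊, (Nat.floor_lt hmem.1).2 hmem.2, θ - ⌊θ⌋₊,
    ⟨sub_nonneg.2 (Nat.floor_le hmem.1), by linarith [Nat.lt_floor_add_one θ]⟩, ?_⟩
  rw [add_sub_cancel, hpoint, Complex.real_smul, Complex.norm_mul_exp_arg_mul_I]

/-- The piecewise linear bump at `0` on the circle of length `n`, as a function on the line. -/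
def tent (n : ℕ) (δ : ℝ) : ℝ := max 0 (1 - ‖(δ : AddCircle (n : ℝ))‖)

theorem tent_neg (n : ℕ) (δ : ℝ) : tent n (-δ) = tent n δ := by
  rw [tent, AddCircle.coe_neg, norm_neg, tent]

theorem periodic_tent (n : ℕ) : Periodic (tent n) n := fun δ => by
  rw [tent, AddCircle.coe_add_period, tent]

theorem tent_of_abs_le_one {n : ℕ} (hn : 2 ≤ n) {δ : ℝ} (h : |δ| ≤ 1) : tent n δ = 1 - |δ| := by
  have hn' : (2 : ℝ) ≤ n := by exact_mod_cast hn
  rw [tent, (AddCircle.norm_coe_eq_abs_iff _ (by positivity)).2, max_eq_right (by linarith)]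
  rw [Nat.abs_cast]
  linarith

theorem tent_eq_zero {n : ℕ} {δ : ℝ} (h1 : 1 ≤ δ) (h2 : δ ≤ n - 1) : tent n δ = 0 := by
  wlog h : δ ≤ n / 2 generalizing δ
  · rw [← this (δ := n - δ) (by linarith) (by linarith) (by linarith), ← tent_neg n (n - δ),
      neg_sub, (periodic_tent n).sub_eq]
  refine max_eq_left ?_
  rw [(AddCircle.norm_coe_eq_abs_iff _ (by linarith)).2] <;> rw [abs_of_pos (by linarith)]
  · linarith
  · rwa [Nat.abs_cast]

theorem add_one_mod_ne {n k : ℕ} (hn : 2 ≤ n) (hk : k < n) : (k + 1) % n ≠ k := by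
  rcases (by omega : k + 1 < n ∨ k + 1 = n) with h | h
  · rw [Nat.mod_eq_of_lt h]
    omega
  · rw [h, Nat.mod_self]
    omega

theorem add_one_mod_add_one_mod_ne {n k : ℕ} (hn : 3 ≤ n) (hk : k < n) :
    ((k + 1) % n + 1) % n ≠ k := by
  rw [Nat.mod_add_mod]
  rcases (by omega : k + 2 < n ∨ k + 2 = n ∨ k + 2 = n + 1) with h | h | h
  · rw [Nat.mod_eq_of_lt h]
    omega
  · rw [h, Nat.mod_self]
    omega
  · rw [h, Nat.add_mod_left, Nat.mod_eq_of_lt] <;> omega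

/-- The point with weights `1 - s` and `s` at the vertices `k` and `k + 1` of the cycle
`0, 1, …, n - 1`. -/
def edgePoint (n k : ℕ) (s : ℝ) : ℕ → ℝ := Pi.single k (1 - s) + Pi.single ((k + 1) % n) s

theorem edgePoint_self {n k : ℕ} (hn : 2 ≤ n) (hk : k < n) (s : ℝ) :
    edgePoint n k s k = 1 - s := by
  simp [edgePoint, add_one_mod_ne hn hk]

theorem edgePoint_next {n k : ℕ} (hn : 2 ≤ n) (hk : k < n) (s : ℝ) :
    edgePoint n k s ((k + 1) % n) = s := by
  simp [edgePoint, add_one_mod_ne hn hk]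

theorem edgePoint_of_ne {n k i : ℕ} (s : ℝ) (h : i ≠ k) (h' : i ≠ (k + 1) % n) :
    edgePoint n k s i = 0 := by
  simp [edgePoint, h, h']

theorem edgePoint_nonneg (n k : ℕ) {s : ℝ} (hs : s ∈ Set.Icc (0 : ℝ) 1) : 0 ≤ edgePoint n k s :=
  add_nonneg (Pi.single_nonneg.2 (sub_nonneg.2 hs.2)) (Pi.single_nonneg.2 hs.1)

theorem edgePoint_inj {n k l : ℕ} {s t : ℝ} (hn : 3 ≤ n) (hk : k < n) (hl : l < n)
    (hs : s ∈ Set.Ico (0 : ℝ) 1) (ht : t ∈ Set.Ico (0 : ℝ) 1)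
    (h : edgePoint n k s = edgePoint n l t) : k = l ∧ s = t := by
  have hmem : ∀ {k l : ℕ} {s t : ℝ}, k < n → s < 1 → edgePoint n k s = edgePoint n l t →
      k = l ∨ k = (l + 1) % n := fun {k l s t} hk hs h => by
    by_contra! hne
    have hval := congrFun h k
    rw [edgePoint_self (by omega) hk, edgePoint_of_ne t hne.1 hne.2] at hval
    linarith
  have hkl : k = l := by
    rcases hmem hk hs.2 h, hmem hl ht.2 h.symm with ⟨hkl | hkl, hlk | hlk⟩
    · exact hkl
    · exact hkl
    · exact hlk.symm
    · exact absurd (hlk ▸ hkl).symm (add_one_mod_add_one_mod_ne hn hk)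
  subst hkl
  have hval := congrFun h k
  rw [edgePoint_self (by omega) hk, edgePoint_self (by omega) hk] at hval
  exact ⟨rfl, by linarith⟩

theorem tent_eq_edgePoint {n k i : ℕ} {s : ℝ} (hn : 2 ≤ n) (hk : k < n) (hi : i < n)
    (hs : s ∈ Set.Icc (0 : ℝ) 1) : tent n (k + s - i) = edgePoint n k s i := by
  obtain ⟨hs0, hs1⟩ := hs
  rcases eq_or_ne i k with rfl | hik
  · rw [add_sub_cancel_left, tent_of_abs_le_one hn (by rwa [abs_of_nonneg hs0]),
      abs_of_nonneg hs0, edgePoint_self hn hi]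
  rcases eq_or_ne i ((k + 1) % n) with hnext | hnext
  · have hshift : tent n (k + s - i) = tent n (s - 1) := by
      rcases (by omega : k + 1 < n ∨ k + 1 = n) with h | h
      · rw [hnext, Nat.mod_eq_of_lt h]
        push_cast
        ring_nf
      · rw [hnext, h, Nat.mod_self, ← periodic_tent n (s - 1), ← h]
        push_cast
        ring_nf
    rw [hshift, tent_of_abs_le_one hn] <;> rw [abs_of_nonpos (by linarith)]
    · rw [hnext, edgePoint_next hn hk]
      ring
    · linarith
  rw [edgePoint_of_ne s hik hnext]
  have hin : (i : ℝ) + 1 ≤ n := by exact_mod_cast hi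
  rcases hik.lt_or_gt with h | h
  · have hgap : k + 2 ≤ n + i := by
      by_contra hcon
      obtain ⟨rfl, hkn⟩ : i = 0 ∧ k + 1 = n := by omega
      exact hnext (by rw [hkn, Nat.mod_self])
    have : (i : ℝ) + 1 ≤ k := by exact_mod_cast h
    have : (k : ℝ) + 2 ≤ n + i := by exact_mod_cast hgap
    exact tent_eq_zero (by linarith) (by linarith)
  · rw [Nat.mod_eq_of_lt (by omega)] at hnext
    have : (k : ℝ) + 2 ≤ i := by exact_mod_cast (by omega : k + 2 ≤ i)
    have : (0 : ℝ) ≤ k := k.cast_nonneg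
    rw [← tent_neg]
    exact tent_eq_zero (by linarith) (by linarith)

/-- The barycentric coordinates of a point of the unit disc, considered as the cone with apex `n`
over the cycle `0, 1, …, n - 1`. -/
def coneCoord (n : ℕ) (z : ℂ) (i : ℕ) : ℝ :=
  if i < n then ‖z‖ * max 0 (1 - n / (2 * π) * angle z (circlePoint n i))
  else if i = n then 1 - ‖z‖ else 0

theorem continuous_coneCoord (n : ℕ) : Continuous (coneCoord n) := by
  refine continuous_pi fun i => ?_
  unfold coneCoord
  split_ifs
  · refine continuous_iff_continuousAt.2 fun z => ?_
    rcases eq_or_ne z 0 with rfl | hz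
    · rw [ContinuousAt, norm_zero, zero_mul]
      refine squeeze_zero (fun z => by positivity) (fun z => ?_)
        (continuous_norm.tendsto' 0 0 norm_zero)
      refine mul_le_of_le_one_right (norm_nonneg _) (max_le zero_le_one (sub_le_self _ ?_))
      exact mul_nonneg (by positivity) (angle_nonneg _ _)
    · have hangle : ContinuousAt (fun z => angle z (circlePoint n i)) z :=
        ContinuousAt.comp (f := fun z => (z, circlePoint n i))
          (continuousAt_angle hz (circlePoint_ne_zero n i)) (by fun_prop)
      fun_prop
  · fun_prop
  · fun_prop

theorem coneCoord_smul_circlePoint {n k : ℕ} {r s : ℝ} (hn : 2 ≤ n) (hk : k < n) (hr : 0 ≤ r)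
    (hs : s ∈ Set.Icc (0 : ℝ) 1) :
    coneCoord n (r • circlePoint n (k + s)) = Pi.single n (1 - r) + r • edgePoint n k s := by
  have hmod : (k + 1) % n < n := Nat.mod_lt _ (by omega)
  ext i
  rw [coneCoord, norm_smul_circlePoint n hr, Pi.add_apply, Pi.smul_apply, smul_eq_mul]
  split_ifs with hin hin'
  · rw [Pi.single_eq_of_ne hin.ne, zero_add, ← tent_eq_edgePoint hn hk hin hs]
    rcases hr.eq_or_lt with rfl | hr
    · rw [zero_mul, zero_mul]
    · rw [angle_smul_left_of_pos _ _ hr, angle_circlePoint (by omega), tent]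
  · rw [hin', Pi.single_eq_same, edgePoint_of_ne s (by omega) (by omega), mul_zero, add_zero]
  · rw [Pi.single_eq_of_ne hin', edgePoint_of_ne s (by omega) (by omega), mul_zero, add_zero]

/-- The facets of the cone with apex `n` over the cycle `0, 1, …, n - 1`. -/
def coneFacets (n : ℕ) : Set (Finset ℕ) := {t | ∃ k < n, t = {k, (k + 1) % n, n}}

theorem sum_coneFacet {n k : ℕ} (hn : 2 ≤ n) (hk : k < n) (x : ℕ → ℝ) :
    ∑ i ∈ ({k, (k + 1) % n, n} : Finset ℕ), x i = x k + x ((k + 1) % n) + x n := by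
  have hmod : (k + 1) % n < n := Nat.mod_lt _ (by omega)
  rw [sum_insert, sum_pair hmod.ne, add_assoc]
  simp only [mem_insert, mem_singleton, not_or]
  exact ⟨(add_one_mod_ne hn hk).symm, hk.ne⟩

theorem conePoint_mem_polyhedron {n k : ℕ} {r s : ℝ} (hn : 2 ≤ n) (hk : k < n)
    (hr : r ∈ Set.Icc (0 : ℝ) 1) (hs : s ∈ Set.Icc (0 : ℝ) 1) :
    Pi.single n (1 - r) + r • edgePoint n k s ∈ polyhedron (coneFacets n) := by
  have hmod : (k + 1) % n < n := Nat.mod_lt _ (by omega)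
  have hsupp : support (Pi.single n (1 - r) + r • edgePoint n k s) ⊆
      ({k, (k + 1) % n, n} : Finset ℕ) := fun i => by
    contrapose
    simp +contextual [edgePoint]
  refine ⟨add_nonneg (Pi.single_nonneg.2 (sub_nonneg.2 hr.2))
    (smul_nonneg hr.1 (edgePoint_nonneg n k hs)), ?_, _, ⟨k, hk, rfl⟩, hsupp⟩
  rw [finsum_eq_sum_of_support_subset _ hsupp, sum_coneFacet hn hk]
  simp only [Pi.add_apply, Pi.smul_apply, smul_eq_mul, Pi.single_eq_same,
    Pi.single_eq_of_ne hk.ne, Pi.single_eq_of_ne hmod.ne, edgePoint_self hn hk,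
    edgePoint_next hn hk, edgePoint_of_ne s hk.ne' hmod.ne']
  ring

theorem exists_eq_conePoint {n : ℕ} (hn : 2 ≤ n) {x : ℕ → ℝ} (hx : x ∈ polyhedron (coneFacets n)) :
    ∃ k < n, ∃ r ∈ Set.Icc (0 : ℝ) 1, ∃ s ∈ Set.Icc (0 : ℝ) 1,
      x = Pi.single n (1 - r) + r • edgePoint n k s := by
  obtain ⟨hx0, hsum, _, ⟨k, hk, rfl⟩, hsupp⟩ := hx
  rw [finsum_eq_sum_of_support_subset _ hsupp, sum_coneFacet hn hk] at hsum
  have hxk : 0 ≤ x k := hx0 k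
  have hxnext : 0 ≤ x ((k + 1) % n) := hx0 _
  have hxn : 0 ≤ x n := hx0 n
  have hmod : (k + 1) % n < n := Nat.mod_lt _ (by omega)
  set r := x k + x ((k + 1) % n) with hr
  set s := x ((k + 1) % n) / r with hs
  have hrs : r * s = x ((k + 1) % n) := by
    rcases (add_nonneg hxk hxnext).eq_or_lt with h | h
    · rw [hr, ← h]
      linarith
    · exact mul_div_cancel₀ _ h.ne'
  refine ⟨k, hk, r, ⟨by linarith, by linarith⟩, s,
    ⟨by positivity, div_le_one_of_le₀ (by linarith) (by linarith)⟩, funext fun i => ?_⟩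
  rw [Pi.add_apply, Pi.smul_apply, smul_eq_mul]
  rcases eq_or_ne i n with rfl | hin
  · rw [Pi.single_eq_same, edgePoint_of_ne s hk.ne' hmod.ne']
    linarith
  rw [Pi.single_eq_of_ne hin]
  rcases eq_or_ne i k with rfl | hik
  · rw [edgePoint_self hn hk]
    linarith
  rcases eq_or_ne i ((k + 1) % n) with rfl | hnext
  · rw [edgePoint_next hn hk]
    linarith
  · rw [edgePoint_of_ne s hik hnext, mul_zero, add_zero]
    by_contra hxi
    simpa [hik, hnext, hin] using hsupp hxi

theorem coneCoord_injective {n : ℕ} (hn : 3 ≤ n) : Injective (coneCoord n) := by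
  intro z w h
  have hnorm : ∀ u, coneCoord n u n = 1 - ‖u‖ := fun u => by simp [coneCoord]
  have hr : ‖z‖ = ‖w‖ := by linarith [hnorm z, hnorm w, congrFun h n]
  rcases eq_or_ne ‖z‖ 0 with h0 | h0
  · exact (norm_eq_zero.1 h0).trans (norm_eq_zero.1 (hr.symm.trans h0)).symm
  obtain ⟨k, hk, s, hs, hz⟩ := exists_eq_smul_circlePoint (by omega : n ≠ 0) z
  obtain ⟨l, hl, t, ht, hw⟩ := exists_eq_smul_circlePoint (by omega : n ≠ 0) w
  rw [hz, hw, coneCoord_smul_circlePoint (by omega) hk (norm_nonneg z) (Set.Ico_subset_Icc_self hs),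
    coneCoord_smul_circlePoint (by omega) hl (norm_nonneg w) (Set.Ico_subset_Icc_self ht), hr] at h
  obtain ⟨rfl, rfl⟩ := edgePoint_inj hn hk hl hs ht (smul_right_injective _ (hr ▸ h0)
    (add_left_cancel h))
  rw [hz, hw, hr]

theorem exists_homeomorph_cone {n : ℕ} (hn : 3 ≤ n) :
    ∃ f : UnitDisc ≃ₜ polyhedron (coneFacets n), ∀ z, (f z : ℕ → ℝ) = coneCoord n z := by
  have hmem : ∀ z : UnitDisc, coneCoord n z ∈ polyhedron (coneFacets n) := fun z => by
    obtain ⟨k, hk, s, hs, hz⟩ := exists_eq_smul_circlePoint (by omega : n ≠ 0) (z : ℂ)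
    have hs := Set.Ico_subset_Icc_self hs
    rw [hz, coneCoord_smul_circlePoint (by omega) hk (norm_nonneg _) hs]
    exact conePoint_mem_polyhedron (by omega) hk
      ⟨norm_nonneg _, mem_closedBall_zero_iff.1 z.2⟩ hs
  let f : UnitDisc → polyhedron (coneFacets n) := fun z => ⟨coneCoord n z, hmem z⟩
  have hf : Continuous f := ((continuous_coneCoord n).comp continuous_subtype_val).subtype_mk _
  have hinj : Injective f := fun z w h =>
    Subtype.ext (coneCoord_injective hn (congrArg Subtype.val h))
  have hsurj : Surjective f := by
    rintro ⟨x, hx⟩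
    obtain ⟨k, hk, r, hr, s, hs, rfl⟩ := exists_eq_conePoint (by omega) hx
    exact ⟨⟨r • circlePoint n (k + s),
      mem_closedBall_zero_iff.2 ((norm_smul_circlePoint n hr.1 _).trans_le hr.2)⟩,
      Subtype.ext (coneCoord_smul_circlePoint (by omega) hk hr.1 hs)⟩
  have : CompactSpace UnitDisc := isCompact_iff_compactSpace.1 (isCompact_closedBall _ _)
  exact ⟨hf.homeoOfEquivCompactToT2 (f := .ofBijective f ⟨hinj, hsurj⟩), fun z => rfl⟩

theorem coneCoord_circlePoint {n k : ℕ} {s : ℝ} (hn : 2 ≤ n) (hk : k < n)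
    (hs : s ∈ Set.Icc (0 : ℝ) 1) : coneCoord n (circlePoint n (k + s)) = edgePoint n k s := by
  simpa using coneCoord_smul_circlePoint hn hk zero_le_one hs

end Cone

noncomputable section Relabelling

variable {V W : Type*} [DecidableEq W] {D t u : Finset V} {φ : V → W} {x y : V → ℝ}
  {𝒯 : Set (Finset V)}

/-- The map of barycentric coordinates induced by the vertex map `φ`, for points that are supported
on the finite set `D`. -/
def relabel (D : Finset V) (φ : V → W) (x : V → ℝ) (j : W) : ℝ := ∑ i ∈ D with φ i = j, x i

theorem continuous_relabel : Continuous (relabel D φ) :=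
  continuous_pi fun _ => continuous_finsetSum _ fun i _ => continuous_apply i

theorem relabel_add : relabel D φ (x + y) = relabel D φ x + relabel D φ y :=
  funext fun _ => sum_add_distrib

theorem relabel_single [DecidableEq V] {i : V} (hi : i ∈ D) (c : ℝ) :
    relabel D φ (Pi.single i c) = Pi.single (φ i) c := by
  ext j
  simp only [relabel, Pi.single_apply, sum_ite_eq', mem_filter, hi, true_and, eq_comm (a := j)]

theorem relabel_nonneg (hx : 0 ≤ x) : 0 ≤ relabel D φ x :=
  fun _ => sum_nonneg fun i _ => hx i

theorem relabel_apply (htD : t ⊆ D) (hφ : Set.InjOn φ t) (hx : support x ⊆ t) {i : V}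
    (hi : i ∈ t) : relabel D φ x (φ i) = x i := by
  refine sum_eq_single_of_mem i (by simp [htD hi]) fun j hj hji => ?_
  by_contra hxj
  exact hji (hφ (hx hxj) hi (mem_filter.1 hj).2)

theorem support_relabel_subset (hx : support x ⊆ t) :
    support (relabel D φ x) ⊆ (t.image φ : Finset W) := by
  intro j hj
  obtain ⟨i, hi, hxi⟩ := exists_ne_zero_of_sum_ne_zero hj
  exact mem_image.2 ⟨i, hx hxi, (mem_filter.1 hi).2⟩

theorem finsum_relabel (hx : support x ⊆ D) : ∑ᶠ j, relabel D φ x j = ∑ᶠ i, x i := by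
  rw [finsum_eq_sum_of_support_subset _ (support_relabel_subset hx),
    finsum_eq_sum_of_support_subset _ hx]
  exact sum_fiberwise_of_maps_to (fun i hi => mem_image_of_mem φ hi) x

theorem relabel_injOn (htD : t ⊆ D) (hφ : Set.InjOn φ t) :
    Set.InjOn (relabel D φ) {x | support x ⊆ (t : Set V)} := by
  intro x hx y hy h
  ext i
  by_cases hi : i ∈ t
  · rw [← relabel_apply htD hφ hx hi, h, relabel_apply htD hφ hy hi]
  · rw [notMem_support.1 (mt (@hx i) hi), notMem_support.1 (mt (@hy i) hi)]

theorem exists_apply_eq_of_relabel_eq (htD : t ⊆ D) (huD : u ⊆ D) (ht : Set.InjOn φ t)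
    (hu : Set.InjOn φ u) (hx : support x ⊆ t) (hy : support y ⊆ u)
    (h : relabel D φ x = relabel D φ y) {i : V} (hi : x i ≠ 0) :
    ∃ j ∈ u, φ i = φ j ∧ y j = x i := by
  have hxi : relabel D φ y (φ i) = x i := by rw [← h, relabel_apply htD ht hx (hx hi)]
  obtain ⟨j, hj, hji⟩ := mem_image.1 (support_relabel_subset hy (hxi.trans_ne hi))
  refine ⟨j, hj, hji.symm, ?_⟩
  rw [← hxi, ← hji, relabel_apply huD hu hy hj]

theorem relabel_mem_polyhedron (hD : ∀ t ∈ 𝒯, t ⊆ D) (hx : x ∈ polyhedron 𝒯) :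
    relabel D φ x ∈ polyhedron (image φ '' 𝒯) := by
  obtain ⟨hx0, hsum, t, ht, hxt⟩ := hx
  exact ⟨relabel_nonneg hx0, (finsum_relabel (hxt.trans (coe_subset.2 (hD t ht)))).trans hsum,
    _, ⟨t, ht, rfl⟩, support_relabel_subset hxt⟩

theorem surjOn_relabel (hD : ∀ t ∈ 𝒯, t ⊆ D) (hφ : ∀ t ∈ 𝒯, Set.InjOn φ t) :
    Set.SurjOn (relabel D φ) (polyhedron 𝒯) (polyhedron (image φ '' 𝒯)) := by
  classical
  rintro y ⟨hy0, hsum, _, ⟨t, ht, rfl⟩, hyt⟩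
  set x : V → ℝ := fun i => if i ∈ t then y (φ i) else 0 with hx
  have hxt : support x ⊆ t := fun i hi => by
    by_contra h
    exact hi (if_neg h)
  have hxy : relabel D φ x = y := by
    ext j
    by_cases hj : j ∈ t.image φ
    · obtain ⟨i, hi, rfl⟩ := mem_image.1 hj
      rw [relabel_apply (hD t ht) (hφ t ht) hxt hi]
      exact if_pos hi
    · rw [notMem_support.1 (mt (@support_relabel_subset _ _ _ D t φ x hxt j) hj),
        notMem_support.1 (mt (@hyt j) hj)]
  refine ⟨x, ⟨fun i => ?_, ?_, t, ht, hxt⟩, hxy⟩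
  · simp only [hx]
    split_ifs
    exacts [hy0 _, le_rfl]
  · rw [← hsum, ← hxy, finsum_relabel (hxt.trans (coe_subset.2 (hD t ht)))]

theorem nonempty_homeomorph_image (hD : ∀ t ∈ 𝒯, t ⊆ D) (hφ : Injective φ) :
    Nonempty (polyhedron 𝒯 ≃ₜ polyhedron (image φ '' 𝒯)) := by
  have hcomp : ∀ {x}, x ∈ polyhedron 𝒯 → relabel D φ x ∘ φ = x := by
    rintro x ⟨-, -, t, ht, hxt⟩
    ext i
    by_cases hi : i ∈ t
    · exact relabel_apply (hD t ht) hφ.injOn hxt hi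
    · rw [notMem_support.1 (mt (@hxt i) hi), comp_apply, ← notMem_support]
      exact mt (@support_relabel_subset _ _ _ D t φ x hxt _) (by simpa [hφ.eq_iff] using hi)
  have hsurj : ∀ y : polyhedron (image φ '' 𝒯), (y : W → ℝ) ∘ φ ∈ polyhedron 𝒯 ∧
      relabel D φ (y ∘ φ) = y := by
    intro y
    obtain ⟨x, hx, hxy⟩ := surjOn_relabel hD (fun t _ => hφ.injOn) y.2
    rw [← hxy, hcomp hx]
    exact ⟨hx, rfl⟩
  refine ⟨⟨⟨fun x => ⟨_, relabel_mem_polyhedron hD x.2⟩, fun y => ⟨y ∘ φ, (hsurj y).1⟩,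
    fun x => Subtype.ext (hcomp x.2), fun y => Subtype.ext (hsurj y).2⟩, ?_, ?_⟩⟩
  · exact (continuous_relabel.comp continuous_subtype_val).subtype_mk _
  · exact ((Pi.continuous_precomp φ).comp continuous_subtype_val).subtype_mk _

end Relabelling

section Quotient

variable {X Y : Type*} [TopologicalSpace X] [TopologicalSpace Y] [CompactSpace X] [T2Space Y]
  {r : X → X → Prop} {f : X → Y}

theorem nonempty_homeomorph_quot (hf : Continuous f) (hsurj : Surjective f)
    (hr : ∀ a b, r a b → f a = f b) (hfib : ∀ a b, f a = f b → Quot.mk r a = Quot.mk r b) :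
    Nonempty (Quot r ≃ₜ Y) := by
  have hinj : Injective (Quot.lift f hr) := by
    rintro ⟨a⟩ ⟨b⟩ h
    exact hfib a b h
  have : CompactSpace (Quot r) := Quot.compactSpace
  exact ⟨Continuous.homeoOfEquivCompactToT2 (f := Equiv.ofBijective (Quot.lift f hr)
    ⟨hinj, hsurj.of_comp (g := Quot.mk r)⟩) (continuous_quot_lift hr hf)⟩

end Quotient

/-! ### The ten-vertex triangulation -/

section TenVertexSurface

/-- The triangles of a triangulation of `N_6` with ten vertices. -/
def triangles : List (List ℕ) :=
  [[0, 1, 6], [0, 1, 7], [0, 2, 5], [0, 2, 6], [0, 3, 5], [0, 3, 8], [0, 4, 8], [0, 4, 9],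
   [0, 7, 9], [1, 2, 4], [1, 2, 9], [1, 3, 4], [1, 3, 7], [1, 5, 8], [1, 5, 9], [1, 6, 8],
   [2, 4, 7], [2, 5, 8], [2, 6, 9], [2, 7, 8], [3, 4, 9], [3, 5, 6], [3, 6, 9], [3, 7, 8],
   [4, 5, 6], [4, 5, 7], [4, 6, 8], [5, 7, 9]]

/-- Exchanges that lead from `triangles` to a triangulation that contains six one-sided cycles of
length four which have a vertex in common and cut the surface into a disc. -/
def surfaceMoves : List (List ℕ × List ℕ) :=
  [([0, 3], [10]), ([1, 8], [11]), ([4, 6], [12]), ([4, 8], [13]), ([7, 8], [14]), ([3, 8], [15]),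
   ([3, 10], [16]), ([6, 12], [17]), ([3, 4], [18]), ([4, 12], [19]), ([3, 16], [20]),
   ([8, 12], [21]), ([1, 6], [22]), ([0, 8], [23]), ([8, 15], [24]), ([1, 9], [25]),
   ([2, 8], [26]), ([10, 15], [27]), ([6, 8], [28]), ([3, 9], [29]), ([3, 15], [30]),
   ([8, 11], [31]), ([0, 1], [32]), ([2, 4], [33]), ([1, 2], [34]), ([0, 4], [35]),
   ([0, 10], [36]), ([8, 14], [37]), ([1, 11], [38]), ([3, 14], [39]), ([4, 13], [40]),
   ([0, 9], [41]), ([1, 4], [42]), ([0, 6], [43]), ([8, 13], [44]), ([2, 9], [45]),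
   ([10, 16], [46]), ([2, 6], [47]), ([6, 9], [48]), ([1, 33], [49]), ([1, 42], [50]),
   ([9, 48], [51]), ([9, 25], [52]), ([4, 19], [53]), ([4, 35], [54]), ([9, 35], [55]),
   ([9, 41], [56]), ([2, 33], [57]), ([2, 34], [58]), ([2, 25], [59]), ([2, 45], [60]),
   ([0, 7], [61]), ([13, 40], [62]), ([4, 53], [5, 40]), ([53], [5, 19, 40]), ([1, 50], [18, 49]),
   ([50], [18, 42, 49]), ([41, 56], [7, 55]), ([56], [7, 9, 55]), ([9, 51], [29, 45]),
   ([51], [29, 45, 48]), ([48], [6, 29, 45]), ([0, 61], [32, 41]), ([61], [7, 32, 41]),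
   ([2, 60], [47, 59]), ([60], [45, 47, 59]), ([9, 52], [5, 45]), ([52], [5, 25, 45]),
   ([13, 62], [19, 35]), ([62], [19, 35, 40]), ([5, 31], [8, 11]), ([31], [8, 11, 28]),
   ([17, 28], [6, 8]), ([28], [6, 8, 11]), ([27, 46], [10, 16]), ([46], [5, 10, 16]),
   ([8, 44], [21, 23]), ([44], [13, 21, 23]), ([5, 38], [1, 11]), ([38], [1, 11, 22]),
   ([15, 27], [16, 24]), ([27], [10, 16, 24]), ([5, 36], [0, 10]), ([36], [0, 10, 23]),
   ([14, 37], [24, 26]), ([37], [8, 24, 26]), ([14, 39], [7, 30]), ([39], [3, 7, 30]),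
   ([4, 42], [18, 33]), ([42], [18, 33, 49]), ([1, 49], [18, 34]), ([49], [18, 33, 34]),
   ([10, 16], [5, 24]), ([16, 24], [5, 15]), ([16], [5, 15, 20]), ([3, 20], [5, 30]),
   ([20], [5, 15, 30]), ([15, 24], [5, 14]), ([15], [5, 14, 30]), ([5, 30], [3, 14]),
   ([30], [3, 7, 14]), ([7, 41], [32, 55]), ([41, 55], [32, 35]), ([41], [0, 32, 35]),
   ([33, 57], [7, 34]), ([34, 57], [7, 58]), ([57], [2, 7, 58]), ([33, 34], [7, 18]),
   ([33], [4, 7, 18]), ([12, 21], [13, 17]), ([12, 17], [5, 13]), ([12], [5, 13, 19]),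
   ([13, 19], [5, 35]), ([19], [5, 35, 40]), ([35, 40], [5, 54]), ([40], [4, 5, 54]),
   ([21, 23], [8, 13]), ([21], [8, 13, 17]), ([8, 23], [10, 13]), ([23], [0, 10, 13]),
   ([5, 17], [6, 13]), ([17], [6, 8, 13]), ([25, 59], [45, 58]), ([45, 59], [47, 58]),
   ([59], [2, 47, 58]), ([1, 25], [5, 34]), ([25, 58], [34, 45]), ([25], [5, 34, 45]),
   ([9, 29], [18, 45]), ([6, 29], [3, 45]), ([29], [3, 18, 45]), ([45, 58], [34, 47]),
   ([34, 58], [7, 47]), ([58], [2, 7, 47]), ([6, 43], [22, 47]), ([0, 43], [2, 22]),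
   ([43], [2, 22, 47]), ([35, 55], [32, 54]), ([32, 55], [7, 54]), ([55], [7, 9, 54]),
   ([0, 35], [13, 32]), ([13, 35], [5, 32]), ([35], [5, 32, 54]), ([2, 47], [7, 22]),
   ([34, 47], [7, 45]), ([45, 47], [6, 7]), ([47], [6, 7, 22]), ([0, 22], [2, 32]),
   ([0, 32], [2, 13]), ([0, 5], [2, 10]), ([0], [2, 10, 13]), ([1, 7], [3, 32]),
   ([11, 22], [1, 6]), ([1, 22], [6, 32]), ([5, 26], [2, 8]), ([7, 32], [3, 54]),
   ([6, 22], [7, 32]), ([22], [2, 7, 32]), ([1, 34], [5, 18]), ([6, 8], [11, 13]),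
   ([8, 24], [10, 26]), ([14, 24], [5, 26]), ([1, 6], [11, 32]), ([10, 26], [8, 24]),
   ([3, 7], [14, 54]), ([3, 32], [1, 54]), ([6, 45], [3, 7]), ([6, 7], [3, 32]),
   ([6, 32], [3, 11]), ([5, 6], [3, 13]), ([6], [3, 11, 13]), ([5, 18], [1, 34]),
   ([3, 7], [32, 45]), ([3, 32], [11, 45]), ([11, 45], [3, 32]), ([9, 18], [4, 45]),
   ([11, 13], [3, 8]), ([14, 54], [3, 7]), ([8, 24], [10, 26]), ([3, 8], [11, 13]),
   ([2, 26], [8, 14]), ([3, 32], [11, 45]), ([8, 14], [2, 26]), ([32, 45], [7, 11]),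
   ([3, 18], [1, 45]), ([7, 11], [32, 45]), ([7, 14], [2, 3]), ([5, 26], [14, 24]),
   ([14, 26], [2, 24]), ([7, 18], [4, 34]), ([8, 13], [10, 11]), ([2, 24], [14, 26]),
   ([3, 7], [2, 54]), ([10, 26], [8, 24]), ([11, 13], [3, 10]), ([14, 26], [2, 24]),
   ([7, 45], [32, 34]), ([3, 10], [11, 13]), ([2, 54], [3, 7]), ([2, 8], [5, 26]),
   ([32, 45], [11, 34]), ([3, 54], [1, 7]), ([2, 7], [3, 32]), ([32, 34], [7, 11]),
   ([11, 13], [3, 10]), ([3, 32], [2, 7]), ([7, 34], [4, 11]), ([10, 11], [3, 8]),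
   ([7, 11], [4, 32]), ([1, 32], [11, 54]), ([24, 26], [2, 8]), ([11, 54], [1, 32]),
   ([2, 8], [24, 26]), ([2, 24], [14, 26]), ([1, 45], [3, 18]), ([1, 32], [11, 54]),
   ([24, 26], [8, 14]), ([3, 18], [1, 45]), ([1, 34], [5, 18]), ([1, 45], [3, 18]),
   ([4, 32], [7, 11]), ([7, 11], [4, 32]), ([4, 11], [32, 34]), ([8, 24], [10, 14]),
   ([3, 10], [8, 13]), ([5, 26], [2, 8]), ([8, 13], [3, 10]), ([2, 3], [7, 14]),
   ([2, 32], [7, 13]), ([7, 13], [2, 32]), ([32, 34], [4, 11]), ([5, 8], [63]), ([4, 5], [64])]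

/-- The disc that is left when the surface is cut open. Its boundary is the cycle `0, …, 47`. -/
def discTriangles : List (List ℕ) :=
  [[18, 45, 46], [38, 41, 42], [43, 44, 45], [38, 40, 41], [18, 19, 45], [19, 43, 45], [3, 4, 10],
   [4, 5, 10], [13, 14, 18], [14, 17, 18], [6, 10, 48], [5, 6, 10], [3, 10, 11], [14, 15, 17],
   [9, 10, 48], [11, 12, 46], [12, 13, 46], [13, 18, 46], [2, 3, 46], [2, 46, 47], [3, 11, 46],
   [37, 42, 43], [37, 38, 42], [21, 22, 30], [22, 29, 30], [30, 31, 33], [23, 26, 27],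
   [21, 30, 43], [30, 35, 43], [30, 34, 35], [30, 33, 34], [23, 25, 26], [22, 27, 28],
   [22, 28, 29], [31, 32, 33], [7, 8, 49], [0, 1, 47], [15, 16, 17], [8, 9, 49], [38, 39, 40],
   [19, 20, 21], [35, 36, 37], [23, 24, 25], [22, 23, 27], [6, 7, 9], [1, 2, 47], [6, 9, 48],
   [7, 9, 49], [19, 21, 43], [35, 37, 43]]

/-- Exchanges that lead from the disc to the cone with apex `48` over its boundary. -/
def discMoves : List (List ℕ × List ℕ) :=
  [([6, 10], [5, 48]), ([5, 10], [4, 48]), ([4, 10], [3, 48]), ([3, 10], [11, 48]),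
   ([3, 11], [46, 48]), ([3, 46], [2, 48]), ([2, 46], [47, 48]), ([2, 47], [1, 48]),
   ([1, 47], [0, 48]), ([6, 9], [7, 48]), ([7, 9], [48, 49]), ([7, 49], [8, 48]),
   ([49], [8, 9, 48]), ([11, 46], [12, 48]), ([12, 46], [13, 48]), ([13, 46], [18, 48]),
   ([13, 18], [14, 48]), ([14, 18], [17, 48]), ([14, 17], [15, 48]), ([15, 17], [16, 48]),
   ([18, 46], [45, 48]), ([18, 45], [19, 48]), ([19, 45], [43, 48]), ([19, 43], [21, 48]),
   ([19, 21], [20, 48]), ([21, 43], [30, 48]), ([21, 30], [22, 48]), ([22, 30], [29, 48]),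
   ([22, 29], [28, 48]), ([22, 28], [27, 48]), ([22, 27], [23, 48]), ([23, 27], [26, 48]),
   ([23, 26], [25, 48]), ([23, 25], [24, 48]), ([30, 43], [35, 48]), ([30, 35], [34, 48]),
   ([30, 34], [33, 48]), ([30, 33], [31, 48]), ([31, 33], [32, 48]), ([35, 43], [37, 48]),
   ([35, 37], [36, 48]), ([37, 43], [42, 48]), ([37, 42], [38, 48]), ([38, 42], [41, 48]),
   ([38, 41], [40, 48]), ([38, 40], [39, 48]), ([43, 45], [44, 48])]

/-- The vertex of the surface that corresponds to the vertex `i` of the disc. -/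
def discLabel (i : ℕ) : ℕ :=
  [5, 63, 8, 10, 5, 63, 8, 10, 5, 14, 2, 13, 5, 14, 2, 13, 5, 32, 7, 54, 5, 32, 7, 54, 5, 64, 4, 9,
   5, 64, 4, 9, 5, 45, 18, 34, 5, 45, 18, 34, 5, 1, 3, 11, 5, 1, 3, 11, 26, 24].getD i 0

/-- The finite sets listed by `T`. -/
def facets (T : List (List ℕ)) : Set (Finset ℕ) := List.toFinset '' {t | t ∈ T}

theorem maskSets_map_mask (T : List (List ℕ)) : maskSets (T.map mask) = facets T := by
  ext t
  simp [maskSets, facets, maskSet_mask]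

theorem facets_map_map (φ : ℕ → ℕ) (T : List (List ℕ)) :
    facets (T.map (List.map φ)) = image φ '' facets T := by
  have himage : ∀ t : List ℕ, (t.map φ).toFinset = t.toFinset.image φ := fun t => by
    ext
    simp
  ext t
  simp [facets, himage]

theorem nonempty_homeomorph_facets_triangles :
    Nonempty (polyhedron (facets triangles) ≃ₜ
      polyhedron (image discLabel '' facets discTriangles)) := by
  have hmoves : deforms [] ((discTriangles.map (List.map discLabel)).map mask) surfaceMoves
      (triangles.map mask) := by decide +kernel
  obtain ⟨g, -⟩ := exists_homeomorph_of_deforms hmoves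
  rw [maskSets_map_mask, maskSets_map_mask, facets_map_map] at g
  exact ⟨g⟩

theorem discTriangles_injOn : ∀ t ∈ facets discTriangles, Set.InjOn discLabel t := by
  have hnodup : ∀ t ∈ discTriangles, (t.map discLabel).Nodup := by decide +kernel
  rintro _ ⟨t, ht, rfl⟩
  simpa [Set.InjOn] using List.inj_on_of_nodup_map (hnodup t ht)

theorem discTriangles_subset_range : ∀ t ∈ facets discTriangles, t ⊆ range 50 := by
  have hlt : ∀ t ∈ discTriangles, ∀ i ∈ t, i < 50 := by decide +kernel
  rintro _ ⟨t, ht, rfl⟩ i hi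
  exact mem_range.2 (hlt t ht i (List.mem_toFinset.1 hi))

theorem discLabel_add_four : ∀ k < 48, k % 8 < 4 → discLabel (k + 4) = discLabel k ∧
    discLabel ((k + 4 + 1) % 48) = discLabel ((k + 1) % 48) := by
  decide +kernel

theorem eq_or_eq_add_four_of_discLabel_eq :
    ∀ a ∈ range 48, ∀ b ∈ range 48, discLabel a = discLabel b →
      a = b ∨ (a % 4 = 0 ∧ b % 4 = 0) ∨ (a % 8 < 4 ∧ b = a + 4) ∨ (b % 8 < 4 ∧ a = b + 4) := by
  decide +kernel

/-- The pair `(i, j)` of vertices is one of the two that are identified when the boundary edges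
from `k` and from `k + 4` are glued. -/
def IsGluedPair (k i j : ℕ) : Prop :=
  (i = k ∧ j = k + 4) ∨ (i = (k + 1) % 48 ∧ j = (k + 4 + 1) % 48)

instance (k i j : ℕ) : Decidable (IsGluedPair k i j) := inferInstanceAs (Decidable (_ ∨ _))

/-- The images of two triangles of the disc meet only in the image of their intersection, or of one
pair of boundary vertices, or of two glued edges. -/
theorem discLabel_eq_cases : ∀ t ∈ discTriangles, ∀ u ∈ discTriangles,
    (∀ i ∈ t, ∀ j ∈ u, discLabel i = discLabel j → i = j) ∨
    (∃ a ∈ t, ∃ b ∈ u, a < 48 ∧ b < 48 ∧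
      ∀ i ∈ t, ∀ j ∈ u, discLabel i = discLabel j → i = a ∧ j = b) ∨
    (∃ k ∈ t, k < 48 ∧ k % 8 < 4 ∧
      ∀ i ∈ t, ∀ j ∈ u, discLabel i = discLabel j → IsGluedPair k i j) ∨
    (∃ k ∈ u, k < 48 ∧ k % 8 < 4 ∧
      ∀ i ∈ t, ∀ j ∈ u, discLabel i = discLabel j → IsGluedPair k j i) := by
  decide +kernel

end TenVertexSurface

noncomputable section Gluing

/-- The point at the position `θ` of the boundary of the disc, whose length is taken to be `48`. -/
def rimPoint (θ : ℝ) : UnitDisc :=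
  ⟨circlePoint 48 θ, by rw [mem_closedBall_zero_iff, norm_circlePoint]⟩

theorem crossCapGluing_rimPoint {k : ℕ} (hk : k < 48) (hk' : k % 8 < 4) {s : ℝ}
    (hs : s ∈ Set.Icc (0 : ℝ) 1) :
    crossCapGluing 6 (rimPoint (k + s)) (rimPoint ((k + 4 : ℕ) + s)) := by
  have hdiv : (k : ℝ) = 8 * (k / 8 : ℕ) + (k % 8 : ℕ) := by
    exact_mod_cast (Nat.div_add_mod k 8).symm
  have hlt : ((k % 8 : ℕ) : ℝ) ≤ 3 := by exact_mod_cast (by omega : k % 8 ≤ 3)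
  obtain ⟨hs0, hs1⟩ := hs
  refine ⟨⟨k / 8, by omega⟩, ((k % 8 : ℕ) + s) / 4, ⟨by positivity, by linarith⟩, ?_, ?_⟩
  all_goals
    simp only [rimPoint, circlePoint, Nat.cast_add, hdiv]
    congr 1
    push_cast
    ring

theorem exists_eq_natCast_add_div {n : ℕ} (hn : n ≠ 0) {t : ℝ} (ht : t ∈ Set.Icc (0 : ℝ) 1) :
    ∃ i < n, ∃ s ∈ Set.Icc (0 : ℝ) 1, t = (i + s) / n := by
  have hn' : (0 : ℝ) < n := by positivity
  rcases ht.2.eq_or_lt with rfl | ht1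
  · refine ⟨n - 1, by omega, 1, by simp, ?_⟩
    rw [Nat.cast_pred (by omega)]
    field_simp
    ring
  · have hnt : 0 ≤ n * t := mul_nonneg hn'.le ht.1
    refine ⟨⌊n * t⌋₊, (Nat.floor_lt hnt).2 (by nlinarith), n * t - ⌊n * t⌋₊,
      ⟨sub_nonneg.2 (Nat.floor_le hnt), ?_⟩, ?_⟩
    · linarith [Nat.lt_floor_add_one (n * t)]
    · field_simp
      ring

theorem exists_rimPoint_of_crossCapGluing {z w : UnitDisc} (h : crossCapGluing 6 z w) :
    ∃ k : ℕ, k < 48 ∧ k % 8 < 4 ∧ ∃ s ∈ Set.Icc (0 : ℝ) 1, z = rimPoint (k + s) ∧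
      w = rimPoint ((k + 4 : ℕ) + s) := by
  obtain ⟨⟨j, hj⟩, t, ht, hz, hw⟩ := h
  obtain ⟨i, hi, s, hs, rfl⟩ := exists_eq_natCast_add_div four_ne_zero ht
  refine ⟨8 * j + i, by omega, by omega, s, hs, Subtype.ext ?_, Subtype.ext ?_⟩
  all_goals
    simp only [hz, hw, rimPoint, circlePoint]
    congr 1
    push_cast
    ring

/-- The point of the surface that comes from the point `rimPoint θ`. -/
def rimImage (θ : ℝ) : NonorientableSurface 6 := Quot.mk _ (rimPoint θ)

theorem rimImage_add_four {k : ℕ} (hk : k < 48) (hk' : k % 8 < 4) {s : ℝ}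
    (hs : s ∈ Set.Icc (0 : ℝ) 1) : rimImage (k + s) = rimImage ((k + 4 : ℕ) + s) :=
  Quot.sound (crossCapGluing_rimPoint hk hk' hs)

theorem rimImage_four_mul {c : ℕ} (hc : c < 12) : rimImage (4 * c : ℕ) = rimImage 0 := by
  induction c with
  | zero => simp
  | succ c ih =>
    rw [← ih (by omega)]
    symm
    rcases Nat.even_or_odd c with ⟨d, hd⟩ | ⟨d, hd⟩
    · simpa [mul_add] using rimImage_add_four (k := 4 * c) (by omega) (by omega)
        (Set.left_mem_Icc.2 zero_le_one)
    · obtain ⟨k, hk⟩ : ∃ k, 4 * c = k + 1 := ⟨4 * c - 1, by omega⟩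
      have h := rimImage_add_four (k := k) (by omega) (by omega) (Set.right_mem_Icc.2 zero_le_one)
      rw [mul_add, hk]
      convert h using 2 <;> push_cast <;> ring

theorem rimImage_eq_of_discLabel_eq {a b : ℕ} (ha : a < 48) (hb : b < 48)
    (h : discLabel a = discLabel b) : rimImage a = rimImage b := by
  have hshift : ∀ {k : ℕ}, k < 48 → k % 8 < 4 → rimImage k = rimImage (k + 4 : ℕ) :=
    fun hk hk' => by simpa using rimImage_add_four hk hk' (Set.left_mem_Icc.2 zero_le_one)
  rcases eq_or_eq_add_four_of_discLabel_eq a (mem_range.2 ha) b (mem_range.2 hb) h with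
    rfl | ⟨ha4, hb4⟩ | ⟨ha8, rfl⟩ | ⟨hb8, rfl⟩
  · rfl
  · obtain ⟨c, rfl⟩ := Nat.dvd_of_mod_eq_zero ha4
    obtain ⟨d, rfl⟩ := Nat.dvd_of_mod_eq_zero hb4
    rw [rimImage_four_mul (by omega), rimImage_four_mul (by omega)]
  · exact hshift ha ha8
  · exact (hshift hb hb8).symm

theorem support_edgePoint_subset (n k : ℕ) (s : ℝ) :
    support (edgePoint n k s) ⊆ ({k, (k + 1) % n} : Finset ℕ) := by
  intro i hi
  by_contra h
  rw [mem_coe, mem_insert, mem_singleton, not_or] at h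
  exact hi (edgePoint_of_ne s h.1 h.2)

theorem edgePoint_zero (n k : ℕ) : edgePoint n k 0 = Pi.single k 1 := by
  simp [edgePoint]

theorem relabel_edgePoint {n k : ℕ} {D : Finset ℕ} (hk : k ∈ D) (hk' : (k + 1) % n ∈ D)
    (φ : ℕ → ℕ) (s : ℝ) : relabel D φ (edgePoint n k s) =
      Pi.single (φ k) (1 - s) + Pi.single (φ ((k + 1) % n)) s := by
  rw [edgePoint, relabel_add, relabel_single hk, relabel_single hk']

theorem relabel_edgePoint_add_four {k : ℕ} (hk : k < 48) (hk' : k % 8 < 4) (s : ℝ) :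
    relabel (range 50) discLabel (edgePoint 48 (k + 4) s) =
      relabel (range 50) discLabel (edgePoint 48 k s) := by
  obtain ⟨h, h'⟩ := discLabel_add_four k hk hk'
  rw [relabel_edgePoint, relabel_edgePoint, h, h'] <;> rw [mem_range] <;> omega

theorem exists_eq_edgePoint {n k : ℕ} {𝒯 : Set (Finset ℕ)} {x : ℕ → ℝ} (hn : 2 ≤ n) (hk : k < n)
    (hx : x ∈ polyhedron 𝒯) (h : support x ⊆ ({k, (k + 1) % n} : Finset ℕ)) :
    ∃ s ∈ Set.Icc (0 : ℝ) 1, x = edgePoint n k s := by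
  obtain ⟨hx0, hsum, -⟩ := hx
  rw [finsum_eq_sum_of_support_subset _ h, sum_pair (add_one_mod_ne hn hk).symm] at hsum
  have hk0 : 0 ≤ x k := hx0 k
  refine ⟨x ((k + 1) % n), ⟨hx0 _, by linarith⟩, funext fun i => ?_⟩
  rcases eq_or_ne i k with rfl | hik
  · rw [edgePoint_self hn hk]
    linarith
  rcases eq_or_ne i ((k + 1) % n) with rfl | hik'
  · rw [edgePoint_next hn hk]
  · rw [edgePoint_of_ne _ hik hik']
    by_contra hi
    simpa [hik, hik'] using h hi

theorem eq_single_of_support_subset {V : Type*} [DecidableEq V] {𝒯 : Set (Finset V)} {x : V → ℝ}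
    {a : V} (hx : x ∈ polyhedron 𝒯) (h : support x ⊆ {a}) : x = Pi.single a 1 := by
  obtain ⟨-, hsum, -⟩ := hx
  rw [finsum_eq_single x a fun i hi => by_contra fun hxi => hi (h hxi)] at hsum
  rw [← hsum]
  ext i
  rcases eq_or_ne i a with rfl | hi
  · simp
  · rw [Pi.single_eq_of_ne hi]
    exact notMem_support.1 (mt (@h i) hi)

theorem discLabel_ne_discLabel_next : ∀ k < 48, discLabel k ≠ discLabel ((k + 1) % 48) := by
  decide +kernel

variable {x y : ℕ → ℝ}

theorem exists_eq_edgePoint_of_isGluedPair {k : ℕ} (hk : k < 48) (hk' : k % 8 < 4)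
    (hx : x ∈ polyhedron (facets discTriangles)) (hy : y ∈ polyhedron (facets discTriangles))
    (h : relabel (range 50) discLabel x = relabel (range 50) discLabel y)
    (hxk : ∀ i, x i ≠ 0 → ∃ j, IsGluedPair k i j) (hyk : ∀ j, y j ≠ 0 → ∃ i, IsGluedPair k i j) :
    ∃ s ∈ Set.Icc (0 : ℝ) 1, x = edgePoint 48 k s ∧ y = edgePoint 48 (k + 4) s := by
  obtain ⟨s, hs, rfl⟩ := exists_eq_edgePoint (n := 48) (by omega) hk hx fun i hi => by
    obtain ⟨j, hij⟩ := hxk i hi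
    simpa using hij.imp And.left And.left
  obtain ⟨s', -, rfl⟩ := exists_eq_edgePoint (n := 48) (by omega) (by omega : k + 4 < 48) hy
    fun j hj => by
      obtain ⟨i, hij⟩ := hyk j hj
      simpa using hij.imp And.right And.right
  rw [relabel_edgePoint_add_four hk hk'] at h
  have hinj : Set.InjOn discLabel ({k, (k + 1) % 48} : Finset ℕ) := by
    have hne := discLabel_ne_discLabel_next k hk
    simp [Set.InjOn, hne, hne.symm]
  have hss' := relabel_injOn (fun i hi => ?_) hinj (support_edgePoint_subset 48 k s)
    (support_edgePoint_subset 48 k s') h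
  · have hnext := congrFun hss' ((k + 1) % 48)
    rw [edgePoint_next (by omega) hk, edgePoint_next (by omega) hk] at hnext
    exact ⟨s, hs, rfl, by rw [hnext]⟩
  · rw [mem_insert, mem_singleton] at hi
    rw [mem_range]
    omega

theorem exists_matching_of_relabel_eq (hx : x ∈ polyhedron (facets discTriangles))
    (hy : y ∈ polyhedron (facets discTriangles))
    (h : relabel (range 50) discLabel x = relabel (range 50) discLabel y) :
    ∃ M : ℕ → ℕ → Prop, (∀ i j, M i j → discLabel i = discLabel j) ∧
      (∀ i, x i ≠ 0 → ∃ j, M i j ∧ y j = x i) ∧ (∀ j, y j ≠ 0 → ∃ i, M i j ∧ x i = y j) ∧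
      ((∀ i j, M i j → i = j) ∨
        (∃ a < 48, ∃ b < 48, ∀ i j, M i j → i = a ∧ j = b) ∨
        (∃ k < 48, k % 8 < 4 ∧ ∀ i j, M i j → IsGluedPair k i j) ∨
        (∃ k < 48, k % 8 < 4 ∧ ∀ i j, M i j → IsGluedPair k j i)) := by
  obtain ⟨-, -, _, ⟨t, ht, rfl⟩, hxt⟩ := hx
  obtain ⟨-, -, _, ⟨u, hu, rfl⟩, hyu⟩ := hy
  have hD := discTriangles_subset_range
  have hinj := discTriangles_injOn
  refine ⟨fun i j => i ∈ t ∧ j ∈ u ∧ discLabel i = discLabel j, fun i j hij => hij.2.2,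
    fun i hi => ?_, fun j hj => ?_, ?_⟩
  · obtain ⟨j, hj, hij, hv⟩ := exists_apply_eq_of_relabel_eq (hD _ ⟨t, ht, rfl⟩)
      (hD _ ⟨u, hu, rfl⟩) (hinj _ ⟨t, ht, rfl⟩) (hinj _ ⟨u, hu, rfl⟩) hxt hyu h hi
    exact ⟨j, ⟨List.mem_toFinset.1 (hxt hi), List.mem_toFinset.1 hj, hij⟩, hv⟩
  · obtain ⟨i, hi, hji, hv⟩ := exists_apply_eq_of_relabel_eq (hD _ ⟨u, hu, rfl⟩)
      (hD _ ⟨t, ht, rfl⟩) (hinj _ ⟨u, hu, rfl⟩) (hinj _ ⟨t, ht, rfl⟩) hyu hxt h.symm hj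
    exact ⟨i, ⟨List.mem_toFinset.1 hi, List.mem_toFinset.1 (hyu hj), hji.symm⟩, hv⟩
  · rcases discLabel_eq_cases t ht u hu with H | ⟨a, -, b, -, ha, hb, H⟩ | ⟨k, -, hk, hk', H⟩ |
      ⟨k, -, hk, hk', H⟩
    · exact .inl fun i j hij => H i hij.1 j hij.2.1 hij.2.2
    · exact .inr (.inl ⟨a, ha, b, hb, fun i j hij => H i hij.1 j hij.2.1 hij.2.2⟩)
    · exact .inr (.inr (.inl ⟨k, hk, hk', fun i j hij => H i hij.1 j hij.2.1 hij.2.2⟩))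
    · exact .inr (.inr (.inr ⟨k, hk, hk', fun i j hij => H i hij.1 j hij.2.1 hij.2.2⟩))

theorem eq_or_glued_of_relabel_eq (hx : x ∈ polyhedron (facets discTriangles))
    (hy : y ∈ polyhedron (facets discTriangles))
    (h : relabel (range 50) discLabel x = relabel (range 50) discLabel y) :
    x = y ∨
    (∃ a < 48, ∃ b < 48, discLabel a = discLabel b ∧ x = Pi.single a 1 ∧ y = Pi.single b 1) ∨
    (∃ k < 48, k % 8 < 4 ∧ ∃ s ∈ Set.Icc (0 : ℝ) 1,
      x = edgePoint 48 k s ∧ y = edgePoint 48 (k + 4) s) ∨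
    (∃ k < 48, k % 8 < 4 ∧ ∃ s ∈ Set.Icc (0 : ℝ) 1,
      y = edgePoint 48 k s ∧ x = edgePoint 48 (k + 4) s) := by
  obtain ⟨M, hM, hxy, hyx, H⟩ := exists_matching_of_relabel_eq hx hy h
  have hxM : ∀ i, x i ≠ 0 → ∃ j, M i j := fun i hi => (hxy i hi).imp fun _ => And.left
  have hyM : ∀ j, y j ≠ 0 → ∃ i, M i j := fun j hj => (hyx j hj).imp fun _ => And.left
  rcases H with H | ⟨a, ha, b, hb, H⟩ | ⟨k, hk, hk', H⟩ | ⟨k, hk, hk', H⟩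
  · refine .inl (funext fun i => ?_)
    by_contra hne
    rcases eq_or_ne (x i) 0 with hi | hi
    · obtain ⟨j, hij, hv⟩ := hyx i fun hyi => hne (hi.trans hyi.symm)
      exact hne (H j i hij ▸ hv)
    · obtain ⟨j, hij, hv⟩ := hxy i hi
      exact hne (H i j hij ▸ hv.symm)
  · have hxa : x = Pi.single a 1 := eq_single_of_support_subset hx fun i hi =>
      (hxM i hi).elim fun j hij => (H i j hij).1
    have hyb : y = Pi.single b 1 := eq_single_of_support_subset hy fun j hj =>
      (hyM j hj).elim fun i hij => (H i j hij).2
    obtain ⟨j, haj⟩ := hxM a (by simp [hxa])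
    exact .inr (.inl ⟨a, ha, b, hb, (H a j haj).2 ▸ hM a j haj, hxa, hyb⟩)
  · exact .inr (.inr (.inl ⟨k, hk, hk', exists_eq_edgePoint_of_isGluedPair hk hk' hx hy h
      (fun i hi => (hxM i hi).imp (H i)) (fun j hj => (hyM j hj).imp fun i => H i j)⟩))
  · exact .inr (.inr (.inr ⟨k, hk, hk', exists_eq_edgePoint_of_isGluedPair hk hk' hy hx h.symm
      (fun j hj => (hyM j hj).imp fun i => H i j) (fun i hi => (hxM i hi).imp (H i))⟩))

theorem maskSets_coneFacets (n : ℕ) :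
    maskSets (((List.range n).map fun k => [k, (k + 1) % n, n]).map mask) = coneFacets n := by
  rw [maskSets_map_mask]
  ext t
  simp [facets, coneFacets, eq_comm]

theorem edgePoint_mem_polyhedron {k : ℕ} (hk : k < 48) {s : ℝ} (hs : s ∈ Set.Icc (0 : ℝ) 1) :
    edgePoint 48 k s ∈ polyhedron (facets discTriangles) := by
  have hedge : ∀ k < 48, ∃ t ∈ discTriangles, ∀ i ∈ [k, (k + 1) % 48], i ∈ t := by decide +kernel
  obtain ⟨t, ht, hkt⟩ := hedge k hk
  refine ⟨edgePoint_nonneg 48 k hs, ?_, _, ⟨t, ht, rfl⟩, (support_edgePoint_subset 48 k s).trans ?_⟩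
  · rw [finsum_eq_sum_of_support_subset _ (support_edgePoint_subset 48 k s),
      sum_pair (add_one_mod_ne (by omega) hk).symm, edgePoint_self (by omega) hk,
      edgePoint_next (by omega) hk, sub_add_cancel]
  · intro i hi
    exact List.mem_toFinset.2 (hkt i (by simpa using hi))

theorem exists_homeomorph_disc : ∃ g : UnitDisc ≃ₜ polyhedron (facets discTriangles),
    ∀ k : ℕ, k < 48 → ∀ s ∈ Set.Icc (0 : ℝ) 1,
      (g (rimPoint (k + s)) : ℕ → ℝ) = edgePoint 48 k s := by
  have hmoves : deforms ((List.range 48).map fun k => mask [k, (k + 1) % 48])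
      (((List.range 48).map fun k => [k, (k + 1) % 48, 48]).map mask) discMoves
      (discTriangles.map mask) := by decide +kernel
  obtain ⟨cone, hcone⟩ := exists_homeomorph_cone (n := 48) (by norm_num)
  have hdeform := exists_homeomorph_of_deforms hmoves
  rw [maskSets_map_mask, maskSets_coneFacets] at hdeform
  obtain ⟨h, hh⟩ := hdeform
  refine ⟨cone.trans h.symm, fun k hk s hs => ?_⟩
  have hrim : h ⟨_, edgePoint_mem_polyhedron hk hs⟩ = cone (rimPoint (k + s)) := by
    refine Subtype.ext ((hh _ ⟨_, List.mem_map_of_mem (List.mem_range.2 hk), ?_⟩).trans ?_)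
    · simpa [maskSet_mask] using support_edgePoint_subset 48 k s
    · rw [hcone, rimPoint, coneCoord_circlePoint (by norm_num) hk hs]
  rw [Homeomorph.trans_apply, ← hrim, Homeomorph.symm_apply_apply]

theorem nonempty_homeomorph_nonorientableSurface :
    Nonempty (NonorientableSurface 6 ≃ₜ polyhedron (image discLabel '' facets discTriangles)) := by
  obtain ⟨g, hg⟩ := exists_homeomorph_disc
  have hrim : ∀ k : ℕ, k < 48 → ∀ s ∈ Set.Icc (0 : ℝ) 1, ∀ z, (g z : ℕ → ℝ) = edgePoint 48 k s →
      Quot.mk _ z = rimImage (k + s) := fun k hk s hs z hz => by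
    rw [g.injective (Subtype.ext (hz.trans (hg k hk s hs).symm)), rimImage]
  have : CompactSpace UnitDisc := isCompact_iff_compactSpace.1 (isCompact_closedBall _ _)
  refine nonempty_homeomorph_quot (f := fun z => ⟨_, relabel_mem_polyhedron
    discTriangles_subset_range (φ := discLabel) (g z).2⟩) ?_ ?_ ?_ ?_
  · exact (continuous_relabel.comp (continuous_subtype_val.comp g.continuous)).subtype_mk _
  · rintro ⟨y, hy⟩
    obtain ⟨x, hx, rfl⟩ := surjOn_relabel discTriangles_subset_range discTriangles_injOn hy
    exact ⟨g.symm ⟨x, hx⟩, by simp⟩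
  · intro z w hzw
    obtain ⟨k, hk, hk', s, hs, rfl, rfl⟩ := exists_rimPoint_of_crossCapGluing hzw
    simp only [hg k hk s hs, hg (k + 4) (by omega) s hs, relabel_edgePoint_add_four hk hk']
  · intro z w h
    rcases eq_or_glued_of_relabel_eq (g z).2 (g w).2 (congrArg Subtype.val h) with
      hzw | ⟨a, ha, b, hb, hab, hz, hw⟩ | ⟨k, hk, hk', s, hs, hz, hw⟩ |
        ⟨k, hk, hk', s, hs, hw, hz⟩
    · rw [g.injective (Subtype.ext hzw)]
    · have h0 : (0 : ℝ) ∈ Set.Icc (0 : ℝ) 1 := by simp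
      rw [hrim a ha 0 h0 z (by rw [hz, edgePoint_zero]),
        hrim b hb 0 h0 w (by rw [hw, edgePoint_zero]), add_zero, add_zero,
        rimImage_eq_of_discLabel_eq ha hb hab]
    · rw [hrim k hk s hs z hz, hrim (k + 4) (by omega) s hs w hw, rimImage_add_four hk hk' hs]
    · rw [hrim k hk s hs w hw, hrim (k + 4) (by omega) s hs z hz, rimImage_add_four hk hk' hs]

end Gluing

section TenVertexComplex

/-- A simplicial complex with ten vertices whose facets are `triangles`. -/
def tenVertexComplex : AbstractSimplicialComplex (Fin 10) where
  faces := {s | s.Nonempty ∧ ∃ t ∈ triangles, ∀ i ∈ s, (i : ℕ) ∈ t}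
  isRelLowerSet_faces := by
    rintro s ⟨hs, t, ht, h⟩
    exact ⟨hs, fun u hu hne => ⟨hne, t, ht, fun i hi => h i (hu hi)⟩⟩
  singleton_mem v := by
    have hcover : ∀ v : Fin 10, ∃ t ∈ triangles, (v : ℕ) ∈ t := by decide
    simpa using hcover v

theorem length_nodup_lt_of_mem_triangles :
    ∀ t ∈ triangles, t.length = 3 ∧ t.Nodup ∧ ∀ i ∈ t, i < 10 := by
  decide

theorem isTwoDimensional_tenVertexComplex : tenVertexComplex.IsTwoDimensional := by
  refine ⟨?_, {0, 1, 6}, ⟨⟨0, by simp⟩, [0, 1, 6], by decide, by decide⟩, by decide⟩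
  rintro s ⟨-, t, ht, hs⟩
  obtain ⟨hlen, hnodup, -⟩ := length_nodup_lt_of_mem_triangles t ht
  rw [← hlen, ← List.toFinset_card_of_nodup hnodup, ← card_map Fin.valEmbedding]
  refine card_le_card fun i hi => ?_
  obtain ⟨j, hj, rfl⟩ := mem_map.1 hi
  exact List.mem_toFinset.2 (hs j hj)

theorem polyhedron_image_faces_tenVertexComplex :
    polyhedron (image Fin.val '' tenVertexComplex.faces) = polyhedron (facets triangles) := by
  refine (polyhedron_mono ?_).antisymm (polyhedron_mono ?_)
  · rintro _ ⟨s, ⟨-, t, ht, hs⟩, rfl⟩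
    refine ⟨_, ⟨t, ht, rfl⟩, fun i hi => ?_⟩
    obtain ⟨j, hj, rfl⟩ := mem_image.1 hi
    exact List.mem_toFinset.2 (hs j hj)
  · rintro _ ⟨t, ht, rfl⟩
    obtain ⟨hlen, -, hlt⟩ := length_nodup_lt_of_mem_triangles t ht
    obtain ⟨a, ha⟩ := List.exists_mem_of_length_pos (by omega : 0 < t.length)
    refine ⟨_, ⟨({v | (v : ℕ) ∈ t} : Finset (Fin 10)), ⟨⟨⟨a, hlt a ha⟩, by simpa⟩, t, ht, by simp⟩,
      rfl⟩, fun i hi => ?_⟩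
    rw [List.mem_toFinset] at hi
    exact mem_image.2 ⟨⟨i, hlt i hi⟩, by simpa, rfl⟩

theorem triangulates_tenVertexComplex :
    tenVertexComplex.Triangulates (NonorientableSurface 6) := by
  obtain ⟨f⟩ := nonempty_homeomorph_image (𝒯 := tenVertexComplex.faces)
    (fun t _ => subset_univ t) Fin.val_injective
  rw [← space_eq_polyhedron, polyhedron_image_faces_tenVertexComplex] at f
  obtain ⟨g⟩ := nonempty_homeomorph_facets_triangles
  obtain ⟨h⟩ := nonempty_homeomorph_nonorientableSurface
  exact ⟨isTwoDimensional_tenVertexComplex, ⟨(f.trans g).trans h.symm⟩⟩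

end TenVertexComplex

/-! ### The immersion -/

section Separation

open scoped Matrix

variable {R S V : Type*}

/-- Six times the signed volume of the tetrahedron `a b c d`. -/
def signedVolume [CommRing R] (a b c d : Fin 3 → R) : R :=
  (b - a) ⨯₃ (c - a) ⬝ᵥ (d - a)

theorem signedVolume_eq [CommRing R] (a b c d : Fin 3 → R) :
    signedVolume a b c d =
      ((b 1 - a 1) * (c 2 - a 2) - (b 2 - a 2) * (c 1 - a 1)) * (d 0 - a 0) +
      ((b 2 - a 2) * (c 0 - a 0) - (b 0 - a 0) * (c 2 - a 2)) * (d 1 - a 1) +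
      ((b 0 - a 0) * (c 1 - a 1) - (b 1 - a 1) * (c 0 - a 0)) * (d 2 - a 2) := by
  simp only [signedVolume, cross_apply, Matrix.vec3_dotProduct, Pi.sub_apply]
  rfl

theorem map_signedVolume [CommRing R] [CommRing S] (f : R →+* S) (a b c d : Fin 3 → R) :
    f (signedVolume a b c d) = signedVolume (f ∘ a) (f ∘ b) (f ∘ c) (f ∘ d) := by
  simp [signedVolume_eq]

/-- The plane through `P v`, `P p` and `P q` weakly separates the points with indices in `s` from
those with indices in `t`, and contains no other points of either family. Its nondegeneracy is
witnessed by a point `P e` outside it. -/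
def SeparatedBy [CommRing R] [PartialOrder R] (P : V → Fin 3 → R) (s t : Set V) (v p q : V) :
    Prop :=
  (∀ i ∈ s, 0 ≤ signedVolume (P v) (P p) (P q) (P i)) ∧
  (∀ i ∈ t, signedVolume (P v) (P p) (P q) (P i) ≤ 0) ∧
  (∀ i ∈ s ∪ t, signedVolume (P v) (P p) (P q) (P i) = 0 → i = v ∨ i = p ∨ i = q) ∧
  ∃ e, signedVolume (P v) (P p) (P q) (P e) ≠ 0

instance [Fintype V] [DecidableEq V] [CommRing R] [PartialOrder R] [DecidableEq R]
    [DecidableLE R] (P : V → Fin 3 → R) (s t : Set V) [DecidablePred (· ∈ s)]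
    [DecidablePred (· ∈ t)] (v p q : V) : Decidable (SeparatedBy P s t v p q) :=
  inferInstanceAs <| Decidable (_ ∧ _ ∧ _ ∧ _)

variable {P : V → Fin 3 → ℝ}

theorem SeparatedBy.mono {s s' t t' : Set V} {v p q : V} (h : SeparatedBy P s' t' v p q)
    (hs : s ⊆ s') (ht : t ⊆ t') : SeparatedBy P s t v p q :=
  ⟨fun i hi => h.1 i (hs hi), fun i hi => h.2.1 i (ht hi),
    fun i hi => h.2.2.1 i (Set.union_subset_union hs ht hi), h.2.2.2⟩

theorem SeparatedBy.intCast {P : V → Fin 3 → ℤ} {s t : Set V} {v p q : V}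
    (h : SeparatedBy P s t v p q) : SeparatedBy (fun i k => (P i k : ℝ)) s t v p q := by
  have hvol (i : V) : signedVolume (fun k => (P v k : ℝ)) (fun k => (P p k : ℝ))
      (fun k => (P q k : ℝ)) (fun k => (P i k : ℝ)) = signedVolume (P v) (P p) (P q) (P i) :=
    (map_signedVolume (Int.castRingHom ℝ) _ _ _ _).symm
  unfold SeparatedBy at *
  simpa only [hvol, Int.cast_nonneg_iff, Int.cast_nonpos, Int.cast_eq_zero, ne_eq] using h

variable [Fintype V] {d : V → ℝ}

theorem sum_mul_signedVolume (hd : ∑ i, d i = 0) (hP : ∑ i, d i • P i = 0) (a b c : Fin 3 → ℝ) :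
    ∑ i, d i * signedVolume a b c (P i) = 0 := by
  calc ∑ i, d i * signedVolume a b c (P i)
      = (b - a) ⨯₃ (c - a) ⬝ᵥ (∑ i, d i • P i - (∑ i, d i) • a) := by
        simp only [signedVolume, sum_smul, ← sum_sub_distrib, ← smul_sub, dotProduct_sum,
          dotProduct_smul, smul_eq_mul]
    _ = 0 := by rw [hd, hP, zero_smul, sub_zero, dotProduct_zero]

theorem eq_zero_of_forall_ne_zero (hd : ∑ i, d i = 0) (hP : ∑ i, d i • P i = 0) {v p q e : V}
    (hvol : signedVolume (P v) (P p) (P q) (P e) ≠ 0)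
    (hsupp : ∀ i, d i ≠ 0 → i = v ∨ i = p ∨ i = q) : d v = 0 := by
  have hsum : ∑ i, d i * signedVolume (P p) (P e) (P q) (P i) =
      d v * signedVolume (P p) (P e) (P q) (P v) := by
    refine sum_eq_single v (fun i _ hiv => ?_) (by simp)
    by_cases hi : d i = 0
    · rw [hi, zero_mul]
    · obtain rfl | rfl | rfl := hsupp i hi
      · exact absurd rfl hiv
      all_goals simp only [signedVolume_eq]; ring
  rw [sum_mul_signedVolume hd hP] at hsum
  have hperm : signedVolume (P p) (P e) (P q) (P v) = signedVolume (P v) (P p) (P q) (P e) := by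
    simp only [signedVolume_eq]; ring
  rw [hperm] at hsum
  exact (mul_eq_zero.1 hsum.symm).resolve_right hvol

theorem eq_zero_of_support_subset_triple (hd : ∑ i, d i = 0) (hP : ∑ i, d i • P i = 0)
    {v p q e : V} (hvol : signedVolume (P v) (P p) (P q) (P e) ≠ 0)
    (hsupp : ∀ i, d i ≠ 0 → i = v ∨ i = p ∨ i = q) : d = 0 := by
  have hrotate (a b c : Fin 3 → ℝ) : signedVolume b c a (P e) = signedVolume a b c (P e) := by
    simp only [signedVolume_eq]; ring
  have hvol' : signedVolume (P p) (P q) (P v) (P e) ≠ 0 := by rwa [hrotate]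
  have hvol'' : signedVolume (P q) (P v) (P p) (P e) ≠ 0 := by rwa [hrotate]
  ext i
  by_contra hi
  obtain rfl | rfl | rfl := hsupp i hi
  · exact hi (eq_zero_of_forall_ne_zero hd hP hvol hsupp)
  · exact hi (eq_zero_of_forall_ne_zero hd hP hvol' fun j hj => or_rotate.1 (hsupp j hj))
  · exact hi (eq_zero_of_forall_ne_zero hd hP hvol'' fun j hj => or_rotate.2 (hsupp j hj))

theorem eq_of_separatedBy {x y : V → ℝ} (hx : 0 ≤ x) (hy : 0 ≤ y)
    (hsum : ∑ i, x i = ∑ i, y i) (hP : ∑ i, x i • P i = ∑ i, y i • P i) {v p q : V}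
    (h : SeparatedBy P (support x) (support y) v p q) : x = y := by
  obtain ⟨hpos, hneg, hplane, e, he⟩ := h
  have hd : ∑ i, (x - y) i = 0 := by simp [hsum]
  have hdP : ∑ i, (x - y) i • P i = 0 := by simp [sub_smul, hP]
  set f : V → ℝ := fun i => signedVolume (P v) (P p) (P q) (P i)
  have hxf (i : V) : 0 ≤ x i * f i := by
    by_cases hi : x i = 0
    · simp [hi]
    · exact mul_nonneg (hx i) (hpos i hi)
  have hyf (i : V) : y i * f i ≤ 0 := by
    by_cases hi : y i = 0
    · simp [hi]
    · exact mul_nonpos_of_nonneg_of_nonpos (hy i) (hneg i hi)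
  have hzero (i : V) : x i * f i - y i * f i = 0 := by
    refine (sum_eq_zero_iff_of_nonneg (f := fun i => x i * f i - y i * f i) fun i _ => ?_).1 ?_ i
      (mem_univ i)
    · linarith [hxf i, hyf i]
    · simpa only [Pi.sub_apply, sub_mul] using sum_mul_signedVolume hd hdP (P v) (P p) (P q)
  refine sub_eq_zero.1 (eq_zero_of_support_subset_triple hd hdP he fun i hi => ?_)
  by_contra hi'
  have hfi (hxy : i ∈ support x ∪ support y) : f i ≠ 0 := fun hf => hi' (hplane i hxy hf)
  have hxi : x i = 0 := by
    by_contra hxi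
    exact mul_ne_zero hxi (hfi (.inl hxi)) (by linarith [hxf i, hyf i, hzero i])
  have hyi : y i = 0 := by
    by_contra hyi
    exact mul_ne_zero hyi (hfi (.inr hyi)) (by linarith [hxf i, hyf i, hzero i])
  exact hi (by simp [hxi, hyi])

theorem isPolyhedralImmersion_of_separatedBy {Δ : AbstractSimplicialComplex V}
    {ψ : V → EuclideanSpace ℝ (Fin 3)}
    (h : ∀ s ∈ Δ.faces, ∀ t ∈ Δ.faces, ∀ v ∈ s, v ∈ t →
      ∃ p q, SeparatedBy (fun i => (ψ i).ofLp) (s : Set V) t v p q) :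
    Δ.IsPolyhedralImmersion ψ := by
  rintro ⟨x, ⟨hx, hxsum⟩, hxΔ⟩
  obtain ⟨v, hv⟩ : ∃ v, x v ≠ 0 := by
    by_contra! h0
    simp [h0] at hxsum
  refine ⟨{y | y.1 v ≠ 0}, ?_, ?_⟩
  · exact (isOpen_ne.preimage ((continuous_apply v).comp continuous_subtype_val)).mem_nhds hv
  rintro ⟨y, ⟨hy, hysum⟩, s, hs, hys⟩ hyv ⟨z, ⟨hz, hzsum⟩, t, ht, hzt⟩ hzv hyz
  obtain ⟨p, q, hsep⟩ := h s hs t ht v (hys v hyv) (hzt v hzv)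
  refine Subtype.ext (eq_of_separatedBy hy hz (hysum.trans hzsum.symm) ?_ (hsep.mono hys hzt))
  simpa [AbstractSimplicialComplex.linearMapOfVertices] using congrArg WithLp.ofLp hyz

end Separation

noncomputable section Immersion

/-- The coordinates of the vertices of an immersion of `tenVertexComplex`. -/
def positions : Fin 10 → Fin 3 → ℤ :=
  ![![-2, -3, -1], ![2, 3, -1], ![-3, 3, 1], ![3, -3, 1], ![3, 2, -3], ![-3, -2, -3],
    ![1, -2, 0], ![-1, 2, 0], ![-1, -2, -1], ![1, 2, -1]]

theorem exists_separatedBy_positions : ∀ t ∈ triangles, ∀ u ∈ triangles, ∀ v : Fin 10,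
    (v : ℕ) ∈ t → (v : ℕ) ∈ u →
      ∃ p q, SeparatedBy positions {i | (i : ℕ) ∈ t} {i | (i : ℕ) ∈ u} v p q := by
  decide +kernel

/-- The positions of the vertices in space. -/
def position (v : Fin 10) : EuclideanSpace ℝ (Fin 3) :=
  WithLp.toLp 2 fun k => (positions v k : ℝ)

theorem isPolyhedralImmersion_position : tenVertexComplex.IsPolyhedralImmersion position := by
  refine isPolyhedralImmersion_of_separatedBy ?_
  rintro s ⟨-, t, ht, hst⟩ s' ⟨-, t', ht', hst'⟩ v hv hv'
  obtain ⟨p, q, h⟩ := exists_separatedBy_positions t ht t' ht' v (hst v hv) (hst' v hv')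
  exact ⟨p, q, h.intCast.mono hst hst'⟩

/-- The involution of the vertices that exchanges `2 * i` and `2 * i + 1`. -/
def swapVertices : Equiv.Perm (Fin 10) :=
  Involutive.toPerm ![1, 0, 3, 2, 5, 4, 7, 6, 9, 8] (by unfold Involutive; decide)

/-- The half-turn about the third coordinate axis. -/
def halfTurn : EuclideanSpace ℝ (Fin 3) ≃ₗᵢ[ℝ] EuclideanSpace ℝ (Fin 3) :=
  LinearIsometryEquiv.piLpCongrRight 2 fun i =>
    if i = 2 then LinearIsometryEquiv.refl ℝ ℝ else LinearIsometryEquiv.neg ℝ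

theorem halfTurn_apply (x : EuclideanSpace ℝ (Fin 3)) (i : Fin 3) :
    halfTurn x i = if i = 2 then x i else - x i := by
  simp only [halfTurn, LinearIsometryEquiv.piLpCongrRight_apply]
  split_ifs <;> simp_all

theorem det_halfTurn :
    LinearMap.det (halfTurn : EuclideanSpace ℝ (Fin 3) →ₗ[ℝ] EuclideanSpace ℝ (Fin 3)) = 1 := by
  rw [← LinearMap.det_toMatrix (EuclideanSpace.basisFun (Fin 3) ℝ).toBasis, Matrix.det_fin_three]
  simp [LinearMap.toMatrix_apply, halfTurn_apply]

theorem isRotationOfOrder_halfTurn : IsRotationOfOrder 2 halfTurn.toAffineIsometryEquiv := by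
  refine ⟨⟨0, by simp⟩, by simpa using det_halfTurn, orderOf_eq_prime ?_ fun h => ?_⟩
  · ext x i
    simp only [sq, AffineIsometryEquiv.coe_mul, comp_apply,
      LinearIsometryEquiv.coe_toAffineIsometryEquiv, halfTurn_apply, AffineIsometryEquiv.coe_one,
      id]
    split_ifs <;> simp
  · have h0 := congrArg (fun f : EuclideanSpace ℝ (Fin 3) ≃ᵃⁱ[ℝ] EuclideanSpace ℝ (Fin 3) =>
      f (EuclideanSpace.single 0 1) 0) h
    norm_num [halfTurn_apply, Fin.ext_iff] at h0

theorem isAutomorphism_of_involutive {V : Type*} {Δ : AbstractSimplicialComplex V}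
    {σ : Equiv.Perm V} (hσ : Involutive σ)
    (h : ∀ s ∈ Δ.faces, s.map σ.toEmbedding ∈ Δ.faces) : Δ.IsAutomorphism σ := by
  refine fun s => ⟨h s, fun hs => ?_⟩
  have hmap : (s.map σ.toEmbedding).map σ.toEmbedding = s := by
    rw [map_map, show σ.toEmbedding.trans σ.toEmbedding = .refl V from DFunLike.ext _ _ hσ,
      map_refl]
  exact hmap ▸ h _ hs

theorem isAutomorphism_swapVertices : tenVertexComplex.IsAutomorphism swapVertices := by
  have htriangles : ∀ t ∈ triangles, ∃ u ∈ triangles, ∀ i : Fin 10, (i : ℕ) ∈ t →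
      ((swapVertices i : Fin 10) : ℕ) ∈ u := by decide +kernel
  refine isAutomorphism_of_involutive (by unfold Involutive; decide) ?_
  rintro s ⟨hs, t, ht, hst⟩
  obtain ⟨u, hu, htu⟩ := htriangles t ht
  refine ⟨hs.map, u, hu, fun i hi => ?_⟩
  obtain ⟨j, hj, rfl⟩ := mem_map.1 hi
  exact htu j (hst j hj)

theorem halfTurn_position (v : Fin 10) : halfTurn (position v) = position (swapVertices v) := by
  have hswap : ∀ v : Fin 10, ∀ k : Fin 3, positions (swapVertices v) k =
      if k = 2 then positions v k else - positions v k := by decide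
  ext k
  simp only [halfTurn_apply, position, hswap]
  split_ifs <;> simp

theorem hasRotationalSymmetry_position : tenVertexComplex.HasRotationalSymmetry position 2 := by
  refine ⟨_, isRotationOfOrder_halfTurn, swapVertices, isAutomorphism_swapVertices, fun x _ => ?_⟩
  simp only [AbstractSimplicialComplex.linearMapOfVertices,
    LinearIsometryEquiv.coe_toAffineIsometryEquiv, map_sum, map_smul, halfTurn_position]
  exact Fintype.sum_equiv swapVertices _ _ fun v => by simp

end Immersion

/-! ### Edges lie in two triangles -/

section PlaneTopology

open unitInterval

/-- The map `f` has a continuous logarithm. On a circle this says that `f` has winding number zero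
about the origin. -/
def HasLog {A : Type*} [TopologicalSpace A] (f : A → ℂ) : Prop :=
  ∃ g : A → ℂ, Continuous g ∧ ∀ a, Complex.exp (g a) = f a

variable {F : ℂ → ℂ}

theorem hasLog_of_homotopy {A : Type*} [TopologicalSpace A] {H : I × A → ℂ} (hH : Continuous H)
    (hH0 : ∀ p, H p ≠ 0) (hlog : HasLog fun a => H (0, a)) : HasLog fun a => H (1, a) := by
  obtain ⟨g, hg, hgH⟩ := hlog
  let H' : C(I × A, {z : ℂ // z ≠ 0}) := ⟨fun p => ⟨H p, hH0 p⟩, by fun_prop⟩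
  have hH'0 : ∀ a, H' (0, a) = (⟨_, (g a).exp_ne_zero⟩ : {z : ℂ // z ≠ 0}) := fun a =>
    Subtype.ext (hgH a).symm
  let L := Complex.isCoveringMap_exp.liftHomotopy H' ⟨g, hg⟩ hH'0
  have hlift := Complex.isCoveringMap_exp.liftHomotopy_lifts H' ⟨g, hg⟩ hH'0
  exact ⟨fun a => L (1, a), by fun_prop, fun a => congrArg Subtype.val (congrFun hlift (1, a))⟩

theorem not_hasLog_of_odd {f : Circle → ℂ} (hf : ∀ u, f (-u) = -f u) : ¬ HasLog f := by
  rintro ⟨g, hg, hgf⟩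
  set jump : Circle → ℝ := fun u => (g (-u) - g u).im
  have hjump : ∀ u, jump u ≠ 0 := fun u h => by
    have hexp : Complex.exp (g (-u) - g u) = -1 := by
      rw [Complex.exp_sub, hgf, hf, ← hgf, neg_div, div_self (Complex.exp_ne_zero _)]
    rw [show g (-u) - g u = ((g (-u) - g u).re : ℂ) from Complex.ext rfl h,
      ← Complex.ofReal_exp] at hexp
    have hneg : Real.exp (g (-u) - g u).re = -1 := mod_cast hexp
    linarith [Real.exp_pos (g (-u) - g u).re]
  have hodd : jump (-1) = -jump 1 := by simp [jump]
  have hcont : Continuous jump := by fun_prop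
  obtain ⟨u, hu⟩ : (0 : ℝ) ∈ Set.range jump := by
    refine (isPreconnected_range hcont).ordConnected.uIcc_subset ⟨1, rfl⟩ ⟨-1, rfl⟩ ?_
    rw [hodd, Set.mem_uIcc]
    grind
  exact hjump u hu

theorem mul_circle_mem_closedBall {s : ℂ} (hs : ‖s‖ ≤ 1) (u : Circle) :
    s * u ∈ Metric.closedBall (0 : ℂ) 1 := by
  rwa [mem_closedBall_zero_iff, norm_mul, Circle.norm_coe, mul_one]

theorem circle_mem_closedBall (u : Circle) : (u : ℂ) ∈ Metric.closedBall (0 : ℂ) 1 := by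
  rw [mem_closedBall_zero_iff, Circle.norm_coe]

theorem norm_unitInterval_le_one (s : I) : ‖((s : ℝ) : ℂ)‖ ≤ 1 := by
  rw [Complex.norm_real, Real.norm_of_nonneg s.2.1]
  exact s.2.2

theorem hasLog_sub_of_forall_ne (hF : ContinuousOn F (Metric.closedBall 0 1)) {b : ℂ}
    (hb : ∀ z ∈ Metric.closedBall 0 1, F z ≠ b) : HasLog fun u : Circle => F u - b := by
  have hmem (p : I × Circle) := mul_circle_mem_closedBall (norm_unitInterval_le_one p.1) p.2
  have hcont : Continuous fun p : I × Circle => F (p.1 * p.2) :=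
    hF.comp_continuous (by fun_prop) hmem
  have h0 : F 0 - b ≠ 0 := sub_ne_zero.2 (hb 0 (by simp))
  simpa using hasLog_of_homotopy (hcont.sub continuous_const)
    (fun p => sub_ne_zero.2 (hb _ (hmem p)))
    ⟨fun _ => Complex.log (F 0 - b), continuous_const, fun _ => by simp [Complex.exp_log h0]⟩

theorem HasLog.sub_of_segment {A : Type*} [TopologicalSpace A] {f : A → ℂ} (hf : Continuous f)
    {b c : ℂ} (hlog : HasLog fun a => f a - b) (hseg : ∀ a, f a ∉ segment ℝ b c) :
    HasLog fun a => f a - c := by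
  have hline (p : I × A) : AffineMap.lineMap b c (p.1 : ℝ) ∈ segment ℝ b c :=
    segment_eq_image_lineMap ℝ b c ▸ ⟨p.1, p.1.2, rfl⟩
  simpa using hasLog_of_homotopy (H := fun p : I × A => f p.2 - AffineMap.lineMap b c (p.1 : ℝ))
    (by fun_prop)
    (fun p h => hseg p.2 (sub_eq_zero.1 h ▸ hline p)) (by simpa using hlog)

theorem not_hasLog_sub_of_injOn (hF : ContinuousOn F (Metric.closedBall 0 1))
    (hinj : Set.InjOn F (Metric.closedBall 0 1)) : ¬ HasLog fun u : Circle => F u - F 0 := by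
  intro hlog
  have hmem (p : I × Circle) : (-(p.1 : ℝ) * p.2 : ℂ) ∈ Metric.closedBall 0 1 :=
    mul_circle_mem_closedBall ((norm_neg _).trans_le (norm_unitInterval_le_one p.1)) p.2
  have hcont : Continuous fun p : I × Circle => F (-(p.1 : ℝ) * p.2) :=
    hF.comp_continuous (by fun_prop) hmem
  have hcont1 : Continuous fun u : Circle => F u :=
    hF.comp_continuous (by fun_prop) circle_mem_closedBall
  refine not_hasLog_of_odd (f := fun u : Circle => F u - F (-u)) (by simp) ?_
  have := hasLog_of_homotopy (H := fun p : I × Circle => F p.2 - F (-(p.1 : ℝ) * p.2))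
    ((hcont1.comp continuous_snd).sub hcont) (fun p h => ?_) (by simpa using hlog)
  · simpa using this
  have heq : (p.2 : ℂ) * (1 + p.1) = 0 := by
    linear_combination hinj (circle_mem_closedBall p.2) (hmem p) (sub_eq_zero.1 h)
  have hne : (1 + p.1 : ℂ) ≠ 0 := mod_cast (by linarith [p.1.2.1] : (1 + p.1 : ℝ) ≠ 0)
  exact mul_ne_zero p.2.coe_ne_zero hne heq

theorem image_unitClosedBall_mem_nhds (hF : ContinuousOn F (Metric.closedBall 0 1))
    (hinj : Set.InjOn F (Metric.closedBall 0 1)) :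
    F '' Metric.closedBall 0 1 ∈ nhds (F 0) := by
  by_contra hnhds
  have hcont : Continuous fun u : Circle => F u :=
    hF.comp_continuous (by fun_prop) circle_mem_closedBall
  have hF0 : F 0 ∈ (Set.range fun u : Circle => F u)ᶜ := by
    rintro ⟨u, hu⟩
    exact u.coe_ne_zero (hinj (circle_mem_closedBall u) (by simp) hu)
  obtain ⟨δ, hδ, hball⟩ := Metric.isOpen_iff.1
    (isCompact_range hcont).isClosed.isOpen_compl _ hF0
  obtain ⟨b, hbδ, hb⟩ : ∃ b ∈ Metric.ball (F 0) δ, b ∉ F '' Metric.closedBall 0 1 :=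
    Set.not_subset.1 fun h => hnhds (Filter.mem_of_superset (Metric.ball_mem_nhds _ hδ) h)
  have hlog := hasLog_sub_of_forall_ne hF fun z hz h => hb ⟨z, hz, h⟩
  refine not_hasLog_sub_of_injOn hF hinj (hlog.sub_of_segment hcont fun u hu => ?_)
  exact hball ((convex_ball _ _).segment_subset hbδ (Metric.mem_ball_self hδ) hu) ⟨u, rfl⟩

/-- Invariance of domain in the plane. -/
theorem image_mem_nhds_of_injOn {D : Set ℂ} {z : ℂ} (hD : D ∈ nhds z) (hF : ContinuousOn F D)
    (hinj : Set.InjOn F D) : F '' D ∈ nhds (F z) := by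
  obtain ⟨r, hr, hrD⟩ := Metric.nhds_basis_closedBall.mem_iff.1 hD
  have hmaps : Set.MapsTo (fun w : ℂ => z + r * w) (Metric.closedBall 0 1) D := fun w hw => by
    refine hrD ?_
    simp only [mem_closedBall_zero_iff] at hw
    simpa [abs_of_pos hr] using mul_le_of_le_one_right hr.le hw
  have hscale : Set.InjOn (fun w : ℂ => z + r * w) (Metric.closedBall 0 1) := fun w _ w' _ h => by
    simpa [hr.ne'] using h
  have := image_unitClosedBall_mem_nhds (hF.comp (by fun_prop) hmaps) (hinj.comp hscale hmaps)
  rw [Set.image_comp] at this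
  simpa using Filter.mem_of_superset this (Set.image_mono hmaps.image_subset)

end PlaneTopology

section HomeomorphInvOn

theorem exists_leftInvOn_of_homeomorph {E F : Type*} [TopologicalSpace E] [TopologicalSpace F]
    [Nonempty E] [Nonempty F] {A : Set E} {B : Set F} (h : A ≃ₜ B) :
    ∃ (f : E → F) (g : F → E), ContinuousOn f A ∧ ContinuousOn g B ∧ Set.MapsTo f A B ∧
      Set.MapsTo g B A ∧ Set.LeftInvOn g f A ∧ Set.LeftInvOn f g B := by
  let f := Function.extend ((↑) : A → E) (fun a => (h a : F)) fun _ => Classical.arbitrary F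
  let g := Function.extend ((↑) : B → F) (fun b => (h.symm b : E)) fun _ => Classical.arbitrary E
  have hf (a : A) : f a = h a := Subtype.val_injective.extend_apply _ _ a
  have hg (b : B) : g b = h.symm b := Subtype.val_injective.extend_apply _ _ b
  refine ⟨f, g, ?_, ?_, fun x hx => ?_, fun y hy => ?_, fun x hx => ?_, fun y hy => ?_⟩
  · rw [continuousOn_iff_continuous_domRestrict]
    exact (continuous_subtype_val.comp h.continuous).congr fun a => (hf a).symm
  · rw [continuousOn_iff_continuous_domRestrict]
    exact (continuous_subtype_val.comp h.symm.continuous).congr fun b => (hg b).symm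
  · exact hf ⟨x, hx⟩ ▸ Subtype.coe_prop _
  · exact hg ⟨y, hy⟩ ▸ Subtype.coe_prop _
  · rw [hf ⟨x, hx⟩, hg, h.symm_apply_apply]
  · rw [hg ⟨y, hy⟩, hf, h.apply_symm_apply]

end HomeomorphInvOn

section StdSimplex

variable {V : Type*} [Fintype V]

theorem eq_of_forall_ne_of_sum_eq {y y' : V → ℝ} (m : V) (h : ∀ i ≠ m, y i = y' i)
    (hsum : ∑ i, y i = ∑ i, y' i) : y = y' := by
  classical
  funext i
  obtain rfl | hi := eq_or_ne i m
  · rw [← add_sum_erase _ _ (mem_univ i), ← add_sum_erase _ _ (mem_univ i),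
      sum_congr rfl fun j hj => h j (ne_of_mem_erase hj)] at hsum
    exact add_right_cancel hsum
  · exact h i hi

theorem exists_pos_of_mem_stdSimplex {y : V → ℝ} (hy : y ∈ stdSimplex ℝ V) : ∃ a, 0 < y a := by
  by_contra! h
  exact (one_pos.trans_eq hy.2.symm).not_ge (sum_nonpos fun i _ => h i)

end StdSimplex

section EdgeLinks

variable {V : Type*} [DecidableEq V]

/-- The link of the edge `u v`: the vertices that span a triangle of `Δ` with it. -/
def edgeLink (Δ : AbstractSimplicialComplex V) (u v : V) : Set V :=
  {w | w ≠ u ∧ w ≠ v ∧ {u, v, w} ∈ Δ.faces}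

/-- Every edge of `Δ` is in exactly two triangles. -/
def IsClosedAtEdges (Δ : AbstractSimplicialComplex V) : Prop :=
  ∀ u v, u ≠ v → {u, v} ∈ Δ.faces → (edgeLink Δ u v).ncard = 2

variable [Fintype V] {Δ : AbstractSimplicialComplex V} {u v w x : V} {y : V → ℝ}

theorem eq_zero_or_exists_mem_edgeLink (hΔ : ∀ s ∈ Δ.faces, s.card ≤ 3) (huv : u ≠ v)
    (hy : y ∈ Δ.space) (hyu : 0 < y u) (hyv : 0 < y v) :
    (∀ i, i ≠ u → i ≠ v → y i = 0) ∨
      ∃ m ∈ edgeLink Δ u v, ∀ i, i ≠ u → i ≠ v → i ≠ m → y i = 0 := by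
  obtain ⟨-, s, hs, hsupp⟩ := hy
  by_cases hm : ∃ m ∈ s, m ≠ u ∧ m ≠ v
  · obtain ⟨m, hms, hmu, hmv⟩ := hm
    have hcard : ({u, v, m} : Finset V).card = 3 :=
      Finset.card_eq_three.2 ⟨u, v, m, huv, hmu.symm, hmv.symm, rfl⟩
    have hsub : ({u, v, m} : Finset V) ⊆ s := by
      simp [insert_subset_iff, hms, hsupp u hyu.ne', hsupp v hyv.ne']
    obtain rfl := Finset.eq_of_subset_of_card_le hsub (hcard ▸ hΔ s hs)
    refine Or.inr ⟨m, ⟨hmu, hmv, hs⟩, fun i hiu hiv him => of_not_not fun hi => ?_⟩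
    simpa [hiu, hiv, him] using hsupp i hi
  · push Not at hm
    exact Or.inl fun i hiu hiv => of_not_not fun hi => hiv (hm i (hsupp i hi) hiu)

theorem eq_of_edgeLink_subsingleton (hΔ : ∀ s ∈ Δ.faces, s.card ≤ 3) (huv : u ≠ v)
    (hlink : (edgeLink Δ u v).Subsingleton) {y' : V → ℝ} (hy : y ∈ Δ.space) (hyu : 0 < y u)
    (hyv : 0 < y v) (hy' : y' ∈ Δ.space) (hyu' : 0 < y' u) (hyv' : 0 < y' v)
    (hu : y u = y' u) (hv : y v = y' v) : y = y' := by
  obtain ⟨m, hm⟩ : ∃ m, edgeLink Δ u v ⊆ {m} :=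
    (hlink.eq_empty_or_singleton).elim (fun h => ⟨u, by simp [h]⟩) fun ⟨m, h⟩ => ⟨m, h.subset⟩
  have hzero {y} (hy : y ∈ Δ.space) (hyu : 0 < y u) (hyv : 0 < y v) (i : V) (hiu : i ≠ u)
      (hiv : i ≠ v) (him : i ≠ m) : y i = 0 := by
    obtain h | ⟨m', hm', h⟩ := eq_zero_or_exists_mem_edgeLink hΔ huv hy hyu hyv
    · exact h i hiu hiv
    · exact h i hiu hiv (hm hm' ▸ him)
  refine eq_of_forall_ne_of_sum_eq m (fun i him => ?_) (hy.1.2.trans hy'.1.2.symm)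
  obtain rfl | hiu := eq_or_ne i u
  · exact hu
  obtain rfl | hiv := eq_or_ne i v
  · exact hv
  rw [hzero hy hyu hyv i hiu hiv him, hzero hy' hyu' hyv' i hiu hiv him]

/-- The points on which the coordinates `u` and `v` are positive. Its trace on the underlying space
of a complex is the open star of the edge `u v`. -/
def openStar (u v : V) : Set (V → ℝ) := {y | 0 < y u ∧ 0 < y v}

end EdgeLinks

section EdgeCharts

variable {V : Type*}

theorem isOpen_openStar (u v : V) : IsOpen (openStar u v) :=
  (isOpen_lt continuous_const (continuous_apply u)).inter
    (isOpen_lt continuous_const (continuous_apply v))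

/-- A chart of the union of two triangles with the common edge `u v` and the apices `w` and `x`. -/
def edgeChart (u v w x : V) (y : V → ℝ) : ℂ := ⟨y u - y v, y w - y x⟩

theorem continuous_edgeChart (u v w x : V) : Continuous (edgeChart u v w x) :=
  Complex.equivRealProdCLM.symm.continuous.comp
    (f := fun y : V → ℝ => (y u - y v, y w - y x)) (by fun_prop)

variable [DecidableEq V] {u v w x : V} {y : V → ℝ}

/-- The parametrization of two triangles with the common edge `u v` and the apices `w` and `x` by
the square `|re z| + |im z| ≤ 1`. -/
noncomputable def page (u v w x : V) (z : ℂ) : V → ℝ :=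
  Pi.single u ((1 - |z.im| + z.re) / 2) + Pi.single v ((1 - |z.im| - z.re) / 2) +
    Pi.single w (max z.im 0) + Pi.single x (max (-z.im) 0)

theorem continuous_page (u v w x : V) : Continuous (page u v w x) := by
  have single (i : V) {c : ℂ → ℝ} (hc : Continuous c) :
      Continuous fun z => (Pi.single i (c z) : V → ℝ) :=
    (continuous_single i).comp hc
  exact (((single u (by fun_prop)).add (single v (by fun_prop))).add
    (single w (by fun_prop))).add (single x (by fun_prop))

theorem page_apply_of_ne {i : V} (hu : i ≠ u) (hv : i ≠ v) (hw : i ≠ w) (hx : i ≠ x) (z : ℂ) :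
    page u v w x z i = 0 := by
  simp [page, hu, hv, hw, hx]

theorem edgeChart_page (huv : u ≠ v) (hwx : w ≠ x) (hwu : w ≠ u) (hwv : w ≠ v) (hxu : x ≠ u)
    (hxv : x ≠ v) (z : ℂ) : edgeChart u v w x (page u v w x z) = z := by
  apply Complex.ext
  · simp only [edgeChart, page, Pi.add_apply, Pi.single_apply, huv, huv.symm, hwu.symm, hwv.symm,
      hxu.symm, hxv.symm, if_true, if_false]
    ring
  · simp [edgeChart, page, Pi.single_apply, hwx, hwx.symm, hwu, hwv, hxu, hxv]

variable [Fintype V]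

theorem page_edgeChart (huv : u ≠ v) (hwx : w ≠ x) (hwu : w ≠ u) (hwv : w ≠ v) (hxu : x ≠ u)
    (hxv : x ≠ v) (hy : y ∈ stdSimplex ℝ V)
    (hsupp : ∀ i, i ≠ u → i ≠ v → i ≠ w → i ≠ x → y i = 0) (h0 : y w = 0 ∨ y x = 0) :
    page u v w x (edgeChart u v w x y) = y := by
  have hsum : y u + y v + y w + y x = 1 := by
    rw [← hy.2, ← sum_subset (subset_univ {u, v, w, x}) (by grind),
      sum_insert (by grind), sum_insert (by grind), sum_pair hwx]
    ring
  have habs : |y w - y x| = y w + y x := by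
    obtain h | h := h0 <;> simp [h, abs_of_nonneg (hy.1 _)]
  have hmax : max (y w - y x) 0 = y w ∧ max (y x - y w) 0 = y x := by
    obtain h | h := h0 <;> simp [h, hy.1 w, hy.1 x]
  funext i
  simp only [page, edgeChart, habs, neg_sub, hmax, Pi.add_apply, Pi.single_apply]
  split_ifs with hu hv hw hx <;> grind

variable {Δ : AbstractSimplicialComplex V} {A : Set (V → ℝ)} {F : (V → ℝ) → ℂ}

theorem page_mem_space (huv : u ≠ v) (hw : w ∈ edgeLink Δ u v) (hx : x ∈ edgeLink Δ u v) {z : ℂ}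
    (hz : page u v w x z ∈ openStar u v) : page u v w x z ∈ Δ.space := by
  have hu : 0 < 1 - |z.im| + z.re := by
    simpa [page, Pi.single_apply, huv, hw.1.symm, hx.1.symm] using hz.1
  have hv : 0 < 1 - |z.im| - z.re := by
    simpa [page, Pi.single_apply, huv.symm, hw.2.1.symm, hx.2.1.symm] using hz.2
  refine ⟨⟨fun i => ?_, ?_⟩, ?_⟩
  · have single_nonneg (j : V) {c : ℝ} (hc : 0 ≤ c) : 0 ≤ (Pi.single j c : V → ℝ) i :=
      (Pi.single_nonneg (α := fun _ : V => ℝ)).2 hc i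
    exact add_nonneg (add_nonneg (add_nonneg (single_nonneg u (by linarith))
      (single_nonneg v (by linarith))) (single_nonneg w (le_max_right _ _)))
      (single_nonneg x (le_max_right _ _))
  · simp only [page, Pi.add_apply, sum_add_distrib, sum_pi_single', mem_univ, if_true]
    linarith [max_zero_add_max_neg_zero_eq_abs_self z.im]
  · rcases le_total 0 z.im with h | h
    · refine ⟨_, hw.2.2, fun i hi => of_not_not fun hmem => hi ?_⟩
      simp only [mem_insert, mem_singleton, not_or] at hmem
      simp [page, hmem, h]
    · refine ⟨_, hx.2.2, fun i hi => of_not_not fun hmem => hi ?_⟩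
      simp only [mem_insert, mem_singleton, not_or] at hmem
      simp [page, hmem, h]

/-- Two triangles with a common edge form a neighbourhood of the points of the edge in a disc, so
that invariance of domain applies to them. -/
theorem image_inter_range_page_mem_nhds (huv : u ≠ v) (hwx : w ≠ x) (hw : w ∈ edgeLink Δ u v)
    (hx : x ∈ edgeLink Δ u v) {z : ℂ} (hz : page u v w x z ∈ openStar u v)
    (hA : A ∈ nhdsWithin (page u v w x z) Δ.space) (hF : ContinuousOn F A) (hinj : Set.InjOn F A) :
    F '' (A ∩ Set.range (page u v w x)) ∈ nhds (F (page u v w x z)) := by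
  have hcont := (continuous_page u v w x).continuousAt (x := z)
  have hmem : ∀ᶠ z' in nhds z, page u v w x z' ∈ Δ.space :=
    (hcont.eventually_mem ((isOpen_openStar u v).mem_nhds hz)).mono fun _ =>
      page_mem_space huv hw hx
  have hnhds := image_mem_nhds_of_injOn (F := F ∘ page u v w x)
    (tendsto_nhdsWithin_iff.2 ⟨hcont, hmem⟩ hA)
    (hF.comp (continuous_page u v w x).continuousOn fun _ h => h)
    (hinj.comp (LeftInverse.injective (edgeChart_page huv hwx hw.1 hw.2.1 hx.1 hx.2.1)).injOn
      fun _ h => h)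
  rwa [Set.image_comp, Set.image_preimage_eq_inter_range] at hnhds

theorem page_edgeChart_of_edgeLink_eq (hΔ : ∀ s ∈ Δ.faces, s.card ≤ 3) (huv : u ≠ v) (hwx : w ≠ x)
    (hlink : edgeLink Δ u v = {w, x}) (hy : y ∈ Δ.space) (hyuv : y ∈ openStar u v) :
    page u v w x (edgeChart u v w x y) = y := by
  have hw : w ∈ edgeLink Δ u v := hlink ▸ Or.inl rfl
  have hx : x ∈ edgeLink Δ u v := hlink ▸ Or.inr rfl
  obtain h | ⟨m, hm, h⟩ := eq_zero_or_exists_mem_edgeLink hΔ huv hy hyuv.1 hyuv.2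
  · exact page_edgeChart huv hwx hw.1 hw.2.1 hx.1 hx.2.1 hy.1 (fun i hu hv _ _ => h i hu hv)
      (Or.inl (h w hw.1 hw.2.1))
  obtain rfl | rfl : m = w ∨ m = x := hlink.subset hm
  · exact page_edgeChart huv hwx hw.1 hw.2.1 hx.1 hx.2.1 hy.1 (fun i hu hv hi _ => h i hu hv hi)
      (Or.inr (h x hx.1 hx.2.1 hwx.symm))
  · exact page_edgeChart huv hwx hw.1 hw.2.1 hx.1 hx.2.1 hy.1 (fun i hu hv _ hi => h i hu hv hi)
      (Or.inl (h w hw.1 hw.2.1 hwx))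

end EdgeCharts

section EdgeInvariance

variable {V W : Type*} [Fintype V] [DecidableEq V] [Fintype W] [DecidableEq W]
  {Δ : AbstractSimplicialComplex V} {Γ : AbstractSimplicialComplex W}
  {f : (V → ℝ) → W → ℝ} {g : (W → ℝ) → V → ℝ} {u v w x m : V}

theorem exists_eq_single_or_exists_mem_openStar {y : V → ℝ} (hy : y ∈ Δ.space) :
    (∃ a, y = Pi.single a 1) ∨ ∃ a b, a ≠ b ∧ {a, b} ∈ Δ.faces ∧ y ∈ openStar a b := by
  obtain ⟨a, ha⟩ := exists_pos_of_mem_stdSimplex hy.1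
  by_cases hb : ∃ b ≠ a, y b ≠ 0
  · obtain ⟨b, hba, hb⟩ := hb
    obtain ⟨hy, s, hs, hsupp⟩ := hy
    refine Or.inr ⟨a, b, hba.symm, (Δ.isRelLowerSet_faces hs).2 ?_ (by simp), ha,
      (hy.1 b).lt_of_ne' hb⟩
    simp [insert_subset_iff, hsupp a ha.ne', hsupp b hb]
  · push Not at hb
    exact Or.inl ⟨a, eq_of_forall_ne_of_sum_eq a (fun i hi => by simp [hb i hi, hi])
      (by simp [hy.1.2])⟩

/-- Only finitely many points of an edge are mapped to vertices. -/
theorem exists_mem_edge_map_mem_openStar (hf : Set.MapsTo f Δ.space Γ.space)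
    (hinj : Set.InjOn f Δ.space) (huv : u ≠ v) (he : {u, v} ∈ Δ.faces) :
    ∃ p ∈ Δ.space, p ∈ openStar u v ∧ p u + p v = 1 ∧ (∀ i, i ≠ u → i ≠ v → p i = 0) ∧
      ∃ a b, a ≠ b ∧ {a, b} ∈ Γ.faces ∧ f p ∈ openStar a b := by
  let e (s : ℝ) : V → ℝ := Pi.single u (1 - s) + Pi.single v s
  have heu (s : ℝ) : e s u = 1 - s := by simp [e, huv]
  have hev (s : ℝ) : e s v = s := by simp [e, huv.symm]
  have hmem (s : ℝ) (hs : s ∈ Set.Ioo 0 1) : e s ∈ Δ.space := by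
    refine ⟨⟨fun i => ?_, by simp [e, sum_add_distrib]⟩, _, he, fun i hi => ?_⟩
    · exact add_nonneg ((Pi.single_nonneg (α := fun _ : V => ℝ)).2 (sub_nonneg.2 hs.2.le) i)
        ((Pi.single_nonneg (α := fun _ : V => ℝ)).2 hs.1.le i)
    · by_contra hcon
      simp only [mem_insert, mem_singleton, not_or] at hcon
      exact hi (by simp [e, hcon])
  have heinj : Set.InjOn (f ∘ e) (Set.Ioo 0 1) := fun s hs t ht hst => by
    simpa [hev] using congrFun (hinj (hmem s hs) (hmem t ht) hst) v
  obtain ⟨-, ⟨s, hs, rfl⟩, hvertex⟩ := ((Set.Ioo_infinite one_pos).image heinj).exists_notMem_finite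
    (Set.finite_range fun a : W => (Pi.single a 1 : W → ℝ))
  refine ⟨e s, hmem s hs, ⟨by simpa [heu] using hs.2, by simpa [hev] using hs.1⟩,
    by simp [heu, hev], fun i hu hv => by simp [e, hu, hv],
    (exists_eq_single_or_exists_mem_openStar (hf (hmem s hs))).resolve_left ?_⟩
  rintro ⟨a, ha⟩
  exact hvertex ⟨a, ha.symm⟩

theorem tendsto_lineMap_nhdsWithin_space {p : V → ℝ} (hp : p ∈ Δ.space) (hm : m ∈ edgeLink Δ u v)
    (hp0 : ∀ i, i ≠ u → i ≠ v → p i = 0) :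
    Filter.Tendsto (AffineMap.lineMap p (Pi.single m 1)) (nhdsWithin (0 : ℝ) (Set.Ioi 0))
      (nhdsWithin p Δ.space) := by
  refine tendsto_nhdsWithin_iff.2 ⟨?_, ?_⟩
  · have : Continuous (AffineMap.lineMap (k := ℝ) p (Pi.single m 1)) := AffineMap.lineMap_continuous
    simpa using (this.tendsto 0).mono_left nhdsWithin_le_nhds
  · filter_upwards [Ioo_mem_nhdsGT one_pos] with t ht
    refine ⟨(convex_stdSimplex ℝ V).lineMap_mem hp.1 (single_mem_stdSimplex ℝ m) ⟨ht.1.le, ht.2.le⟩,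
      _, hm.2.2, fun i hi => ?_⟩
    by_contra hmem
    simp only [mem_insert, mem_singleton, not_or] at hmem
    simp [AffineMap.lineMap_apply_module', hp0 i hmem.1 hmem.2.1, hmem] at hi

/-- The pages of a further triangle at the edge would be mapped into the image of the pages of the
first two, which is open. -/
theorem ncard_edgeLink_le_two (hΓ : ∀ s ∈ Γ.faces, s.card ≤ 3) (hΓc : IsClosedAtEdges Γ)
    (hf : Set.MapsTo f Δ.space Γ.space) (hinj : Set.InjOn f Δ.space)
    (hfc : ContinuousOn f Δ.space) (huv : u ≠ v) (he : {u, v} ∈ Δ.faces) :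
    (edgeLink Δ u v).ncard ≤ 2 := by
  by_contra! htwo
  obtain ⟨w, x, m, hw, hx, hm, hwx, hwm, hxm⟩ := (Set.two_lt_ncard_iff (Set.toFinite _)).1 htwo
  obtain ⟨p, hp, hpuv, -, hp0, a, b, hab, habΓ, hfp⟩ :=
    exists_mem_edge_map_mem_openStar hf hinj huv he
  obtain ⟨c, d, hcd, hlink⟩ := Set.ncard_eq_two.1 (hΓc a b hab habΓ)
  have hpage : page u v w x (edgeChart u v w x p) = p :=
    page_edgeChart huv hwx hw.1 hw.2.1 hx.1 hx.2.1 hp.1 (fun i hu hv _ _ => hp0 i hu hv)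
      (Or.inl (hp0 w hw.1 hw.2.1))
  let A := Δ.space ∩ f ⁻¹' openStar a b
  let F := edgeChart a b c d ∘ f
  have hA : A ∈ nhdsWithin p Δ.space := Filter.inter_mem self_mem_nhdsWithin
    ((hfc p hp).preimage_mem_nhdsWithin ((isOpen_openStar a b).mem_nhds hfp))
  have hF : ContinuousOn F A :=
    (continuous_edgeChart a b c d).comp_continuousOn (hfc.mono Set.inter_subset_left)
  have hFinj : Set.InjOn F A := fun y hy y' hy' h => hinj hy.1 hy'.1 <| by
    rw [← page_edgeChart_of_edgeLink_eq hΓ hab hcd hlink (hf hy.1) hy.2,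
      ← page_edgeChart_of_edgeLink_eq hΓ hab hcd hlink (hf hy'.1) hy'.2]
    exact congrArg _ h
  have hnhds := image_inter_range_page_mem_nhds huv hwx hw hx (hpage.symm ▸ hpuv)
    (hpage.symm ▸ hA) hF hFinj
  rw [hpage] at hnhds
  have himage : F ⁻¹' (F '' (A ∩ Set.range (page u v w x))) ∈ nhdsWithin p Δ.space :=
    (hF p (mem_of_mem_nhdsWithin hp hA)).mono_of_mem_nhdsWithin hA hnhds
  have hline := (tendsto_lineMap_nhdsWithin_space hp hm hp0).eventually_mem
    (Filter.inter_mem hA himage)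
  obtain ⟨t, ⟨htA, y, ⟨hyA, z, hz⟩, hy⟩, ht⟩ := (hline.and self_mem_nhdsWithin).exists
  have hym : y m = 0 := hz ▸ page_apply_of_ne hm.1 hm.2.1 hwm.symm hxm.symm z
  rw [hFinj hyA htA hy, AffineMap.lineMap_apply_module'] at hym
  have htm : t = 0 := by simpa [hp0 m hm.1 hm.2.1] using hym
  exact lt_irrefl 0 (htm ▸ ht)

theorem one_lt_ncard_edgeLink (hΔ : ∀ s ∈ Δ.faces, s.card ≤ 3) (hΓ : ∀ s ∈ Γ.faces, s.card ≤ 3)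
    (hΓc : IsClosedAtEdges Γ) (hf : Set.MapsTo f Δ.space Γ.space)
    (hg : Set.MapsTo g Γ.space Δ.space) (hgf : Set.LeftInvOn g f Δ.space)
    (hginj : Set.InjOn g Γ.space) (hgc : ContinuousOn g Γ.space) (huv : u ≠ v)
    (he : {u, v} ∈ Δ.faces) : 1 < (edgeLink Δ u v).ncard := by
  by_contra! hone
  obtain ⟨p, hp, hpuv, hpsum, -, a, b, hab, habΓ, hfp⟩ :=
    exists_mem_edge_map_mem_openStar hf hgf.injOn huv he
  obtain ⟨c, d, hcd, hlink⟩ := Set.ncard_eq_two.1 (hΓc a b hab habΓ)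
  have hpage := page_edgeChart_of_edgeLink_eq hΓ hab hcd hlink (hf hp) hfp
  let χ (y : V → ℝ) : ℂ := ⟨y u, 1 - (y u + y v)⟩
  have hχ : Continuous χ := Complex.equivRealProdCLM.symm.continuous.comp
    (f := fun y : V → ℝ => (y u, 1 - (y u + y v))) (by fun_prop)
  let A := Γ.space ∩ g ⁻¹' openStar u v
  have hA : A ∈ nhdsWithin (f p) Γ.space := Filter.inter_mem self_mem_nhdsWithin
    ((hgc _ (hf hp)).preimage_mem_nhdsWithin
      ((isOpen_openStar u v).mem_nhds (by rwa [hgf hp])))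
  have hinj : Set.InjOn (χ ∘ g) A := fun y hy y' hy' h => hginj hy.1 hy'.1 <| by
    obtain ⟨hu, hv⟩ := Complex.ext_iff.1 h
    simp only [χ, comp_apply] at hu hv
    exact eq_of_edgeLink_subsingleton hΔ huv (Set.ncard_le_one_iff_subsingleton.1 hone) (hg hy.1)
      hy.2.1 hy.2.2 (hg hy'.1) hy'.2.1 hy'.2.2 hu (by linarith)
  have hnhds := image_inter_range_page_mem_nhds hab hcd (hlink ▸ Or.inl rfl) (hlink ▸ Or.inr rfl)
    (hpage.symm ▸ hfp) (hpage.symm ▸ hA)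
    (hχ.comp_continuousOn (hgc.mono Set.inter_subset_left)) hinj
  have him : {z : ℂ | 0 ≤ z.im} ∈ nhds (χ p) := by
    rw [hpage, comp_apply, hgf hp] at hnhds
    refine Filter.mem_of_superset hnhds ?_
    rintro - ⟨y, ⟨hy, -⟩, rfl⟩
    have := sum_le_univ_sum_of_nonneg (s := {u, v}) (hg hy.1).1.1
    rw [sum_pair huv, (hg hy.1).1.2] at this
    exact sub_nonneg.2 this
  rw [← mem_interior_iff_mem_nhds, Complex.interior_setOfPred_le_im] at him
  simp [χ, hpsum] at him

theorem isClosedAtEdges_of_homeomorph (hΔ : ∀ s ∈ Δ.faces, s.card ≤ 3)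
    (hΓ : ∀ s ∈ Γ.faces, s.card ≤ 3) (hΓc : IsClosedAtEdges Γ) (h : Δ.space ≃ₜ Γ.space) :
    IsClosedAtEdges Δ := by
  obtain ⟨f, g, hfc, hgc, hf, hg, hgf, hfg⟩ := exists_leftInvOn_of_homeomorph h
  intro u v huv he
  exact (ncard_edgeLink_le_two hΓ hΓc hf hgf.injOn hfc huv he).antisymm
    (one_lt_ncard_edgeLink hΔ hΓ hΓc hf hg hgf hfg.injOn hgc huv he)

end EdgeInvariance

/-! ### Line fields and cohomology -/

section LineFields

variable {E ι κ : Type*}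

/-- The tensor product of two vector fields. -/
def tensorField (v : E → ι → ℝ) (v' : E → κ → ℝ) (x : E) (p : ι × κ) : ℝ := v x p.1 * v' x p.2

/-- A field of lines on `K`, represented by a non-vanishing vector field `v` that is continuous up
to sign: the sign disappears from `v ⊗ v`. -/
def IsLineField [TopologicalSpace E] (K : Set E) (v : E → ι → ℝ) : Prop :=
  (∀ x ∈ K, v x ≠ 0) ∧ ContinuousOn (tensorField v v) K

/-- A continuous choice of signs for a line field, that is, a trivialization of the associated
double cover of `K`. -/
def IsSection [TopologicalSpace E] (K : Set E) (v : E → ι → ℝ) (ε : E → ℤˣ) : Prop :=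
  ContinuousOn (fun x => ε x • v x) K

variable [TopologicalSpace E] {K L : Set E} {v : E → ι → ℝ} {v' : E → κ → ℝ} {ε ε' : E → ℤˣ}

theorem IsLineField.mono (hv : IsLineField K v) (h : L ⊆ K) : IsLineField L v :=
  ⟨fun x hx => hv.1 x (h hx), hv.2.mono h⟩

theorem IsLineField.comp {F : Type*} [TopologicalSpace F] {M : Set F} {f : F → E}
    (hv : IsLineField K v) (hf : ContinuousOn f M) (hmaps : Set.MapsTo f M K) :
    IsLineField M (v ∘ f) :=
  ⟨fun _ hx => hv.1 _ (hmaps hx), hv.2.comp hf hmaps⟩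

theorem IsLineField.tensorField (hv : IsLineField K v) (hv' : IsLineField K v') :
    IsLineField K (tensorField v v') := by
  refine ⟨fun x hx => ?_, continuousOn_pi.2 fun p => ?_⟩
  · obtain ⟨i, hi⟩ := Function.ne_iff.1 (hv.1 x hx)
    obtain ⟨j, hj⟩ := Function.ne_iff.1 (hv'.1 x hx)
    exact Function.ne_iff.2 ⟨(i, j), mul_ne_zero hi hj⟩
  · refine ((continuousOn_pi.1 hv.2 (p.1.1, p.2.1)).mul
      (continuousOn_pi.1 hv'.2 (p.1.2, p.2.2))).congr fun x _ => ?_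
    exact mul_mul_mul_comm _ _ _ _

theorem IsSection.mono (hε : IsSection K v ε) (h : L ⊆ K) : IsSection L v ε :=
  ContinuousOn.mono hε h

theorem IsSection.comp {F : Type*} [TopologicalSpace F] {M : Set F} {f : F → E}
    (hε : IsSection K v ε) (hf : ContinuousOn f M) (hmaps : Set.MapsTo f M K) :
    IsSection M (v ∘ f) (ε ∘ f) :=
  ContinuousOn.comp hε hf hmaps

theorem IsSection.congr {w : E → ι → ℝ} (hε : IsSection K v ε) (h : Set.EqOn w v K) :
    IsSection K w ε :=
  ContinuousOn.congr hε fun x hx => by simp only [h hx]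

theorem IsSection.const_mul (hε : IsSection K v ε) (a : ℤˣ) :
    IsSection K v fun x => a * ε x :=
  (ContinuousOn.const_smul hε a).congr fun _ _ => mul_smul _ _ _

theorem IsSection.tensorField (hε : IsSection K v ε) (hε' : IsSection K v' ε') :
    IsSection K (tensorField v v') (ε * ε') :=
  continuousOn_pi.2 fun p => ((continuousOn_pi.1 hε p.1).mul (continuousOn_pi.1 hε' p.2)).congr
    fun x _ => (smul_mul_smul_comm (ε x) (v x p.1) (ε' x) (v' x p.2)).symm

theorem IsSection.continuousOn_tensorField_self (hε : IsSection K v ε) :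
    ContinuousOn (_root_.tensorField v v) K := by
  refine ContinuousOn.congr (hε.tensorField hε) fun x _ => ?_
  simp only [Pi.mul_apply, Int.units_mul_self, one_smul]

end LineFields

section DotProduct

variable {E ι κ : Type*} [Fintype ι]

theorem dotProduct_self_pos {w : ι → ℝ} (hw : w ≠ 0) : 0 < w ⬝ᵥ w := by
  simpa using Matrix.dotProduct_star_self_pos_iff.2 hw

theorem tensorField_dotProduct_tensorField [Fintype κ] (v : E → ι → ℝ) (v' : E → κ → ℝ) (x y : E) :
    tensorField v v' x ⬝ᵥ tensorField v v' y = (v x ⬝ᵥ v y) * (v' x ⬝ᵥ v' y) := by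
  simp only [dotProduct, sum_mul_sum, Fintype.sum_prod_type, tensorField, mul_mul_mul_comm]

end DotProduct

section Sections

variable {E ι : Type*} [TopologicalSpace E] {K : Set E} {v v' : E → ι → ℝ} {ε ε' : E → ℤˣ}

theorem IsLineField.continuousOn_dotProduct_self [Fintype ι] (hv : IsLineField K v) :
    ContinuousOn (fun x => v x ⬝ᵥ v x) K :=
  continuousOn_finsetSum _ fun i _ => continuousOn_pi.1 hv.2 (i, i)

theorem IsSection.mul_eq_mul [Finite ι] (hv : IsLineField K v) (hK : IsPreconnected K)
    (hε : IsSection K v ε) (hε' : IsSection K v ε') {x y : E} (hx : x ∈ K) (hy : y ∈ K) :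
    ε x * ε' x = ε y * ε' y := by
  have := Fintype.ofFinite ι
  have hmul (x : E) : (ε x • v x) ⬝ᵥ (ε' x • v x) = (ε x * ε' x) • (v x ⬝ᵥ v x) := by
    rw [smul_dotProduct, dotProduct_smul, mul_smul]
  have hcont : ContinuousOn (fun x => (ε x * ε' x) • (v x ⬝ᵥ v x)) K := by
    simp only [← hmul]
    exact continuousOn_finsetSum _ fun i _ => (continuousOn_pi.1 hε i).mul (continuousOn_pi.1 hε' i)
  have hne {x : E} (hx : x ∈ K) : v x ⬝ᵥ v x ≠ 0 := (dotProduct_self_pos (hv.1 x hx)).ne'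
  have hsq (u : ℤˣ) (r : ℝ) : (u • r) ^ 2 = r ^ 2 := by
    rcases Int.units_eq_one_or u with rfl | rfl <;> simp
  have hsign {u : ℤˣ} {r : ℝ} (hr : r ≠ 0) : (u • r = r ↔ u = 1) ∧ (u • r = -r ↔ u = -1) := by
    rcases Int.units_eq_one_or u with rfl | rfl <;> simp [hr, self_eq_neg, neg_eq_self]
  rcases hK.eq_or_eq_neg_of_sq_eq hcont hv.continuousOn_dotProduct_self (fun x _ => hsq _ _) hne
    with h | h
  · rw [(hsign (hne hx)).1.1 (h hx), (hsign (hne hy)).1.1 (h hy)]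
  · rw [(hsign (hne hx)).2.1 (h hx), (hsign (hne hy)).2.1 (h hy)]

theorem IsLineField.exists_isSection_of_continuousOn_smul [Finite ι] (hv : IsLineField K v)
    {c : E → ℝ} (hc : ∀ x ∈ K, c x ≠ 0) (hcv : ContinuousOn (fun x => c x • v x) K) :
    ∃ ε, IsSection K v ε := by
  have := Fintype.ofFinite ι
  have hpos (x : E) (hx : x ∈ K) : v x ⬝ᵥ v x ≠ 0 := (dotProduct_self_pos (hv.1 x hx)).ne'
  have habs : ContinuousOn (fun x => |c x|) K := by
    have hdot : ContinuousOn (fun x => (c x • v x) ⬝ᵥ (c x • v x)) K :=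
      continuousOn_finsetSum _ fun i _ => (continuousOn_pi.1 hcv i).mul (continuousOn_pi.1 hcv i)
    refine (hdot.div hv.continuousOn_dotProduct_self hpos).sqrt.congr fun x hx => ?_
    simp only [Pi.div_apply, smul_dotProduct, dotProduct_smul, smul_eq_mul]
    rw [← mul_assoc, mul_div_cancel_right₀ _ (hpos x hx), Real.sqrt_mul_self_eq_abs]
  refine ⟨fun x => if 0 < c x then 1 else -1,
    ((habs.inv₀ fun x hx => abs_ne_zero.2 (hc x hx)).smul hcv).congr fun x hx => ?_⟩
  have hcx := hc x hx
  simp only [Pi.smul_apply', Pi.inv_apply, smul_smul]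
  rcases hcx.lt_or_gt with h | h
  · rw [if_neg h.not_gt, abs_of_neg h, inv_neg, neg_mul, inv_mul_cancel₀ hcx, Units.neg_smul,
      one_smul, neg_one_smul]
  · rw [if_pos h, abs_of_pos h, inv_mul_cancel₀ hcx, one_smul, one_smul]

theorem IsLineField.exists_isSection_of_dotProduct_ne_zero [Fintype ι] (hv' : IsLineField K v')
    (hε : IsSection K v ε) (hne : ∀ x ∈ K, v x ⬝ᵥ v' x ≠ 0) : ∃ ε', IsSection K v' ε' := by
  refine hv'.exists_isSection_of_continuousOn_smul (c := fun x => (ε x • v x) ⬝ᵥ v' x)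
    (fun x hx => ?_) (continuousOn_pi.2 fun j => ?_)
  · rw [smul_dotProduct]
    exact smul_ne_zero_iff_ne _ |>.2 (hne x hx)
  · simp only [dotProduct, Pi.smul_apply, smul_eq_mul, sum_mul, mul_assoc]
    exact continuousOn_finsetSum _ fun i _ =>
      (continuousOn_pi.1 hε i).mul (continuousOn_pi.1 hv'.2 (i, j))

end Sections

section Convex

variable {E ι : Type*} {K : Set E} {v : E → ι → ℝ}

theorem IsLineField.exists_dotProduct_ne_zero [PseudoMetricSpace E] [Fintype ι] (hK : IsCompact K)
    (hv : IsLineField K v) :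
    ∃ δ > 0, ∀ x ∈ K, ∀ y ∈ K, dist x y < δ → v x ⬝ᵥ v y ≠ 0 := by
  have : CompactSpace K := isCompact_iff_compactSpace.1 hK
  have hcont : Continuous fun p : K × K => (v p.1 ⬝ᵥ v p.2) * (v p.1 ⬝ᵥ v p.2) := by
    have h := continuousOn_iff_continuous_domRestrict.1 hv.2
    simp only [← tensorField_dotProduct_tensorField]
    exact continuous_finsetSum _ fun i _ => ((continuous_apply i).comp (h.comp continuous_fst)).mul
      ((continuous_apply i).comp (h.comp continuous_snd))
  have hmem : {p : K × K | (v p.1 ⬝ᵥ v p.2) * (v p.1 ⬝ᵥ v p.2) ≠ 0} ∈ uniformity K := by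
    rw [← nhdsSet_diagonal_eq_uniformity, (isOpen_ne_fun hcont continuous_const).mem_nhdsSet]
    rintro ⟨x, y⟩ hxy
    obtain rfl : x = y := hxy
    exact (mul_self_pos.2 (dotProduct_self_pos (hv.1 x x.2)).ne').ne'
  obtain ⟨δ, hδ, h⟩ := Metric.mem_uniformity_dist.1 hmem
  refine ⟨δ, hδ, fun x hx y hy hxy h0 => ?_⟩
  exact h (a := ⟨x, hx⟩) (b := ⟨y, hy⟩) hxy (by simp only [h0, mul_zero])

theorem IsLineField.exists_isSection [NormedAddCommGroup E] [NormedSpace ℝ E] [Finite ι]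
    (hK : IsCompact K) (hconv : Convex ℝ K) (hv : IsLineField K v) : ∃ ε, IsSection K v ε := by
  have := Fintype.ofFinite ι
  rcases K.eq_empty_or_nonempty with rfl | ⟨x₀, hx₀⟩
  · exact ⟨fun _ => 1, continuousOn_empty _⟩
  obtain ⟨δ, hδ, hne⟩ := hv.exists_dotProduct_ne_zero hK
  obtain ⟨C, hC⟩ := hK.isBounded.subset_closedBall x₀
  obtain ⟨N, hN⟩ := exists_nat_gt (C / δ)
  have hC0 : 0 ≤ C := by simpa using hC hx₀
  have hN0 : (0 : ℝ) < N := lt_of_le_of_lt (by positivity) hN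
  let P (m : ℕ) (x : E) : E := AffineMap.lineMap x₀ x ((m : ℝ) / N)
  have hPK {m : ℕ} (hm : m ≤ N) : Set.MapsTo (P m) K K := fun x hx =>
    hconv.lineMap_mem hx₀ hx ⟨by positivity, (div_le_one hN0).2 (by exact_mod_cast hm)⟩
  have hPc (m : ℕ) : Continuous (P m) := by
    simp only [P, AffineMap.lineMap_apply_module]
    fun_prop
  have hclose {m : ℕ} {x : E} (hx : x ∈ K) : dist (P m x) (P (m + 1) x) < δ := by
    rw [dist_lineMap_lineMap, Real.dist_eq, abs_sub_comm, Nat.cast_succ, ← sub_div,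
      add_sub_cancel_left, abs_of_pos (by positivity), one_div, inv_mul_lt_iff₀ hN0, dist_comm]
    exact (Metric.mem_closedBall.1 (hC hx)).trans_lt ((div_lt_iff₀ hδ).1 hN)
  have key (m : ℕ) (hm : m ≤ N) : ∃ ε, IsSection K (v ∘ P m) ε := by
    induction m with
    | zero =>
      refine ⟨fun _ => 1, ?_⟩
      simpa [IsSection, P] using continuousOn_const
    | succ m ih =>
      obtain ⟨ε, hε⟩ := ih (by lia)
      exact (hv.comp (hPc _).continuousOn (hPK hm)).exists_isSection_of_dotProduct_ne_zero hε
        fun x hx => hne _ (hPK (by lia) hx) _ (hPK hm hx) (hclose hx)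
  simpa [P, comp_def, div_self hN0.ne'] using key N le_rfl

end Convex

section FaceSpace

variable {V : Type*} [Fintype V] {Δ : AbstractSimplicialComplex V} {s t : Finset V} {y : V → ℝ}

/-- The closed simplex with vertex set `s`, in barycentric coordinates. -/
def faceSpace (s : Finset V) : Set (V → ℝ) := {y | y ∈ stdSimplex ℝ V ∧ ∀ i, y i ≠ 0 → i ∈ s}

theorem faceSpace_eq_inter (s : Finset V) :
    faceSpace s = stdSimplex ℝ V ∩ {y | ∀ i, i ∉ s → y i = 0} :=
  Set.ext fun _ => and_congr_right fun _ => forall_congr' fun _ => not_imp_comm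

theorem convex_faceSpace (s : Finset V) : Convex ℝ (faceSpace s) := by
  rw [faceSpace_eq_inter]
  refine (convex_stdSimplex ℝ V).inter fun x hx y hy a b _ _ _ i hi => ?_
  simp only [Pi.add_apply, Pi.smul_apply, hx i hi, hy i hi, smul_zero, add_zero]

theorem isClosed_faceSpace (s : Finset V) : IsClosed (faceSpace s) := by
  rw [faceSpace_eq_inter]
  simp only [Set.ofPred_forall]
  exact (isClosed_stdSimplex ℝ V).inter
    (isClosed_biInter fun i _ => isClosed_eq (continuous_apply i) continuous_const)

theorem isCompact_faceSpace (s : Finset V) : IsCompact (faceSpace s) :=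
  (isCompact_stdSimplex ℝ V).of_isClosed_subset (isClosed_faceSpace s) fun _ h => h.1

theorem single_mem_faceSpace [DecidableEq V] {u : V} (hu : u ∈ s) : Pi.single u 1 ∈ faceSpace s :=
  ⟨single_mem_stdSimplex ℝ u, fun i hi => by
    rwa [not_imp_comm.1 (fun h => Pi.single_eq_of_ne h _) hi]⟩

theorem faceSpace_mono (h : s ⊆ t) : faceSpace s ⊆ faceSpace t :=
  fun _ hy => ⟨hy.1, fun i hi => h (hy.2 i hi)⟩

theorem faceSpace_inter [DecidableEq V] (s t : Finset V) :
    faceSpace (s ∩ t) = faceSpace s ∩ faceSpace t := by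
  ext y
  simp only [faceSpace, mem_inter, Set.mem_inter_iff, Set.mem_ofPred_eq, imp_and,
    forall_and]
  tauto

theorem faceSpace_subset_space (hs : s ∈ Δ.faces) : faceSpace s ⊆ Δ.space :=
  fun _ hy => ⟨hy.1, s, hs, hy.2⟩

theorem exists_ne_zero_of_mem_stdSimplex (hy : y ∈ stdSimplex ℝ V) : ∃ i, y i ≠ 0 :=
  (exists_pos_of_mem_stdSimplex hy).imp fun _ => ne_of_gt

theorem support_mem_faces (hy : y ∈ Δ.space) : ({i | y i ≠ 0} : Finset V) ∈ Δ.faces := by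
  obtain ⟨hy, s, hs, hsupp⟩ := hy
  obtain ⟨i, hi⟩ := exists_ne_zero_of_mem_stdSimplex hy
  exact (Δ.isRelLowerSet_faces hs).2 (fun j hj => hsupp j ((mem_filter_univ j).1 hj))
    ⟨i, (mem_filter_univ i).2 hi⟩

theorem continuousOn_space {X : Type*} [TopologicalSpace X] {f : (V → ℝ) → X}
    (hf : ∀ s ∈ Δ.faces, ContinuousOn f (faceSpace s)) : ContinuousOn f Δ.space := by
  have h : Δ.space = ⋃ s : Δ.faces, faceSpace s.1 := by
    ext y
    simp only [Set.mem_iUnion]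
    exact ⟨fun ⟨h, s, hs, h'⟩ => ⟨⟨s, hs⟩, h, h'⟩, fun ⟨s, h, h'⟩ => ⟨h, s.1, s.2, h'⟩⟩
  rw [h]
  exact (locallyFinite_of_finite _).continuousOn_iUnion (fun s => isClosed_faceSpace s.1)
    fun s => hf s.1 s.2

end FaceSpace

section Cochains

variable {V : Type*} [DecidableEq V] {Δ : AbstractSimplicialComplex V} {b : V → V → ℤˣ}
  {s : Finset V} {u v w : V}

/-- A simplicial 1-cocycle with values in `ℤˣ ≅ ℤ/2ℤ`. Edges need not be oriented, since every
element of `ℤˣ` is its own inverse. -/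
def IsCocycle (Δ : AbstractSimplicialComplex V) (b : V → V → ℤˣ) : Prop :=
  ∀ u v w, {u, v, w} ∈ Δ.faces → b u v * b v w = b u w

/-- A simplicial 1-coboundary with values in `ℤˣ`. -/
def IsCoboundary (Δ : AbstractSimplicialComplex V) (b : V → V → ℤˣ) : Prop :=
  ∃ g : V → ℤˣ, ∀ u v, {u, v} ∈ Δ.faces → b u v = g u * g v

theorem IsCocycle.mul_eq (hb : IsCocycle Δ b) (hs : s ∈ Δ.faces) (hu : u ∈ s) (hv : v ∈ s)
    (hw : w ∈ s) : b u v * b v w = b u w :=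
  hb u v w ((Δ.isRelLowerSet_faces hs).2
    (insert_subset hu (insert_subset hv (singleton_subset_iff.2 hw))) (insert_nonempty _ _))

theorem IsCocycle.self (hb : IsCocycle Δ b) (hs : s ∈ Δ.faces) (hu : u ∈ s) : b u u = 1 :=
  mul_eq_left.1 (hb.mul_eq hs hu hu hu)

theorem IsCocycle.symm (hb : IsCocycle Δ b) (hs : s ∈ Δ.faces) (hu : u ∈ s) (hv : v ∈ s) :
    b v u = b u v := by
  have h := hb.mul_eq hs hu hv hu
  rw [hb.self hs hu, mul_eq_one_iff_eq_inv', Int.units_inv_eq_self] at h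
  exact h

theorem units_mul_eq_mul_swap :
    ∀ {a b c d : ℤˣ}, a * b = c * d → a * c = b * d := by
  decide

end Cochains

section Holonomy

variable {V ι κ : Type*} [Fintype V] [DecidableEq V] {Δ : AbstractSimplicialComplex V}
  {v : (V → ℝ) → ι → ℝ} {v' : (V → ℝ) → κ → ℝ} {b b' : V → V → ℤˣ}

/-- The cochain `b` is the holonomy of the line field `v`: it compares the values at two vertices
of a section of `v` over a face. -/
def IsHolonomy (Δ : AbstractSimplicialComplex V) (v : (V → ℝ) → ι → ℝ) (b : V → V → ℤˣ) : Prop :=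
  ∀ s ∈ Δ.faces, ∃ ε, IsSection (faceSpace s) v ε ∧
    ∀ u ∈ s, ∀ w ∈ s, b u w = ε (Pi.single u 1) * ε (Pi.single w 1)

theorem exists_isHolonomy [Finite ι] (hv : IsLineField Δ.space v) : ∃ b, IsHolonomy Δ v b := by
  have hv' {s} (hs : s ∈ Δ.faces) := hv.mono (faceSpace_subset_space hs)
  have hsec (s) (hs : s ∈ Δ.faces) : ∃ ε, IsSection (faceSpace s) v ε :=
    (hv' hs).exists_isSection (isCompact_faceSpace s) (convex_faceSpace s)
  choose! ε hε using hsec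
  refine ⟨fun u w => ε {u, w} (Pi.single u 1) * ε {u, w} (Pi.single w 1),
    fun s hs => ⟨ε s, hε s hs, fun u hu w hw => ?_⟩⟩
  have hsub : {u, w} ⊆ s := insert_subset hu (singleton_subset_iff.2 hw)
  have hface : {u, w} ∈ Δ.faces := (Δ.isRelLowerSet_faces hs).2 hsub (insert_nonempty _ _)
  exact units_mul_eq_mul_swap ((hε _ hface).mul_eq_mul (hv' hface)
    (convex_faceSpace _).isPreconnected ((hε s hs).mono (faceSpace_mono hsub))
    (single_mem_faceSpace (mem_insert_self _ _))
    (single_mem_faceSpace (mem_insert_of_mem (mem_singleton_self _))))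

theorem IsHolonomy.isCocycle (hb : IsHolonomy Δ v b) : IsCocycle Δ b := by
  intro u w x hs
  obtain ⟨ε, -, hε⟩ := hb _ hs
  rw [hε u (by simp) w (by simp), hε w (by simp) x (by simp), hε u (by simp) x (by simp),
    mul_assoc, ← mul_assoc (ε (Pi.single w 1)), Int.units_mul_self, one_mul]

theorem IsHolonomy.tensorField (hb : IsHolonomy Δ v b) (hb' : IsHolonomy Δ v' b') :
    IsHolonomy Δ (tensorField v v') (b * b') := by
  intro s hs
  obtain ⟨ε, hε, h⟩ := hb s hs
  obtain ⟨ε', hε', h'⟩ := hb' s hs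
  refine ⟨ε * ε', hε.tensorField hε', fun u hu w hw => ?_⟩
  simp only [Pi.mul_apply, h u hu w hw, h' u hu w hw, mul_mul_mul_comm]

theorem IsHolonomy.exists_isSection [Finite ι] (hv : IsLineField Δ.space v) (hb : IsHolonomy Δ v b)
    (h : IsCoboundary Δ b) : ∃ ε, IsSection Δ.space v ε := by
  obtain ⟨g, hg⟩ := h
  have hsec (s) (hs : s ∈ Δ.faces) :
      ∃ ε, IsSection (faceSpace s) v ε ∧ ∀ u ∈ s, ε (Pi.single u 1) = g u := by
    obtain ⟨ε, hε, h⟩ := hb s hs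
    obtain ⟨w, hw⟩ := (Δ.isRelLowerSet_faces hs).1
    refine ⟨_, hε.const_mul (ε (Pi.single w 1) * g w), fun u hu => ?_⟩
    have hwu := hg w u ((Δ.isRelLowerSet_faces hs).2
      (insert_subset hw (singleton_subset_iff.2 hu)) (insert_nonempty _ _))
    rw [mul_right_comm, ← h w hw u hu, hwu, mul_right_comm, Int.units_mul_self, one_mul]
  choose! ε hε hεg using hsec
  have hagree {s t} (hs : s ∈ Δ.faces) (ht : t ∈ Δ.faces) {y} (hys : y ∈ faceSpace s)
      (hyt : y ∈ faceSpace t) : ε s y = ε t y := by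
    obtain ⟨u, hu⟩ := exists_ne_zero_of_mem_stdSimplex hys.1
    have hus := hys.2 u hu
    have hut := hyt.2 u hu
    have hu' := mem_inter.2 ⟨hus, hut⟩
    have hst := (Δ.isRelLowerSet_faces hs).2 inter_subset_left ⟨u, hu'⟩
    have key := ((hε s hs).mono (faceSpace_mono inter_subset_left)).mul_eq_mul
      (hv.mono (faceSpace_subset_space hst)) (convex_faceSpace _).isPreconnected
      ((hε t ht).mono (faceSpace_mono inter_subset_right))
      ((faceSpace_inter s t).superset ⟨hys, hyt⟩) (single_mem_faceSpace hu')
    rwa [hεg s hs u hus, hεg t ht u hut, Int.units_mul_self, mul_eq_one_iff_eq_inv,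
      Int.units_inv_eq_self] at key
  refine ⟨fun y => ε {i | y i ≠ 0} y, continuousOn_space fun s hs =>
    ContinuousOn.congr (hε s hs) fun y hy => congrArg (· • v y) ?_⟩
  exact hagree (support_mem_faces (faceSpace_subset_space hs hy)) hs
    ⟨hy.1, fun i hi => (mem_filter_univ i).2 hi⟩ hy

theorem IsHolonomy.isCoboundary [Finite ι] (hv : IsLineField Δ.space v) (hb : IsHolonomy Δ v b)
    {ε : (V → ℝ) → ℤˣ} (hε : IsSection Δ.space v ε) : IsCoboundary Δ b := by
  refine ⟨fun u => ε (Pi.single u 1), fun u w hface => ?_⟩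
  obtain ⟨ε', hε', h⟩ := hb _ hface
  have hu := mem_insert_self u {w}
  have hw : w ∈ ({u, w} : Finset V) := mem_insert_of_mem (mem_singleton_self w)
  have hsub := faceSpace_subset_space hface
  rw [h u hu w hw]
  exact units_mul_eq_mul_swap (hε'.mul_eq_mul (hv.mono hsub) (convex_faceSpace _).isPreconnected
    (hε.mono hsub) (single_mem_faceSpace hu) (single_mem_faceSpace hw))

end Holonomy

noncomputable section CocycleField

/-- A vertex of the smallest face that contains `x`. -/
def baseVertex {V : Type*} [Nonempty V] (x : V → ℝ) : V := Classical.epsilon fun i => x i ≠ 0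

/-- The line field with holonomy `b`: on the faces around the vertex `k`, it is represented by the
vector field `x ↦ (b k i * x i)ᵢ`, and `baseVertex x` selects one of these representations. -/
def cocycleField {V : Type*} [Nonempty V] (b : V → V → ℤˣ) (x : V → ℝ) (i : V) : ℝ :=
  b (baseVertex x) i • x i

theorem baseVertex_single {V : Type*} [DecidableEq V] [Nonempty V] (u : V) :
    baseVertex (Pi.single u 1 : V → ℝ) = u :=
  not_imp_comm.1 (fun h => Pi.single_eq_of_ne h _)
    (Classical.epsilon_spec (p := fun i => (Pi.single u 1 : V → ℝ) i ≠ 0) ⟨u, by simp⟩)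

variable {V : Type*} [Fintype V] [Nonempty V] {Δ : AbstractSimplicialComplex V} {b : V → V → ℤˣ}
  {s : Finset V} {x : V → ℝ}

theorem baseVertex_ne_zero (hx : x ∈ stdSimplex ℝ V) : x (baseVertex x) ≠ 0 :=
  Classical.epsilon_spec (exists_ne_zero_of_mem_stdSimplex hx)

theorem baseVertex_mem (hx : x ∈ faceSpace s) : baseVertex x ∈ s :=
  hx.2 _ (baseVertex_ne_zero hx.1)

variable [DecidableEq V]

theorem IsCocycle.isSection_cocycleField (hb : IsCocycle Δ b) (hs : s ∈ Δ.faces) {k : V}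
    (hk : k ∈ s) : IsSection (faceSpace s) (cocycleField b) fun x => b k (baseVertex x) := by
  have hcont : Continuous fun (x : V → ℝ) (i : V) => b k i • x i :=
    continuous_pi fun i => (continuous_apply i).const_smul _
  refine hcont.continuousOn.congr fun x hx => funext fun i => ?_
  by_cases hi : x i = 0
  · simp only [Pi.smul_apply, cocycleField, hi, smul_zero]
  · simp only [Pi.smul_apply, cocycleField, smul_smul,
      hb.mul_eq hs hk (baseVertex_mem hx) (hx.2 i hi)]

theorem IsCocycle.isLineField_cocycleField (hb : IsCocycle Δ b) :
    IsLineField Δ.space (cocycleField b) := by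
  refine ⟨fun x hx h => ?_, continuousOn_space fun s hs => ?_⟩
  · exact (smul_ne_zero_iff_ne _).2 (baseVertex_ne_zero hx.1) (congrFun h (baseVertex x))
  · obtain ⟨k, hk⟩ := (Δ.isRelLowerSet_faces hs).1
    exact (hb.isSection_cocycleField hs hk).continuousOn_tensorField_self

theorem IsCocycle.isHolonomy_cocycleField (hb : IsCocycle Δ b) :
    IsHolonomy Δ (cocycleField b) b := by
  intro s hs
  obtain ⟨k, hk⟩ := (Δ.isRelLowerSet_faces hs).1
  refine ⟨_, hb.isSection_cocycleField hs hk, fun u hu w hw => ?_⟩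
  rw [baseVertex_single, baseVertex_single, ← hb.symm hs hk hu, hb.mul_eq hs hu hk hw]

end CocycleField

theorem exists_cohomology_injection {V W : Type*} [Fintype V] [DecidableEq V] [Fintype W]
    [DecidableEq W] [Nonempty W] {Δ : AbstractSimplicialComplex V} {Γ : AbstractSimplicialComplex W}
    (h : Δ.space ≃ₜ Γ.space) :
    ∃ Φ : (W → W → ℤˣ) → V → V → ℤˣ, (∀ b, IsCocycle Γ b → IsCocycle Δ (Φ b)) ∧
      ∀ b b', IsCocycle Γ b → IsCocycle Γ b' → IsCoboundary Δ (Φ b * Φ b') →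
        IsCoboundary Γ (b * b') := by
  obtain ⟨f, g, hfc, hgc, hf, hg, -, hfg⟩ := exists_leftInvOn_of_homeomorph h
  have hpull (b) (hb : IsCocycle Γ b) : IsLineField Δ.space (cocycleField b ∘ f) :=
    hb.isLineField_cocycleField.comp hfc hf
  choose! Φ hΦ using fun b hb => exists_isHolonomy (hpull b hb)
  refine ⟨Φ, fun b hb => (hΦ b hb).isCocycle, fun b b' hb hb' hΔ => ?_⟩
  obtain ⟨ε, hε⟩ := ((hΦ b hb).tensorField (hΦ b' hb')).exists_isSection
    ((hpull b hb).tensorField (hpull b' hb')) hΔ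
  refine (hb.isHolonomy_cocycleField.tensorField hb'.isHolonomy_cocycleField).isCoboundary
    (hb.isLineField_cocycleField.tensorField hb'.isLineField_cocycleField) (ε := ε ∘ g) ?_
  refine (hε.comp hgc hg).congr fun y hy => ?_
  simp only [comp_apply, tensorField, hfg hy, funext_iff, implies_true]

/-! ### Connectivity and the cocycles of the ten-vertex complex -/

namespace NonorientableSurface

variable {h : ℕ}

theorem norm_eq_one_of_crossCapGluing {z w : UnitDisc} (hzw : crossCapGluing h z w) :
    ‖(z : ℂ)‖ = 1 ∧ ‖(w : ℂ)‖ = 1 := by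
  obtain ⟨j, t, -, hz, hw⟩ := hzw
  have key (a : ℝ) : ‖Complex.exp (2 * Real.pi * Complex.I * a)‖ = 1 := by
    rw [mul_right_comm]
    exact_mod_cast Complex.norm_exp_ofReal_mul_I (2 * Real.pi * a)
  rw [hz, hw]
  exact ⟨mod_cast key ((2 * (j : ℕ) + t) / (2 * h)), mod_cast key ((2 * (j : ℕ) + 1 + t) / (2 * h))⟩

theorem eq_of_mk_eq {z w : UnitDisc} (hz : ‖(z : ℂ)‖ < 1) (hw : ‖(w : ℂ)‖ < 1)
    (hzw : Quot.mk (crossCapGluing h) z = Quot.mk (crossCapGluing h) w) : z = w := by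
  classical
  let φ : NonorientableSurface h → ℂ :=
    Quot.lift (fun z => if ‖(z : ℂ)‖ < 1 then (z : ℂ) else 1) fun z w hzw => by
      simp [norm_eq_one_of_crossCapGluing hzw]
  have key := congrArg φ hzw
  simp only [φ, hz, hw, if_true] at key
  exact Subtype.ext key

/-- The embedding of the plane, viewed as the open unit disc, onto the interior of the polygon. -/
noncomputable def openCell (h : ℕ) (x : ℂ) : NonorientableSurface h :=
  Quot.mk _ ⟨Homeomorph.unitBall x, Metric.ball_subset_closedBall (Homeomorph.unitBall x).2⟩

theorem continuous_openCell : Continuous (openCell h) :=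
  continuous_quot_mk.comp
    ((continuous_subtype_val.comp Homeomorph.unitBall.continuous).subtype_mk _)

theorem openCell_injective : Injective (openCell h) := fun x y hxy =>
  Homeomorph.unitBall.injective (Subtype.ext (Subtype.mk.inj (eq_of_mk_eq
    (mem_ball_zero_iff.1 (Homeomorph.unitBall x).2)
    (mem_ball_zero_iff.1 (Homeomorph.unitBall y).2) hxy)))

theorem denseRange_openCell : DenseRange (openCell h) := by
  refine Quot.mk_surjective.denseRange.comp (Subtype.dense_iff.2 ?_) continuous_quot_mk
  refine (closure_ball _ one_ne_zero).superset.trans (closure_mono fun w hw => ?_)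
  obtain ⟨x, hx⟩ := Homeomorph.unitBall.surjective (⟨w, hw⟩ : Metric.ball (0 : ℂ) 1)
  exact ⟨_, ⟨x, rfl⟩, congrArg Subtype.val hx⟩

theorem isPreconnected_compl_of_finite [T1Space (NonorientableSurface h)]
    {F : Set (NonorientableSurface h)} (hF : F.Finite) : IsPreconnected Fᶜ := by
  have hrank : 1 < Module.rank ℝ ℂ := by rw [Complex.rank_real_complex]; exact Nat.one_lt_ofNat
  have hplane : IsPreconnected (openCell h ⁻¹' F)ᶜ :=
    ((hF.preimage openCell_injective.injOn).countable.isConnected_compl_of_one_lt_rank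
      hrank).isPreconnected
  rw [← Set.preimage_compl] at hplane
  have himage := hplane.image (openCell h) continuous_openCell.continuousOn
  rw [Set.image_preimage_eq_inter_range] at himage
  exact himage.subset_closure Set.inter_subset_left
    (denseRange_openCell.open_subset_closure_inter hF.isClosed.isOpen_compl)

end NonorientableSurface

section Connectivity

variable {V : Type*} [Fintype V] {Δ : AbstractSimplicialComplex V} {s t : Finset V} {x : V → ℝ}

theorem isPreconnected_space_diff_of_finite {h : ℕ} (f : Δ.space ≃ₜ NonorientableSurface h)
    {F : Set (V → ℝ)} (hF : F.Finite) : IsPreconnected (Δ.space \ F) := by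
  have : T1Space (NonorientableSurface h) := f.symm.isEmbedding.t1Space
  have hfin : (f.symm ⁻¹' (Subtype.val ⁻¹' F)).Finite :=
    (hF.preimage Subtype.val_injective.injOn).preimage f.symm.injective.injOn
  have himage := ((NonorientableSurface.isPreconnected_compl_of_finite hfin).image _
    f.symm.continuous.continuousOn).image _ continuous_subtype_val.continuousOn
  rwa [← Set.preimage_compl, Set.image_preimage_eq _ f.symm.surjective, ← Set.preimage_compl,
    Subtype.image_preimage_coe] at himage

theorem of_isPreconnected_of_subset_iUnion_faceSpace {X : Set (V → ℝ)} (hX : IsPreconnected X)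
    {𝒮 : Set (Finset V)} (hcover : X ⊆ ⋃ r ∈ 𝒮, faceSpace r) {P : Finset V → Prop}
    (hP : ∀ r ∈ 𝒮, ∀ r' ∈ 𝒮, (X ∩ (faceSpace r ∩ faceSpace r')).Nonempty → P r → P r')
    (hs : s ∈ 𝒮) (ht : t ∈ 𝒮) (hsX : (X ∩ faceSpace s).Nonempty) (htX : (X ∩ faceSpace t).Nonempty)
    (hPs : P s) : P t := by
  by_contra hPt
  have hclosed (Q : Finset V → Prop) : IsClosed (⋃ r ∈ {r ∈ 𝒮 | Q r}, faceSpace r) :=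
    (Set.toFinite _).isClosed_biUnion fun r _ => isClosed_faceSpace r
  have hmem {Q : Finset V → Prop} {r : Finset V} (hr : r ∈ 𝒮) (hQ : Q r) :
      faceSpace r ⊆ ⋃ r ∈ {r ∈ 𝒮 | Q r}, faceSpace r :=
    Set.subset_biUnion_of_mem (u := faceSpace) ⟨hr, hQ⟩
  have hcover' : X ⊆ (⋃ r ∈ {r ∈ 𝒮 | P r}, faceSpace r) ∪ ⋃ r ∈ {r ∈ 𝒮 | ¬ P r}, faceSpace r := by
    intro x hx
    obtain ⟨r, hr, hxr⟩ := Set.mem_iUnion₂.1 (hcover hx)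
    exact (em (P r)).imp (fun hPr => hmem hr hPr hxr) fun hPr => hmem (Q := (¬ P ·)) hr hPr hxr
  obtain ⟨x, hx, hxP, hxP'⟩ := isPreconnected_closed_iff.1 hX _ _ (hclosed P)
    (hclosed fun r => ¬ P r) hcover'
    (hsX.mono (Set.inter_subset_inter_right _ (hmem hs hPs)))
    (htX.mono (Set.inter_subset_inter_right _ (hmem (Q := (¬ P ·)) ht hPt)))
  obtain ⟨r, ⟨hr, hPr⟩, hxr⟩ := Set.mem_iUnion₂.1 hxP
  obtain ⟨r', ⟨hr', hPr'⟩, hxr'⟩ := Set.mem_iUnion₂.1 hxP'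
  exact hPr' (hP r hr r' hr' ⟨x, hx, hxr, hxr'⟩ hPr)

variable [DecidableEq V]

theorem eq_of_forall_edge_eq (hΔ : IsPreconnected Δ.space) {α : Type*} {g : V → α}
    (hg : ∀ u v, {u, v} ∈ Δ.faces → g u = g v) (u v : V) : g u = g v := by
  have hvertex (w : V) : (Δ.space ∩ faceSpace {w}).Nonempty :=
    have hw := single_mem_faceSpace (mem_singleton_self w)
    ⟨_, faceSpace_subset_space (Δ.singleton_mem w) hw, hw⟩
  refine of_isPreconnected_of_subset_iUnion_faceSpace (P := fun s => ∀ w ∈ s, g u = g w) hΔ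
    (fun x hx => ?_) ?_ (Δ.singleton_mem u) (Δ.singleton_mem v) (hvertex u) (hvertex v)
    (fun w hw => congrArg g (mem_singleton.1 hw).symm) v (mem_singleton_self v)
  · obtain ⟨hx, s, hs, hsupp⟩ := hx
    exact Set.mem_biUnion hs ⟨hx, hsupp⟩
  · rintro r - r' hr' ⟨x, -, hxr, hxr'⟩ hgr w hw
    obtain ⟨i, hi⟩ := exists_ne_zero_of_mem_stdSimplex hxr.1
    exact (hgr i (hxr.2 i hi)).trans (hg i w ((Δ.isRelLowerSet_faces hr').2
      (insert_subset (hxr'.2 i hi) (singleton_subset_iff.2 hw)) (insert_nonempty _ _)))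

theorem exists_triangle_mem_faceSpace (hΔ : ∀ s ∈ Δ.faces, s.card ≤ 3) (hc : IsClosedAtEdges Δ)
    (hx : x ∈ Δ.space) (hvertex : ∀ a, x ≠ Pi.single a 1) :
    ∃ r ∈ Δ.faces, r.card = 3 ∧ x ∈ faceSpace r := by
  obtain ⟨a, rfl⟩ | ⟨a, b, hab, hface, ha, hb⟩ := exists_eq_single_or_exists_mem_openStar hx
  · exact absurd rfl (hvertex a)
  obtain ⟨m, hm, hzero⟩ : ∃ m ∈ edgeLink Δ a b, ∀ i, i ≠ a → i ≠ b → i ≠ m → x i = 0 := by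
    rcases eq_zero_or_exists_mem_edgeLink hΔ hab hx ha hb with h | h
    · obtain ⟨m, hm⟩ := Set.nonempty_of_ncard_ne_zero ((hc a b hab hface).trans_ne two_ne_zero)
      exact ⟨m, hm, fun i hia hib _ => h i hia hib⟩
    · exact h
  refine ⟨{a, b, m}, hm.2.2, card_eq_three.2 ⟨a, b, m, hab, hm.1.symm, hm.2.1.symm, rfl⟩, hx.1,
    fun i hi => ?_⟩
  simp only [mem_insert, mem_singleton]
  by_contra! hne
  exact hi (hzero i hne.1 hne.2.1 hne.2.2)

theorem exists_mem_faceSpace_forall_ne_single (hs : 1 < s.card) :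
    ∃ x ∈ faceSpace s, ∀ a, x ≠ Pi.single a 1 := by
  obtain ⟨u, hu, v, hv, huv⟩ := one_lt_card.1 hs
  refine ⟨midpoint ℝ (Pi.single u 1) (Pi.single v 1),
    (convex_faceSpace s).midpoint_mem (single_mem_faceSpace hu) (single_mem_faceSpace hv),
    fun a ha => ?_⟩
  have hau := congrFun ha u
  have hav := congrFun ha v
  simp only [midpoint_eq_smul_add, Pi.smul_apply, Pi.add_apply, Pi.single_apply, huv, huv.symm,
    if_true, if_false, invOf_eq_inv, smul_eq_mul] at hau hav
  split_ifs at hau hav with h <;> norm_num at hau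

theorem eq_of_forall_adjacent_triangle_eq (hΔ : ∀ s ∈ Δ.faces, s.card ≤ 3) (hc : IsClosedAtEdges Δ)
    (hcon : IsPreconnected (Δ.space \ Set.range fun u : V => (Pi.single u 1 : V → ℝ)))
    {α : Type*} {g : Finset V → α}
    (hg : ∀ r ∈ Δ.faces, ∀ r' ∈ Δ.faces, r.card = 3 → r'.card = 3 → 1 < (r ∩ r').card → g r = g r')
    (hs : s ∈ Δ.faces) (ht : t ∈ Δ.faces) (hs3 : s.card = 3) (ht3 : t.card = 3) : g s = g t := by
  have hne {r} (hr : r ∈ Δ.faces) (hr3 : r.card = 3) :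
      ((Δ.space \ Set.range fun u : V => (Pi.single u 1 : V → ℝ)) ∩ faceSpace r).Nonempty := by
    obtain ⟨x, hx, hxv⟩ := exists_mem_faceSpace_forall_ne_single (s := r) (by lia)
    exact ⟨x, ⟨faceSpace_subset_space hr hx, fun ⟨a, ha⟩ => hxv a ha.symm⟩, hx⟩
  refine of_isPreconnected_of_subset_iUnion_faceSpace (𝒮 := {r ∈ Δ.faces | r.card = 3})
    (P := fun r => g s = g r) hcon ?_ ?_ ⟨hs, hs3⟩ ⟨ht, ht3⟩ (hne hs hs3) (hne ht ht3) rfl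
  · rintro x ⟨hx, hxv⟩
    obtain ⟨r, hr, hr3, hxr⟩ :=
      exists_triangle_mem_faceSpace hΔ hc hx fun a ha => hxv ⟨a, ha.symm⟩
    exact Set.mem_biUnion ⟨hr, hr3⟩ hxr
  · rintro r ⟨hr, hr3⟩ r' ⟨hr', hr3'⟩ ⟨x, ⟨hx, hxv⟩, hxr, hxr'⟩ hsr
    obtain ⟨a, rfl⟩ | ⟨a, b, hab, -, ha, hb⟩ := exists_eq_single_or_exists_mem_openStar hx
    · exact absurd ⟨a, rfl⟩ hxv
    · exact hsr.trans (hg r hr r' hr' hr3 hr3' (one_lt_card.2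
        ⟨a, mem_inter.2 ⟨hxr.2 a ha.ne', hxr'.2 a ha.ne'⟩,
          b, mem_inter.2 ⟨hxr.2 b hb.ne', hxr'.2 b hb.ne'⟩, hab⟩))

end Connectivity

theorem isClosedAtEdges_tenVertexComplex : IsClosedAtEdges tenVertexComplex := by
  have hcard : ∀ u v : Fin 10, u ≠ v → (∃ t ∈ triangles, (u : ℕ) ∈ t ∧ (v : ℕ) ∈ t) →
      #{z : Fin 10 | z ≠ u ∧ z ≠ v ∧
        ∃ t ∈ triangles, (u : ℕ) ∈ t ∧ (v : ℕ) ∈ t ∧ (z : ℕ) ∈ t} = 2 := by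
    decide +kernel
  rintro u v huv ⟨-, t, ht, h⟩
  rw [← hcard u v huv ⟨t, ht, h u (by simp), h v (by simp)⟩, ← Set.ncard_coe_finset]
  congr 1
  ext z
  simp [edgeLink, tenVertexComplex]

/-- The edges that are crossed by six closed curves, chosen so that the `j`-th curve has an odd
number of crossings with the cycle `0`, `1`, `cycleVertex i` exactly if `i = j`. -/
def crossedEdges : Fin 6 → List (ℕ × ℕ) :=
  ![[(1, 2), (2, 4), (2, 9), (3, 6), (4, 5), (4, 7), (5, 6), (6, 9)],
    [(0, 3), (2, 7), (3, 5), (3, 8), (4, 5), (4, 7), (5, 6), (7, 8)],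
    [(0, 4), (3, 6), (3, 9), (4, 6), (4, 8), (4, 9), (5, 6)],
    [(1, 5), (2, 7), (2, 8), (4, 7), (5, 7), (5, 8), (5, 9)],
    [(1, 8), (2, 7), (2, 8), (4, 5), (4, 6), (4, 7), (5, 8), (6, 8)],
    [(1, 9), (2, 9), (3, 6), (4, 5), (5, 6), (5, 7), (5, 9), (6, 9)]]

/-- The vertices that form cycles with `0` and `1`; these cycles are a basis of the first homology
of the ten-vertex complex modulo `2`. -/
def cycleVertex : Fin 6 → Fin 10 := ![2, 3, 4, 5, 8, 9]

/-- The cocycle that is `-1` on the edges crossed by the `j`-th curve. -/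
def crossing (j : Fin 6) (u v : Fin 10) : ℤˣ :=
  if (min (u : ℕ) v, max (u : ℕ) v) ∈ crossedEdges j then -1 else 1

/-- The product of the cocycles `crossing j` over the `j` selected by `J`. -/
def crossingProd (J : Fin 6 → Bool) (u v : Fin 10) : ℤˣ :=
  ∏ j, if J j then crossing j u v else 1

theorem isCocycle_crossing (j : Fin 6) : IsCocycle tenVertexComplex (crossing j) := by
  have hcocycle : ∀ j, ∀ t ∈ triangles, ∀ u : Fin 10, (u : ℕ) ∈ t → ∀ v : Fin 10, (v : ℕ) ∈ t →
      ∀ w : Fin 10, (w : ℕ) ∈ t → crossing j u v * crossing j v w = crossing j u w := by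
    decide +kernel
  rintro u v w ⟨-, t, ht, h⟩
  exact hcocycle j t ht u (h u (by simp)) v (h v (by simp)) w (h w (by simp))

theorem isCocycle_crossingProd (J : Fin 6 → Bool) :
    IsCocycle tenVertexComplex (crossingProd J) := by
  intro u v w h
  simp only [crossingProd]
  rw [← prod_mul_distrib]
  refine prod_congr rfl fun j _ => ?_
  split_ifs
  · exact isCocycle_crossing j u v w h
  · exact one_mul 1

theorem crossing_cycle : ∀ i j : Fin 6, crossing j 0 1 * crossing j 1 (cycleVertex i) *
    crossing j 0 (cycleVertex i) = if j = i then -1 else 1 := by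
  decide +kernel

theorem crossingProd_cycle (J : Fin 6 → Bool) (i : Fin 6) :
    crossingProd J 0 1 * crossingProd J 1 (cycleVertex i) * crossingProd J 0 (cycleVertex i) =
      if J i then -1 else 1 := by
  simp only [crossingProd]
  rw [← prod_mul_distrib, ← prod_mul_distrib, prod_eq_single i]
  · split_ifs
    · rw [crossing_cycle, if_pos rfl]
    · rfl
  · intro j _ hj
    split_ifs
    · rw [crossing_cycle, if_neg hj]
    · rfl
  · exact fun hi => absurd (mem_univ i) hi

theorem eq_of_isCoboundary_crossingProd_mul {J J' : Fin 6 → Bool}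
    (h : IsCoboundary tenVertexComplex (crossingProd J * crossingProd J')) : J = J' := by
  obtain ⟨g, hg⟩ := h
  have hedge : ∀ i, (∃ t ∈ triangles, 0 ∈ t ∧ 1 ∈ t) ∧
      (∃ t ∈ triangles, 1 ∈ t ∧ (cycleVertex i : ℕ) ∈ t) ∧
      ∃ t ∈ triangles, 0 ∈ t ∧ (cycleVertex i : ℕ) ∈ t := by decide +kernel
  funext i
  obtain ⟨h01, h1, h0⟩ := hedge i
  have e01 := hg 0 1 ⟨by simp, by simpa using h01⟩
  have e1 := hg 1 (cycleVertex i) ⟨by simp, by simpa using h1⟩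
  have e0 := hg 0 (cycleVertex i) ⟨by simp, by simpa using h0⟩
  have hprod : (if J i then (-1 : ℤˣ) else 1) * (if J' i then -1 else 1) = 1 := by
    rw [← crossingProd_cycle J, ← crossingProd_cycle J']
    calc
      _ = (crossingProd J * crossingProd J') 0 1 *
          (crossingProd J * crossingProd J') 1 (cycleVertex i) *
          (crossingProd J * crossingProd J') 0 (cycleVertex i) := by
        simp only [Pi.mul_apply]
        ac_rfl
      _ = (g 0 * g 0) * (g 1 * g 1) * (g (cycleVertex i) * g (cycleVertex i)) := by
        rw [e01, e1, e0]
        ac_rfl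
      _ = 1 := by simp only [Int.units_mul_self, one_mul]
  cases hJ : J i <;> cases hJ' : J' i <;> simp [hJ, hJ'] at hprod ⊢

/-! ### The Heawood inequality -/

section LinearAlgebra

open scoped Matrix

variable {K m n o ι : Type*} [Field K] [Fintype n]

theorem card_le_rank_add_one (M : Matrix m n K)
    (h : ∀ x, M *ᵥ x = 0 → ∀ i j, x i = x j) : Fintype.card n ≤ M.rank + 1 := by
  have hker : LinearMap.ker M.mulVecLin ≤ K ∙ (1 : n → K) := fun x hx => by
    rcases isEmpty_or_nonempty n with hn | ⟨⟨i⟩⟩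
    · exact Subsingleton.elim x 0 ▸ zero_mem _
    · exact Submodule.mem_span_singleton.2
        ⟨x i, funext fun j => (mul_one _).trans (h x hx i j)⟩
  have hle : Module.finrank K (LinearMap.ker M.mulVecLin) ≤ 1 :=
    (Submodule.finrank_mono hker).trans (by simpa using finrank_span_le_card ({1} : Set (n → K)))
  rw [← Module.finrank_fintype_fun_eq_card K, ← M.mulVecLin.finrank_range_add_finrank_ker]
  exact Nat.add_le_add_left hle _

theorem card_mul_card_pow_rank_le [Finite K] [Fintype m] {M : Matrix n m K} {N : Matrix o n K}
    (hNM : N * M = 0) {x : ι → n → K} (hx : ∀ i, N *ᵥ x i = 0)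
    (hinj : ∀ i j y, x i - x j = M *ᵥ y → i = j) :
    Nat.card ι * Nat.card K ^ M.rank * Nat.card K ^ N.rank ≤ Nat.card K ^ Fintype.card n := by
  let φ : ι × LinearMap.range M.mulVecLin → LinearMap.ker N.mulVecLin := fun p =>
    ⟨x p.1 + p.2, by
      obtain ⟨y, hy⟩ := p.2.2
      rw [LinearMap.mem_ker, map_add, ← hy, N.mulVecLin_apply, hx, N.mulVecLin_apply,
        M.mulVecLin_apply, Matrix.mulVec_mulVec, hNM, Matrix.zero_mulVec, add_zero]⟩
  have hφ : Injective φ := by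
    rintro ⟨i, z⟩ ⟨j, z'⟩ h
    have hval : x i + z = x j + z' := congrArg Subtype.val h
    obtain ⟨y, hy⟩ := (z' - z).2
    obtain rfl : i = j :=
      hinj i j y ((sub_eq_sub_iff_add_eq_add.2 (hval.trans (add_comm _ _))).trans hy.symm)
    rw [Subtype.ext (add_left_cancel hval)]
  have hcard := Nat.card_le_card_of_injective φ hφ
  rw [Nat.card_prod, Module.natCard_eq_pow_finrank (K := K) (V := LinearMap.range M.mulVecLin),
    Module.natCard_eq_pow_finrank (K := K) (V := LinearMap.ker N.mulVecLin)] at hcard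
  rw [← Module.finrank_fintype_fun_eq_card K, ← N.mulVecLin.finrank_range_add_finrank_ker, add_comm,
    pow_add]
  exact Nat.mul_le_mul_right _ hcard

end LinearAlgebra

theorem sum_powersetCard_two_triple {α M : Type*} [DecidableEq α] [AddCommMonoid M]
    (φ : Finset α → M) {u v w : α} (huv : u ≠ v) (huw : u ≠ w) (hvw : v ≠ w) :
    ∑ e ∈ ({u, v, w} : Finset α).powersetCard 2, φ e = φ {u, v} + φ {u, w} + φ {v, w} := by
  have huv_notMem : {u, v} ∉ ({{u, w}, {v, w}} : Finset (Finset α)) := by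
    simp only [mem_insert, mem_singleton, not_or]
    exact ⟨ne_of_mem_of_not_mem' (a := v) (by simp) (by simp [huv.symm, hvw]),
      ne_of_mem_of_not_mem' (a := u) (by simp) (by simp [huv, huw])⟩
  have huw_ne : ({u, w} : Finset α) ≠ {v, w} :=
    ne_of_mem_of_not_mem' (a := u) (by simp) (by simp [huv, huw])
  have hpairs : {{u, v}, {u, w}, {v, w}} = ({u, v, w} : Finset α).powersetCard 2 := by
    refine eq_of_subset_of_card_le ?_ ?_
    · simp [insert_subset_iff, mem_powersetCard, huv, huw, hvw]
    · rw [card_powersetCard, card_eq_three.2 ⟨u, v, w, huv, huw, hvw, rfl⟩,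
        card_insert_of_notMem huv_notMem, card_pair huw_ne]
      exact le_rfl
  rw [← hpairs, sum_insert huv_notMem, sum_pair huw_ne, add_assoc]

section Incidence

variable {V : Type*} [Fintype V] (Δ : AbstractSimplicialComplex V)

/-- The edges of a complex. -/
abbrev EdgeOf : Type _ := {e : Finset V // e ∈ Δ.faces ∧ e.card = 2}

/-- The triangles of a complex. -/
abbrev TriangleOf : Type _ := {t : Finset V // t ∈ Δ.faces ∧ t.card = 3}

noncomputable instance : Fintype (EdgeOf Δ) := Fintype.ofFinite _

noncomputable instance : Fintype (TriangleOf Δ) := Fintype.ofFinite _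

theorem card_edgeOf_le : Fintype.card (EdgeOf Δ) ≤ (Fintype.card V).choose 2 := by
  rw [← Fintype.card_finset_len]
  exact Fintype.card_le_of_injective (fun e : EdgeOf Δ => ⟨e.1, e.2.2⟩) fun e e' h =>
    Subtype.ext (Subtype.mk.inj h)

variable [DecidableEq V]

/-- The matrix modulo two of the coboundary of functions on the vertices. -/
def vertexMatrix : Matrix (EdgeOf Δ) V (ZMod 2) :=
  fun e v => if v ∈ e.1 then 1 else 0

/-- The matrix modulo two of the coboundary of functions on the edges. -/
def edgeMatrix : Matrix (TriangleOf Δ) (EdgeOf Δ) (ZMod 2) :=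
  fun t e => if e.1 ⊆ t.1 then 1 else 0

open scoped Matrix

variable {Δ}

theorem map_filter_edgeOf_subset (t : TriangleOf Δ) :
    ({e : EdgeOf Δ | e.1 ⊆ t.1} : Finset _).map (Embedding.subtype _) = t.1.powersetCard 2 := by
  ext s
  simp only [mem_map, mem_filter, mem_univ, true_and, Embedding.subtype_apply, mem_powersetCard]
  constructor
  · rintro ⟨e, he, rfl⟩
    exact ⟨he, e.2.2⟩
  · rintro ⟨hs, hs2⟩
    exact ⟨⟨s, (Δ.isRelLowerSet_faces t.2.1).2 hs (card_pos.1 (by lia)), hs2⟩, hs, rfl⟩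

theorem vertexMatrix_mulVec_apply (g : V → ZMod 2) (e : EdgeOf Δ) :
    (vertexMatrix Δ *ᵥ g) e = ∑ v ∈ e.1, g v := by
  simp [Matrix.mulVec, dotProduct, vertexMatrix]

theorem edgeMatrix_mulVec_apply (φ : Finset V → ZMod 2) (t : TriangleOf Δ) :
    (edgeMatrix Δ *ᵥ fun e => φ e.1) t = ∑ e ∈ t.1.powersetCard 2, φ e := by
  simp only [Matrix.mulVec, dotProduct, edgeMatrix, ite_mul, one_mul, zero_mul]
  rw [← sum_filter, ← map_filter_edgeOf_subset, sum_map]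
  rfl

theorem edgeMatrix_mul_vertexMatrix : edgeMatrix Δ * vertexMatrix Δ = 0 := by
  refine Matrix.ext_of_mulVec_single fun v => funext fun t => ?_
  obtain ⟨a, b, c, hab, hac, hbc, ht⟩ := card_eq_three.1 t.2.2
  generalize (Pi.single v 1 : V → ZMod 2) = g
  rw [← Matrix.mulVec_mulVec, funext (vertexMatrix_mulVec_apply g),
    edgeMatrix_mulVec_apply fun e => ∑ i ∈ e, g i, ht, sum_powersetCard_two_triple _ hab hac hbc,
    sum_pair hab, sum_pair hac, sum_pair hbc, Matrix.zero_mulVec, Pi.zero_apply]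
  linear_combination (g a + g b + g c) * CharTwo.two_eq_zero (R := ZMod 2)

end Incidence

section SignExponent

/-- The isomorphism of the signs with the additive group of integers modulo two. -/
def signExponent (x : ℤˣ) : ZMod 2 := if x = 1 then 0 else 1

theorem signExponent_mul :
    ∀ x y : ℤˣ, signExponent (x * y) = signExponent x + signExponent y := by
  decide

theorem signExponent_bijective : Bijective signExponent := by
  decide

variable {V : Type*} {Δ : AbstractSimplicialComplex V} {b b' : V → V → ℤˣ}

/-- The function on edges that corresponds to a symmetric function `b` of two vertices. -/
noncomputable def edgeExponent (b : V → V → ℤˣ) (e : Finset V) : ZMod 2 :=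
  open Classical in if ∃ u ∈ e, ∃ v ∈ e, b u v = -1 then 1 else 0

variable [DecidableEq V]

theorem IsCocycle.edgeExponent_pair (hb : IsCocycle Δ b) {s : Finset V} {u v : V} (hs : s ∈ Δ.faces)
    (hu : u ∈ s) (hv : v ∈ s) : edgeExponent b {u, v} = signExponent (b u v) := by
  simp only [edgeExponent, signExponent, mem_insert, mem_singleton, exists_eq_or_imp,
    exists_eq_left, hb.self hs hu, hb.self hs hv, hb.symm hs hu hv]
  rcases Int.units_eq_one_or (b u v) with h | h <;> simp [h]

variable [Fintype V]

open scoped Matrix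

theorem IsCocycle.edgeMatrix_mulVec_edgeExponent (hb : IsCocycle Δ b) :
    (edgeMatrix Δ *ᵥ fun e => edgeExponent b e.1) = 0 := by
  funext t
  obtain ⟨u, v, w, huv, huw, hvw, ht⟩ := card_eq_three.1 t.2.2
  have hu : u ∈ t.1 := by simp [ht]
  have hv : v ∈ t.1 := by simp [ht]
  have hw : w ∈ t.1 := by simp [ht]
  rw [edgeMatrix_mulVec_apply, ht, sum_powersetCard_two_triple _ huv huw hvw,
    hb.edgeExponent_pair t.2.1 hu hv, hb.edgeExponent_pair t.2.1 hu hw,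
    hb.edgeExponent_pair t.2.1 hv hw, ← hb.mul_eq t.2.1 hu hv hw, signExponent_mul, Pi.zero_apply]
  linear_combination
    (signExponent (b u v) + signExponent (b v w)) * CharTwo.two_eq_zero (R := ZMod 2)

theorem IsCocycle.isCoboundary_mul_of_edgeExponent_sub (hb : IsCocycle Δ b) (hb' : IsCocycle Δ b')
    {g : V → ZMod 2} (h : (fun e : EdgeOf Δ => edgeExponent b e.1) -
      (fun e => edgeExponent b' e.1) = vertexMatrix Δ *ᵥ g) : IsCoboundary Δ (b * b') := by
  choose g' hg' using fun v => signExponent_bijective.2 (g v)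
  refine ⟨g', fun u v he => signExponent_bijective.1 ?_⟩
  have hu : u ∈ ({u, v} : Finset V) := by simp
  have hv : v ∈ ({u, v} : Finset V) := by simp
  obtain rfl | huv := eq_or_ne u v
  · rw [Pi.mul_apply, Pi.mul_apply, hb.self he hu, hb'.self he hu, one_mul, Int.units_mul_self]
  · have hedge := congrFun h ⟨{u, v}, he, card_pair huv⟩
    rw [vertexMatrix_mulVec_apply, sum_pair huv, Pi.sub_apply, CharTwo.sub_eq_add,
      hb.edgeExponent_pair he hu hv, hb'.edgeExponent_pair he hu hv] at hedge
    rw [Pi.mul_apply, Pi.mul_apply, signExponent_mul, signExponent_mul, hedge, hg', hg']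

theorem add_rank_vertexMatrix_add_rank_edgeMatrix_le {k : ℕ} {b : (Fin k → Bool) → V → V → ℤˣ}
    (hb : ∀ J, IsCocycle Δ (b J)) (hinj : ∀ J J', IsCoboundary Δ (b J * b J') → J = J') :
    k + (vertexMatrix Δ).rank + (edgeMatrix Δ).rank ≤ Fintype.card (EdgeOf Δ) := by
  have hcard := card_mul_card_pow_rank_le edgeMatrix_mul_vertexMatrix
    (fun J => (hb J).edgeMatrix_mulVec_edgeExponent) fun J J' g h =>
      hinj J J' ((hb J).isCoboundary_mul_of_edgeExponent_sub (hb J') h)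
  rw [Nat.card_eq_fintype_card (α := Fin k → Bool), Fintype.card_fun, Fintype.card_bool,
    Fintype.card_fin, Nat.card_zmod, ← pow_add, ← pow_add] at hcard
  exact (Nat.pow_le_pow_iff_right one_lt_two).1 hcard

end SignExponent

section VertexBound

theorem image_edgeLink {V : Type*} [DecidableEq V] {Δ : AbstractSimplicialComplex V} {u v : V}
    (huv : u ≠ v) : (fun w => {w, u, v}) '' edgeLink Δ u v =
      {t : Finset V | t ∈ Δ.faces ∧ t.card = 3 ∧ {u, v} ⊆ t} := by
  have hrotate (w : V) : ({u, v, w} : Finset V) = {w, u, v} := by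
    rw [pair_comm v w, insert_comm]
  ext t
  constructor
  · rintro ⟨w, ⟨hwu, hwv, hw⟩, rfl⟩
    exact ⟨(hrotate w).subst hw, card_eq_three.2 ⟨w, u, v, hwu, hwv, huv, rfl⟩, subset_insert _ _⟩
  · rintro ⟨ht, ht3, hsub⟩
    obtain ⟨w, hw, rfl⟩ := exists_eq_insert_iff.2 ⟨hsub, by rw [card_pair huv, ht3]⟩
    simp only [mem_insert, mem_singleton, not_or] at hw
    exact ⟨w, ⟨hw.1, hw.2, (hrotate w).symm ▸ ht⟩, rfl⟩

theorem ncard_triangles_eq_ncard_edgeLink {V : Type*} [DecidableEq V]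
    {Δ : AbstractSimplicialComplex V} {u v : V} (huv : u ≠ v) :
    {t : Finset V | t ∈ Δ.faces ∧ t.card = 3 ∧ {u, v} ⊆ t}.ncard = (edgeLink Δ u v).ncard := by
  rw [← image_edgeLink huv]
  refine Set.InjOn.ncard_image fun w ⟨hwu, hwv, _⟩ w' _ h => ?_
  have hw : w ∈ ({w', u, v} : Finset V) := h ▸ mem_insert_self w _
  simpa only [mem_insert, mem_singleton, hwu, hwv, or_false] using hw

variable {V : Type*} [Fintype V] [DecidableEq V] {Δ : AbstractSimplicialComplex V}

open scoped Matrix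

theorem card_le_rank_vertexMatrix_add_one (hΔ : IsPreconnected Δ.space) :
    Fintype.card V ≤ (vertexMatrix Δ).rank + 1 := by
  refine card_le_rank_add_one _ fun g hg => eq_of_forall_edge_eq hΔ fun u v he => ?_
  obtain rfl | huv := eq_or_ne u v
  · rfl
  · have hsum := congrFun hg ⟨{u, v}, he, card_pair huv⟩
    rw [vertexMatrix_mulVec_apply, sum_pair huv] at hsum
    exact CharTwo.add_eq_zero.1 hsum

theorem IsClosedAtEdges.card_filter_subset_triangleOf (hc : IsClosedAtEdges Δ) (e : EdgeOf Δ) :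
    #{t : TriangleOf Δ | e.1 ⊆ t.1} = 2 := by
  obtain ⟨u, v, huv, he⟩ := card_eq_two.1 e.2.2
  have hval : Subtype.val '' {t : TriangleOf Δ | e.1 ⊆ t.1} =
      {t : Finset V | t ∈ Δ.faces ∧ t.card = 3 ∧ {u, v} ⊆ t} := by
    ext t
    simp [he, and_assoc, and_left_comm, and_comm]
  rw [← Set.ncard_coe_finset, coe_filter_univ, ← Set.ncard_image_of_injective _
    Subtype.val_injective, hval, ncard_triangles_eq_ncard_edgeLink huv, hc u v huv (he ▸ e.2.1)]

theorem IsClosedAtEdges.card_triangleOf_mul_three (hc : IsClosedAtEdges Δ) :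
    Fintype.card (TriangleOf Δ) * 3 = Fintype.card (EdgeOf Δ) * 2 := by
  classical
  refine card_mul_eq_card_mul (fun (t : TriangleOf Δ) (e : EdgeOf Δ) => e.1 ⊆ t.1)
    (fun t _ => ?_) fun e _ => hc.card_filter_subset_triangleOf e
  rw [bipartiteAbove, ← card_map, map_filter_edgeOf_subset, card_powersetCard, t.2.2]
  rfl

theorem IsClosedAtEdges.eq_of_edgeMatrix_transpose_mulVec_eq_zero (hc : IsClosedAtEdges Δ)
    {z : TriangleOf Δ → ZMod 2} (hz : (edgeMatrix Δ)ᵀ *ᵥ z = 0) {e : EdgeOf Δ} {s t : TriangleOf Δ}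
    (hs : e.1 ⊆ s.1) (ht : e.1 ⊆ t.1) : z s = z t := by
  obtain rfl | hst := eq_or_ne s t
  · rfl
  have hpair : {s, t} = ({r | e.1 ⊆ r.1} : Finset (TriangleOf Δ)) :=
    eq_of_subset_of_card_le (by simp [insert_subset_iff, hs, ht])
      (by rw [hc.card_filter_subset_triangleOf, card_pair hst])
  have hsum := congrFun hz e
  simp only [Matrix.mulVec, dotProduct, Matrix.transpose_apply, edgeMatrix, ite_mul, one_mul,
    zero_mul, Pi.zero_apply] at hsum
  rw [← sum_filter, ← hpair, sum_pair hst] at hsum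
  exact CharTwo.add_eq_zero.1 hsum

theorem IsClosedAtEdges.card_triangleOf_le_rank_edgeMatrix_add_one (hc : IsClosedAtEdges Δ)
    (h3 : ∀ s ∈ Δ.faces, s.card ≤ 3)
    (hcon : IsPreconnected (Δ.space \ Set.range fun u : V => (Pi.single u 1 : V → ℝ))) :
    Fintype.card (TriangleOf Δ) ≤ (edgeMatrix Δ).rank + 1 := by
  rw [← Matrix.rank_transpose]
  refine card_le_rank_add_one _ fun z hz s t => ?_
  rw [← Subtype.val_injective.extend_apply z 0 s, ← Subtype.val_injective.extend_apply z 0 t]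
  refine eq_of_forall_adjacent_triangle_eq h3 hc hcon (fun r hr r' hr' hr3 hr3' hrr' => ?_)
    s.2.1 t.2.1 s.2.2 t.2.2
  obtain ⟨e, her, he⟩ := exists_subset_card_eq hrr'
  have hface : e ∈ Δ.faces :=
    (Δ.isRelLowerSet_faces hr).2 (her.trans inter_subset_left) (card_pos.1 (by lia))
  rw [Subtype.val_injective.extend_apply z 0 ⟨r, hr, hr3⟩,
    Subtype.val_injective.extend_apply z 0 ⟨r', hr', hr3'⟩]
  exact hc.eq_of_edgeMatrix_transpose_mulVec_eq_zero hz (e := ⟨e, hface, he⟩)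
    (her.trans inter_subset_left) (her.trans inter_subset_right)

/-- The Heawood inequality, with `k` a lower bound for the first Betti number modulo two. -/
theorem three_mul_card_add_three_mul_le_choose_add_six (h3 : ∀ s ∈ Δ.faces, s.card ≤ 3)
    (hc : IsClosedAtEdges Δ) (hΔ : IsPreconnected Δ.space)
    (hcon : IsPreconnected (Δ.space \ Set.range fun u : V => (Pi.single u 1 : V → ℝ)))
    {k : ℕ} {b : (Fin k → Bool) → V → V → ℤˣ} (hb : ∀ J, IsCocycle Δ (b J))
    (hinj : ∀ J J', IsCoboundary Δ (b J * b J') → J = J') :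
    3 * Fintype.card V + 3 * k ≤ (Fintype.card V).choose 2 + 6 := by
  have hrank := add_rank_vertexMatrix_add_rank_edgeMatrix_le hb hinj
  have hV := card_le_rank_vertexMatrix_add_one hΔ
  have hT := hc.card_triangleOf_le_rank_edgeMatrix_add_one h3 hcon
  have hTE := hc.card_triangleOf_mul_three
  have hE := card_edgeOf_le Δ
  lia

theorem ten_le_of_triangulates {n : ℕ} {Δ : AbstractSimplicialComplex (Fin n)}
    (hΔ : Δ.Triangulates (NonorientableSurface 6)) : 10 ≤ n := by
  obtain ⟨⟨h3, -⟩, ⟨f⟩⟩ := hΔ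
  obtain ⟨⟨h3₀, -⟩, ⟨f₀⟩⟩ := triangulates_tenVertexComplex
  have hc := isClosedAtEdges_of_homeomorph h3 h3₀ isClosedAtEdges_tenVertexComplex (f.trans f₀.symm)
  obtain ⟨Φ, hΦ, hΦinj⟩ := exists_cohomology_injection (f.trans f₀.symm)
  have hspace : IsPreconnected Δ.space :=
    Set.sdiff_empty (s := Δ.space) ▸ isPreconnected_space_diff_of_finite f Set.finite_empty
  have hchoose := three_mul_card_add_three_mul_le_choose_add_six h3 hc hspace
    (isPreconnected_space_diff_of_finite f (Set.finite_range _))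
    (fun J => hΦ _ (isCocycle_crossingProd J)) fun J J' hJ => eq_of_isCoboundary_crossingProd_mul
      (hΦinj _ _ (isCocycle_crossingProd J) (isCocycle_crossingProd J') hJ)
  rw [Fintype.card_fin] at hchoose
  contrapose! hchoose
  interval_cases n <;> decide

end VertexBound

theorem theorem7 :
    -- 10 is the minimal number of vertices of a triangulation of `N_6`
    IsLeast {n : ℕ | ∃ Δ : AbstractSimplicialComplex (Fin n),
      Δ.Triangulates (NonorientableSurface 6)} 10 ∧
    -- some 10-vertex triangulation has a polyhedral immersion with 2-fold rotational symmetry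
    (∃ Δ : AbstractSimplicialComplex (Fin 10), Δ.Triangulates (NonorientableSurface 6) ∧
      ∃ ψ : Fin 10 → EuclideanSpace ℝ (Fin 3),
        Δ.IsPolyhedralImmersion ψ ∧ Δ.HasRotationalSymmetry ψ 2) ∧
    -- 10 is the minimal number of vertices of a polyhedrally immersed triangulation of `N_6`
    IsLeast {n : ℕ | ∃ Δ : AbstractSimplicialComplex (Fin n),
      Δ.Triangulates (NonorientableSurface 6) ∧
      ∃ ψ : Fin n → EuclideanSpace ℝ (Fin 3), Δ.IsPolyhedralImmersion ψ} 10 := by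
  refine ⟨⟨⟨tenVertexComplex, triangulates_tenVertexComplex⟩, ?_⟩,
    ⟨tenVertexComplex, triangulates_tenVertexComplex, position, isPolyhedralImmersion_position,
      hasRotationalSymmetry_position⟩,
    ⟨tenVertexComplex, triangulates_tenVertexComplex, position, isPolyhedralImmersion_position⟩, ?_⟩
  · rintro n ⟨Δ, hΔ⟩
    exact ten_le_of_triangulates hΔ
  · rintro n ⟨Δ, hΔ, -⟩
    exact ten_le_of_triangulates hΔ
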